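/- Let $H:\mathbb{R}\times\mathbb{R}^d\times\mathbb{R}^d\to\mathbb{R}$, $(t,q,p)\mapsto H(t,q,p)$, be of class $C^2$, and suppose that there is a constant $C>0$ such that for all $(t,q,p)$ \[ \|\partial^2_{(q,p)}H(t,q,p)\|<C,\qquad \|\partial_{(q,p)}H(t,q,p)\|<C(1+\|p\|),\qquad |H(t,q,p)|<C(1+\|p\|)^2 . \] Let $C^{0,1}(\mathbb{R}^d)$ be the space of (globally) Lipschitz functions $\mathbb{R}^d\to\mathbb{R}$. For a family of operators $(V^t_s)_{0\le s\le t}$ from $C^{0,1}(\mathbb{R}^d)$ to itself consider the following properties. (1) Monotonicity: if $u\le v$, then $V^t_su\le V^t_sv$. (2) Additivity: $V^t_s(c+u)=c+V^t_su$ for all $c\in\mathbb{R}$. (3) Regularity: for each Lipschitz $u$ and $0\le s\le T$, the functions $V^t_su$, $t\in[s,T]$, are Lipschitz with a common constant, and $(t,q)\mapsto V^t_su(q)$ is locally Lipschitz on $(s,\infty)\times\mathbb{R}^d$. (4) Compatibility: if $a<b$ and $u$ is a Lipschitz $C^2$ solution of $\partial_tu+H(t,q,\partial_qu)=0$ on $[a,b]\times\mathbb{R}^d$,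 then $V^t_su_s=u_t$ for all $s\le t$ in $[a,b]$ with $s\ge0$, where $u_t=u(t,\cdot)$. (4') Variational property: for each Lipschitz $C^1$ function $u$, each $Q\in\mathbb{R}^d$ and $0\le s\le t$, there is a solution $\gamma=(q,p):\mathbb{R}\to\mathbb{R}^d\times\mathbb{R}^d$ of $\dot q=\partial_pH(\tau,q,p)$, $\dot p=-\partial_qH(\tau,q,p)$ with $p(s)=du(q(s))$, $q(t)=Q$ and \[ V^t_su(Q)=u(q(s))+\int_s^t\big(p(\tau)\cdot\dot q(\tau)-H(\tau,q(\tau),p(\tau))\big)\,d\tau . \] (5) Markov property: $V^t_s=V^t_r\circ V^r_s$ for $0\le s\le r\le t$. A viscosity operator is a family with (1), (2), (3), (4), (5). A variational operator is a family with (1), (2), (3), (4'). Theorem. There exists exactly one viscosity operator $(V^t_s)_{0\le s\le t}$ for $H$. Moreover, let $(R^t_s)_{0\le s\le t}$ be any variational operator for $H$ such that for all $0\le s\le s'\le t'\le t$, all $L\ge0$ and all $L$-Lipschitz functions $u,v$: - $R^t_su$ is Lipschitz with constant $e^{C(t-s)}(1+L)-1$; - $\|R^{t'}_su-R^t_su\|_\infty\le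 Ce^{2C(t-s)}(1+L)^2|t'-t|$; - $\|R^t_{s'}u-R^t_su\|_\infty\le C(1+L)^2|s'-s|$; - $|R^t_su(Q)-R^t_sv(Q)|\le\sup\{|u(q)-v(q)| : \|q-Q\|\le(e^{C(t-s)}-1)(1+L)\}$ for all $Q\in\mathbb{R}^d$. For each $N\in\mathbb{N}$ let $0=\tau^N_0\le\tau^N_1\le\cdots$ be a subdivision of $[0,\infty)$ with $\tau^N_i\to\infty$ as $i\to\infty$ and $\tau^N_{i+1}-\tau^N_i\le\delta_N$ for all $i$, where $\delta_N\to0$ as $N\to\infty$. For $t\ge0$ let $i_N(t)$ be the unique integer with $t\in[\tau^N_{i_N(t)},\tau^N_{i_N(t)+1})$, and for $0\le s\le t$ put \[ R^t_{s,N}u=R^{t}_{\tau^N_{i_N(t)}}R^{\tau^N_{i_N(t)}}_{\tau^N_{i_N(t)-1}}\cdots R^{\tau^N_{i_N(s)+1}}_{s}u , \] which means $R^t_su$ if $i_N(s)=i_N(t)$. Then for all $0\le s\le t$, every Lipschitz $u$ and every $Q\in\mathbb{R}^d$, $R^t_{s,N}u(Q)\to V^t_su(Q)$ as $N\to\infty$.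 Furthermore, for each Lipschitz $u$, the functions $(s,t,Q)\mapsto R^t_{s,N}u(Q)$ converge to $(s,t,Q)\mapsto V^t_su(Q)$ uniformly on every compact subset of $\{0\le s\le t\}\times\mathbb{R}^d$. -/

import Mathlib

open Set Filter
open scoped NNReal Topology

/-- Euclidean space `ℝ^d`. -/
abbrev Eucl (d : ℕ) : Type := EuclideanSpace ℝ (Fin d)

/-- The space of (globally) Lipschitz real functions on `ℝ^d`. -/
def LipFun (d : ℕ) : Type := {u : Eucl d → ℝ // ∃ K : ℝ≥0, LipschitzWith K u}

/-- The function `c + u`, for `u` Lipschitz and `c` a real constant. -/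
def LipFun.addConst {d : ℕ} (c : ℝ) (u : LipFun d) : LipFun d :=
  ⟨fun q => c + u.1 q, by
    obtain ⟨K, hK⟩ := u.2
    refine ⟨K, LipschitzWith.of_dist_le_mul fun x y => ?_⟩
    simpa using hK.dist_le_mul x y⟩

/-- A family of operators on Lipschitz functions; `V s t` stands for `V^t_s` (from time `s` to
time `t`). Only the values for `0 ≤ s ≤ t` are meaningful. -/
abbrev OpFamily (d : ℕ) : Type := ℝ → ℝ → LipFun d → LipFun d

/-- The Hamiltonian at time `t` as a function on `ℝ^d × ℝ^d = ℝ^{2d}` with the Euclidean norm. -/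
def phaseFun {d : ℕ} (H : ℝ → Eucl d → Eucl d → ℝ) (t : ℝ) : WithLp 2 (Eucl d × Eucl d) → ℝ :=
  fun x => H t x.fst x.snd

/-- `H` is of class `C²` in `(t, q, p)`, and at every point the second and first derivatives in
`(q, p)` and the value of `H` are bounded by `C`, `C (1 + ‖p‖)` and `C (1 + ‖p‖)²`. -/
structure HamiltonianBounds {d : ℕ} (H : ℝ → Eucl d → Eucl d → ℝ) (C : ℝ) : Prop where
  contDiff : ContDiff ℝ 2 (fun x : ℝ × Eucl d × Eucl d => H x.1 x.2.1 x.2.2)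
  pos : 0 < C
  second_lt : ∀ t q p, ‖fderiv ℝ (fderiv ℝ (phaseFun H t)) (WithLp.toLp 2 (q, p))‖ < C
  first_lt : ∀ t q p, ‖fderiv ℝ (phaseFun H t) (WithLp.toLp 2 (q, p))‖ < C * (1 + ‖p‖)
  abs_lt : ∀ t q p, |H t q p| < C * (1 + ‖p‖) ^ 2

/-- `u` is a `C²` solution on `[a, b] × ℝ^d` of `∂_t u + H(t, q, ∂_q u) = 0`
(one-sided derivatives in time at the ends of the interval). -/
structure IsClassicalSolution {d : ℕ} (H : ℝ → Eucl d → Eucl d → ℝ) (a b : ℝ)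
    (u : ℝ → Eucl d → ℝ) : Prop where
  contDiffOn : ContDiffOn ℝ 2 (fun x : ℝ × Eucl d => u x.1 x.2) (Icc a b ×ˢ univ)
  equation : ∀ t ∈ Icc a b, ∀ q : Eucl d,
    derivWithin (fun τ => u τ q) (Icc a b) t + H t q (gradient (u t) q) = 0

/-- Monotonicity. -/
def OpMonotone {d : ℕ} (V : OpFamily d) : Prop :=
  ∀ s t : ℝ, 0 ≤ s → s ≤ t → ∀ u v : LipFun d,
    (∀ q, u.1 q ≤ v.1 q) → ∀ q, (V s t u).1 q ≤ (V s t v).1 q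

/-- Additivity. -/
def OpAdditive {d : ℕ} (V : OpFamily d) : Prop :=
  ∀ s t : ℝ, 0 ≤ s → s ≤ t → ∀ (u : LipFun d) (c : ℝ),
    V s t (u.addConst c) = (V s t u).addConst c

/-- Regularity: Lipschitz in `q`, uniformly for bounded times, and locally Lipschitz in `(t, q)`
after the initial time. -/
def OpRegular {d : ℕ} (V : OpFamily d) : Prop :=
  ∀ (u : LipFun d) (s : ℝ), 0 ≤ s →
    (∀ T : ℝ, s ≤ T → ∃ K : ℝ≥0, ∀ t ∈ Icc s T, LipschitzWith K (V s t u).1) ∧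
    LocallyLipschitzOn (Ioi s ×ˢ univ) (fun x : ℝ × Eucl d => (V s x.1 u).1 x.2)

/-- Compatibility: Lipschitz `C²` solutions of the Hamilton-Jacobi equation (on a time interval
`[a, b]` of positive length) are propagated by the operator. -/
def OpCompatible {d : ℕ} (H : ℝ → Eucl d → Eucl d → ℝ) (V : OpFamily d) : Prop :=
  ∀ (a b : ℝ) (u : ℝ → Eucl d → ℝ), a < b → IsClassicalSolution H a b u →
    (∃ K : ℝ≥0, LipschitzOnWith K (fun x : ℝ × Eucl d => u x.1 x.2) (Icc a b ×ˢ univ)) →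
    ∀ s ∈ Icc a b, ∀ t ∈ Icc a b, 0 ≤ s → s ≤ t →
      ∀ w : LipFun d, w.1 = u s → (V s t w).1 = u t

/-- Markov property. -/
def OpMarkov {d : ℕ} (V : OpFamily d) : Prop :=
  ∀ s r t : ℝ, 0 ≤ s → s ≤ r → r ≤ t → ∀ u : LipFun d, V s t u = V r t (V s r u)

/-- Viscosity operators of the Hamilton-Jacobi equation of `H`. -/
structure IsViscosityOperator {d : ℕ} (H : ℝ → Eucl d → Eucl d → ℝ) (V : OpFamily d) :
    Prop where
  monotone : OpMonotone V
  additive : OpAdditive V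
  regular : OpRegular V
  compatible : OpCompatible H V
  markov : OpMarkov V

/-- `τ ↦ (q τ, p τ)` solves the Hamiltonian system `q' = ∂_p H`, `p' = -∂_q H` on `ℝ`. -/
def IsHamiltonianTrajectory {d : ℕ} (H : ℝ → Eucl d → Eucl d → ℝ) (q p : ℝ → Eucl d) : Prop :=
  ∀ τ : ℝ, HasDerivAt q (gradient (fun y => H τ (q τ) y) (p τ)) τ ∧
    HasDerivAt p (-gradient (fun x => H τ x (p τ)) (q τ)) τ

/-- The Hamiltonian action of the path `(q, p)` between the times `s` and `t`. -/
noncomputable def hamiltonianAction {d : ℕ} (H : ℝ → Eucl d → Eucl d → ℝ) (q p : ℝ → Eucl d)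
    (s t : ℝ) : ℝ :=
  ∫ τ in s..t, (inner ℝ (p τ) (deriv q τ) - H τ (q τ) (p τ))

/-- Variational property: for `u` Lipschitz and `C¹`, the value at `Q` is obtained from `u` by the
action along a Hamiltonian trajectory that starts on the graph of `du` at time `s` and reaches `Q`
at time `t`. -/
def OpVariational {d : ℕ} (H : ℝ → Eucl d → Eucl d → ℝ) (R : OpFamily d) : Prop :=
  ∀ s t : ℝ, 0 ≤ s → s ≤ t → ∀ u : LipFun d, ContDiff ℝ 1 u.1 → ∀ Q : Eucl d,
    ∃ q p : ℝ → Eucl d, IsHamiltonianTrajectory H q p ∧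
      p s = gradient u.1 (q s) ∧ q t = Q ∧
      (R s t u).1 Q = u.1 (q s) + hamiltonianAction H q p s t

/-- Variational operators of the Hamilton-Jacobi equation of `H`. -/
structure IsVariationalOperator {d : ℕ} (H : ℝ → Eucl d → Eucl d → ℝ) (R : OpFamily d) :
    Prop where
  monotone : OpMonotone R
  additive : OpAdditive R
  regular : OpRegular R
  variational : OpVariational H R

/-- The four Lipschitz estimates with constant `C`, for all `0 ≤ s ≤ s' ≤ t' ≤ t` and all
`L`-Lipschitz functions `u`, `v`. In the last one, an arbitrary bound `M` of `|u - v|` on the closed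
ball stands for the supremum of `|u - v|` over this ball. -/
structure LipschitzEstimates {d : ℕ} (C : ℝ) (R : OpFamily d) : Prop where
  space : ∀ (L : ℝ≥0) (u : LipFun d), LipschitzWith L u.1 → ∀ s t : ℝ, 0 ≤ s → s ≤ t →
    ∀ x y : Eucl d,
      |(R s t u).1 x - (R s t u).1 y| ≤ (Real.exp (C * (t - s)) * (1 + L) - 1) * ‖x - y‖
  finalTime : ∀ (L : ℝ≥0) (u : LipFun d), LipschitzWith L u.1 →
    ∀ s t' t : ℝ, 0 ≤ s → s ≤ t' → t' ≤ t → ∀ Q : Eucl d,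
      |(R s t' u).1 Q - (R s t u).1 Q|
        ≤ C * Real.exp (2 * C * (t - s)) * (1 + L) ^ 2 * |t' - t|
  initialTime : ∀ (L : ℝ≥0) (u : LipFun d), LipschitzWith L u.1 →
    ∀ s s' t : ℝ, 0 ≤ s → s ≤ s' → s' ≤ t → ∀ Q : Eucl d,
      |(R s' t u).1 Q - (R s t u).1 Q| ≤ C * (1 + L) ^ 2 * |s' - s|
  locality : ∀ (L : ℝ≥0) (u v : LipFun d), LipschitzWith L u.1 → LipschitzWith L v.1 →
    ∀ s t : ℝ, 0 ≤ s → s ≤ t → ∀ (Q : Eucl d) (M : ℝ),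
      (∀ q ∈ Metric.closedBall Q ((Real.exp (C * (t - s)) - 1) * (1 + L)),
        |u.1 q - v.1 q| ≤ M) →
      |(R s t u).1 Q - (R s t v).1 Q| ≤ M

/-- A subdivision `0 = τ 0 ≤ τ 1 ≤ ⋯` of `[0, ∞)`. -/
structure IsSubdivision (τ : ℕ → ℝ) : Prop where
  zero : τ 0 = 0
  monotone : Monotone τ
  tendsto : Tendsto τ atTop atTop

/-- The index `i` with `t ∈ [τ i, τ (i + 1))`; see `gridIndex_spec`. -/
noncomputable def gridIndex (τ : ℕ → ℝ) (t : ℝ) : ℕ := sSup {i : ℕ | τ i ≤ t}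

theorem gridIndex_spec {τ : ℕ → ℝ} (hτ : IsSubdivision τ) {t : ℝ} (ht : 0 ≤ t) :
    τ (gridIndex τ t) ≤ t ∧ t < τ (gridIndex τ t + 1) := by
  obtain ⟨n, hn⟩ := (hτ.tendsto.eventually_gt_atTop t).exists
  have hb : BddAbove {i : ℕ | τ i ≤ t} :=
    ⟨n, fun i hi => le_of_not_gt fun h =>
      absurd (lt_of_lt_of_le hn (hτ.monotone h.le)) (not_lt.2 hi)⟩
  have h0 : ({i : ℕ | τ i ≤ t}).Nonempty := ⟨0, by simpa [hτ.zero] using ht⟩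
  refine ⟨Nat.sSup_mem h0 hb, lt_of_not_ge fun h => ?_⟩
  have h1 : gridIndex τ t + 1 ≤ gridIndex τ t := le_csSup hb h
  omega

/-- The composition `R^t_{τ_{j+n}} R^{τ_{j+n}}_{τ_{j+n-1}} ⋯ R^{τ_{j+1}}_s u`, which has `n`
intermediate times (it is `R^t_s u` if `n = 0`). -/
def iterSteps {d : ℕ} (R : OpFamily d) (τ : ℕ → ℝ) (s : ℝ) (j : ℕ) (u : LipFun d) :
    ℕ → ℝ → LipFun d
  | 0, t => R s t u
  | n + 1, t => R (τ (j + n + 1)) t (iterSteps R τ s j u n (τ (j + n + 1)))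

/-- The operator `R` iterated from time `s` to time `t` along the subdivision `τ`:
`R^t_{τ_{i(t)}} R^{τ_{i(t)}}_{τ_{i(t)-1}} ⋯ R^{τ_{i(s)+1}}_s`. -/
noncomputable def iteratedOp {d : ℕ} (R : OpFamily d) (τ : ℕ → ℝ) : OpFamily d :=
  fun s t u => iterSteps R τ s (gridIndex τ s) u (gridIndex τ t - gridIndex τ s) t

/-! Every family of functions in the theorem is viewed as a finite sequence along a time grid,
Lipschitz in space and time, that satisfies the viscosity inequalities for sub- and supersolutions
up to a small error (`ApproxSol`). These inequalities are tested only with paraboloids of a fixed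
opening `K`, at points of a ball of radius `ρ`. This is all that doubling of variables needs:
`exists_comparison` shows that two such sequences, possibly on different grids, keep the order of
their initial values at the final time up to `η` on a given ball. So approximate solutions with
equal initial values are close.

Four kinds of sequences are approximate solutions on fine grids: (a) the iterates of an explicit
monotone inf-sup scheme, (b) the samples of a Lipschitz classical solution, (c) the values `W s t u`
of any viscosity operator, (d) the iterates of a variational operator. Comparing (a) with itself
shows that the scheme converges, and its limit is the operator `viscOp`. Comparison also gives
monotonicity and additivity. The Markov property holds because the scheme can be restarted.
Comparing (a) with (b) gives compatibility, (a) with (c) gives uniqueness, and (a) with (d) gives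
the convergence of the iterates, uniformly for bounded times and positions.

For (c) and (d), monotonicity and additivity reduce the inequalities to the action of one short
step, at `Q`, on the functions `testFun Q p M`. These have slope `p` at `Q`, dominate any Lipschitz
function lying below a paraboloid at `Q`, and have Lipschitz gradients. On them a step returns the
value carried by a Hamiltonian characteristic ending at `Q` (`TestVariational`), which is `-h H` to
first order in the length `h`. For variational operators this is property (4'). For viscosity
operators it follows from compatibility, because the method of characteristics
(`exists_classicalSolution`) produces a Lipschitz `C²` solution issued from the test function. There
the characteristics are fixed points of a `C¹` contraction on a path space, and the first variation
of the action shows that the value has derivative `(-H, p)`, which is `C¹`. -/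

open Set Filter
open scoped NNReal Topology

/-! ### Estimates on the Hamiltonian -/

section Hamiltonian

variable {d : ℕ} {H : ℝ → Eucl d → Eucl d → ℝ} {C : ℝ}

/-- The gradient of the Hamiltonian in the momentum variable. -/
noncomputable def gradP (H : ℝ → Eucl d → Eucl d → ℝ) (t : ℝ) (q p : Eucl d) : Eucl d :=
  gradient (fun y => H t q y) p

/-- The gradient of the Hamiltonian in the position variable. -/
noncomputable def gradQ (H : ℝ → Eucl d → Eucl d → ℝ) (t : ℝ) (q p : Eucl d) : Eucl d :=
  gradient (fun x => H t x p) q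

theorem norm_le_of_inner_le {v : Eucl d} {B : ℝ} (hB : 0 ≤ B)
    (h : ∀ w, inner ℝ v w ≤ B * ‖w‖) : ‖v‖ ≤ B := by
  have := h v
  rw [real_inner_self_eq_norm_sq] at this
  rcases (norm_nonneg v).eq_or_lt with h0 | h0
  · rwa [← h0]
  · nlinarith

namespace HamiltonianBounds

theorem contDiff_phaseFun (hH : HamiltonianBounds H C) (t : ℝ) : ContDiff ℝ 2 (phaseFun H t) := by
  have h : ContDiff ℝ 2 fun x : WithLp 2 (Eucl d × Eucl d) => (t, x.fst, x.snd) :=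
    contDiff_const.prodMk ((WithLp.fstL 2 ℝ (Eucl d) (Eucl d)).contDiff.prodMk
      (WithLp.sndL 2 ℝ (Eucl d) (Eucl d)).contDiff)
  exact hH.contDiff.comp h

theorem hasFDerivAt_snd (hH : HamiltonianBounds H C) (t : ℝ) (q p : Eucl d) :
    HasFDerivAt (fun y => H t q y) ((fderiv ℝ (phaseFun H t) (WithLp.toLp 2 (q, p))).comp
      ((WithLp.prodContinuousLinearEquiv 2 ℝ (Eucl d) (Eucl d)).symm.toContinuousLinearMap.comp
        (ContinuousLinearMap.inr ℝ (Eucl d) (Eucl d)))) p := by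
  have h1 := ((hH.contDiff_phaseFun t).differentiable (by norm_num)
    (WithLp.toLp 2 (q, p))).hasFDerivAt
  have h2 : HasFDerivAt (fun y => WithLp.toLp 2 (q, y))
      ((WithLp.prodContinuousLinearEquiv 2 ℝ (Eucl d) (Eucl d)).symm.toContinuousLinearMap.comp
        (ContinuousLinearMap.inr ℝ (Eucl d) (Eucl d))) p :=
    (WithLp.prodContinuousLinearEquiv 2 ℝ (Eucl d) (Eucl d)).symm.hasFDerivAt.comp p
      (hasFDerivAt_prodMk_right q p)
  exact h1.comp p h2

theorem hasFDerivAt_fst (hH : HamiltonianBounds H C) (t : ℝ) (q p : Eucl d) :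
    HasFDerivAt (fun x => H t x p) ((fderiv ℝ (phaseFun H t) (WithLp.toLp 2 (q, p))).comp
      ((WithLp.prodContinuousLinearEquiv 2 ℝ (Eucl d) (Eucl d)).symm.toContinuousLinearMap.comp
        (ContinuousLinearMap.inl ℝ (Eucl d) (Eucl d)))) q := by
  have h1 := ((hH.contDiff_phaseFun t).differentiable (by norm_num)
    (WithLp.toLp 2 (q, p))).hasFDerivAt
  have h2 : HasFDerivAt (fun y => WithLp.toLp 2 (y, p))
      ((WithLp.prodContinuousLinearEquiv 2 ℝ (Eucl d) (Eucl d)).symm.toContinuousLinearMap.comp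
        (ContinuousLinearMap.inl ℝ (Eucl d) (Eucl d))) q :=
    (WithLp.prodContinuousLinearEquiv 2 ℝ (Eucl d) (Eucl d)).symm.hasFDerivAt.comp q
      (hasFDerivAt_prodMk_left q p)
  exact h1.comp q h2

theorem inner_gradP (hH : HamiltonianBounds H C) (t : ℝ) (q p v : Eucl d) :
    inner ℝ (gradP H t q p) v =
      fderiv ℝ (phaseFun H t) (WithLp.toLp 2 (q, p)) (WithLp.toLp 2 (0, v)) := by
  rw [gradP, inner_gradient_left, (hH.hasFDerivAt_snd t q p).fderiv]
  rfl

theorem inner_gradQ (hH : HamiltonianBounds H C) (t : ℝ) (q p v : Eucl d) :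
    inner ℝ (gradQ H t q p) v =
      fderiv ℝ (phaseFun H t) (WithLp.toLp 2 (q, p)) (WithLp.toLp 2 (v, 0)) := by
  rw [gradQ, inner_gradient_left, (hH.hasFDerivAt_fst t q p).fderiv]
  rfl

theorem hasGradientAt_gradP (hH : HamiltonianBounds H C) (t : ℝ) (q p : Eucl d) :
    HasGradientAt (fun y => H t q y) (gradP H t q p) p :=
  (hH.hasFDerivAt_snd t q p).differentiableAt.hasGradientAt

theorem hasGradientAt_gradQ (hH : HamiltonianBounds H C) (t : ℝ) (q p : Eucl d) :
    HasGradientAt (fun x => H t x p) (gradQ H t q p) q :=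
  (hH.hasFDerivAt_fst t q p).differentiableAt.hasGradientAt

theorem norm_gradP_le (hH : HamiltonianBounds H C) (t : ℝ) (q p : Eucl d) :
    ‖gradP H t q p‖ ≤ C * (1 + ‖p‖) := by
  have hC := hH.pos
  refine norm_le_of_inner_le (by positivity) fun w => ?_
  rw [hH.inner_gradP]
  refine (Real.le_norm_self _).trans ((ContinuousLinearMap.le_opNorm _ _).trans ?_)
  rw [WithLp.norm_toLp_snd]
  gcongr
  exact (hH.first_lt t q p).le

theorem norm_gradQ_le (hH : HamiltonianBounds H C) (t : ℝ) (q p : Eucl d) :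
    ‖gradQ H t q p‖ ≤ C * (1 + ‖p‖) := by
  have hC := hH.pos
  refine norm_le_of_inner_le (by positivity) fun w => ?_
  rw [hH.inner_gradQ]
  refine (Real.le_norm_self _).trans ((ContinuousLinearMap.le_opNorm _ _).trans ?_)
  rw [WithLp.norm_toLp_fst]
  gcongr
  exact (hH.first_lt t q p).le

theorem norm_toLp_le (q p : Eucl d) : ‖WithLp.toLp 2 (q, p)‖ ≤ ‖q‖ + ‖p‖ := by
  have h : WithLp.toLp 2 (q, p) = WithLp.toLp 2 (q, 0) + WithLp.toLp 2 (0, p) := by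
    rw [← WithLp.toLp_add]; simp
  rw [h]
  refine (norm_add_le _ _).trans ?_
  rw [WithLp.norm_toLp_fst, WithLp.norm_toLp_snd]

theorem norm_fderiv_sub_le (hH : HamiltonianBounds H C) (t : ℝ) (q p q' p' : Eucl d) :
    ‖fderiv ℝ (phaseFun H t) (WithLp.toLp 2 (q, p)) -
      fderiv ℝ (phaseFun H t) (WithLp.toLp 2 (q', p'))‖ ≤ C * (‖q - q'‖ + ‖p - p'‖) := by
  have h1 : ContDiff ℝ 1 (fderiv ℝ (phaseFun H t)) :=
    (hH.contDiff_phaseFun t).fderiv_right (by norm_num)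
  have h2 := Convex.norm_image_sub_le_of_norm_fderiv_le (𝕜 := ℝ) (C := C)
    (fun x _ => (h1.differentiable (by norm_num)) x)
    (fun x _ => (hH.second_lt t x.fst x.snd).le) convex_univ
    (mem_univ (WithLp.toLp 2 (q', p'))) (mem_univ (WithLp.toLp 2 (q, p)))
  refine h2.trans (mul_le_mul_of_nonneg_left ?_ hH.pos.le)
  rw [← WithLp.toLp_sub]
  exact norm_toLp_le _ _

theorem norm_gradP_sub_le (hH : HamiltonianBounds H C) (t : ℝ) (q p q' p' : Eucl d) :
    ‖gradP H t q p - gradP H t q' p'‖ ≤ C * (‖q - q'‖ + ‖p - p'‖) := by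
  have hC := hH.pos
  refine norm_le_of_inner_le (by positivity) fun w => ?_
  rw [inner_sub_left, hH.inner_gradP, hH.inner_gradP, ← sub_apply]
  refine (Real.le_norm_self _).trans ((ContinuousLinearMap.le_opNorm _ _).trans ?_)
  rw [WithLp.norm_toLp_snd]
  gcongr
  exact hH.norm_fderiv_sub_le t q p q' p'

theorem norm_gradQ_sub_le (hH : HamiltonianBounds H C) (t : ℝ) (q p q' p' : Eucl d) :
    ‖gradQ H t q p - gradQ H t q' p'‖ ≤ C * (‖q - q'‖ + ‖p - p'‖) := by
  have hC := hH.pos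
  refine norm_le_of_inner_le (by positivity) fun w => ?_
  rw [inner_sub_left, hH.inner_gradQ, hH.inner_gradQ, ← sub_apply]
  refine (Real.le_norm_self _).trans ((ContinuousLinearMap.le_opNorm _ _).trans ?_)
  rw [WithLp.norm_toLp_fst]
  gcongr
  exact hH.norm_fderiv_sub_le t q p q' p'

theorem abs_sub_le_fst (hH : HamiltonianBounds H C) (t : ℝ) (q q' p : Eucl d) :
    |H t q p - H t q' p| ≤ C * (1 + ‖p‖) * ‖q - q'‖ := by
  refine Convex.norm_image_sub_le_of_norm_hasFDerivWithin_le (𝕜 := ℝ) (f := fun x => H t x p)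
    (fun x _ => (hH.hasGradientAt_gradQ t x p).hasFDerivAt.hasFDerivWithinAt)
    (fun x _ => ?_) convex_univ (mem_univ q') (mem_univ q)
  rw [LinearIsometryEquiv.norm_map]
  exact hH.norm_gradQ_le t x p

/-- The gradient bound grows with the momentum, so the mean value inequality is applied on the
convex ball of radius `B`. -/
theorem abs_sub_le_snd (hH : HamiltonianBounds H C) (t : ℝ) (q : Eucl d) {p p' : Eucl d} {B : ℝ}
    (hp : ‖p‖ ≤ B) (hp' : ‖p'‖ ≤ B) : |H t q p - H t q p'| ≤ C * (1 + B) * ‖p - p'‖ := by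
  refine Convex.norm_image_sub_le_of_norm_hasFDerivWithin_le (𝕜 := ℝ) (f := fun x => H t q x)
    (s := Metric.closedBall 0 B)
    (fun x _ => (hH.hasGradientAt_gradP t q x).hasFDerivAt.hasFDerivWithinAt)
    (fun x hx => ?_) (convex_closedBall 0 B) (by simpa using hp') (by simpa using hp)
  rw [LinearIsometryEquiv.norm_map]
  refine (hH.norm_gradP_le t q x).trans (mul_le_mul_of_nonneg_left ?_ hH.pos.le)
  have : ‖x‖ ≤ B := by simpa using hx
  linarith

theorem abs_sub_le (hH : HamiltonianBounds H C) (t : ℝ) (q q' : Eucl d) {p p' : Eucl d} {B : ℝ}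
    (hp : ‖p‖ ≤ B) (hp' : ‖p'‖ ≤ B) :
    |H t q p - H t q' p'| ≤ C * (1 + B) * (‖q - q'‖ + ‖p - p'‖) := by
  have h1 := hH.abs_sub_le_fst t q q' p
  have h2 := hH.abs_sub_le_snd t q' hp hp'
  have h3 := _root_.abs_sub_le (H t q p) (H t q' p) (H t q' p')
  have h4 : C * (1 + ‖p‖) * ‖q - q'‖ ≤ C * (1 + B) * ‖q - q'‖ := by
    have := hH.pos
    gcongr
  linarith

theorem abs_le_of_norm_le (hH : HamiltonianBounds H C) (t : ℝ) (q : Eucl d) {p : Eucl d} {B : ℝ}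
    (hp : ‖p‖ ≤ B) : |H t q p| ≤ C * (1 + B) ^ 2 := by
  refine (hH.abs_lt t q p).le.trans ?_
  have := hH.pos
  gcongr

theorem hasFDerivAt_uncurry (hH : HamiltonianBounds H C) (x : ℝ × Eucl d × Eucl d) :
    HasFDerivAt (fun x : ℝ × Eucl d × Eucl d => H x.1 x.2.1 x.2.2)
      (fderiv ℝ (fun x : ℝ × Eucl d × Eucl d => H x.1 x.2.1 x.2.2) x) x :=
  ((hH.contDiff.differentiable (by norm_num)) x).hasFDerivAt

theorem fderiv_apply_snd_snd (hH : HamiltonianBounds H C) (t : ℝ) (q p v : Eucl d) :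
    fderiv ℝ (fun x : ℝ × Eucl d × Eucl d => H x.1 x.2.1 x.2.2) (t, q, p) (0, 0, v) =
      inner ℝ (gradP H t q p) v := by
  have h1 := (hH.hasFDerivAt_uncurry (t, q, p)).comp p
    ((hasFDerivAt_prodMk_right t (q, p)).comp p (hasFDerivAt_prodMk_right q p))
  have h2 := (hH.hasGradientAt_gradP t q p).hasFDerivAt.unique h1
  exact (congrArg (fun L => L v) h2).symm

theorem fderiv_apply_snd_fst (hH : HamiltonianBounds H C) (t : ℝ) (q p v : Eucl d) :
    fderiv ℝ (fun x : ℝ × Eucl d × Eucl d => H x.1 x.2.1 x.2.2) (t, q, p) (0, v, 0) =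
      inner ℝ (gradQ H t q p) v := by
  have h1 := (hH.hasFDerivAt_uncurry (t, q, p)).comp q
    ((hasFDerivAt_prodMk_right t (q, p)).comp (f := fun x => (x, p)) q
      (hasFDerivAt_prodMk_left q p))
  have h2 := (hH.hasGradientAt_gradQ t q p).hasFDerivAt.unique h1
  exact (congrArg (fun L => L v) h2).symm

/-- The partial gradient is a continuous linear image of the total derivative of `H`, hence jointly
`C¹` in time, position and momentum. -/
theorem contDiff_gradP (hH : HamiltonianBounds H C) :
    ContDiff ℝ 1 (fun x : ℝ × Eucl d × Eucl d => gradP H x.1 x.2.1 x.2.2) := by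
  have h1 : ContDiff ℝ 1 (fderiv ℝ (fun x : ℝ × Eucl d × Eucl d => H x.1 x.2.1 x.2.2)) :=
    hH.contDiff.fderiv_right (by norm_num)
  have h2 : (fun x : ℝ × Eucl d × Eucl d => gradP H x.1 x.2.1 x.2.2) = fun x =>
      (InnerProductSpace.toDual ℝ (Eucl d)).symm
        ((fderiv ℝ (fun x : ℝ × Eucl d × Eucl d => H x.1 x.2.1 x.2.2) x).comp
          ((ContinuousLinearMap.inr ℝ ℝ (Eucl d × Eucl d)).comp
            (ContinuousLinearMap.inr ℝ (Eucl d) (Eucl d)))) := by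
    funext x
    refine ext_inner_right ℝ fun v => ?_
    rw [InnerProductSpace.toDual_symm_apply]
    exact (hH.fderiv_apply_snd_snd x.1 x.2.1 x.2.2 v).symm
  rw [h2]
  exact (InnerProductSpace.toDual ℝ (Eucl d)).symm.contDiff.comp (h1.clm_comp contDiff_const)

theorem contDiff_gradQ (hH : HamiltonianBounds H C) :
    ContDiff ℝ 1 (fun x : ℝ × Eucl d × Eucl d => gradQ H x.1 x.2.1 x.2.2) := by
  have h1 : ContDiff ℝ 1 (fderiv ℝ (fun x : ℝ × Eucl d × Eucl d => H x.1 x.2.1 x.2.2)) :=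
    hH.contDiff.fderiv_right (by norm_num)
  have h2 : (fun x : ℝ × Eucl d × Eucl d => gradQ H x.1 x.2.1 x.2.2) = fun x =>
      (InnerProductSpace.toDual ℝ (Eucl d)).symm
        ((fderiv ℝ (fun x : ℝ × Eucl d × Eucl d => H x.1 x.2.1 x.2.2) x).comp
          ((ContinuousLinearMap.inr ℝ ℝ (Eucl d × Eucl d)).comp
            (ContinuousLinearMap.inl ℝ (Eucl d) (Eucl d)))) := by
    funext x
    refine ext_inner_right ℝ fun v => ?_
    rw [InnerProductSpace.toDual_symm_apply]
    exact (hH.fderiv_apply_snd_fst x.1 x.2.1 x.2.2 v).symm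
  rw [h2]
  exact (InnerProductSpace.toDual ℝ (Eucl d)).symm.contDiff.comp (h1.clm_comp contDiff_const)

/-- The bounds say nothing about time derivatives of `H`. Dependence on `t` is controlled only by
uniform continuity on compact sets, which is why the consistency estimates below are confined to
balls of positions. -/
theorem exists_abs_sub_lt (hH : HamiltonianBounds H C) (a b ρ B : ℝ) {ε : ℝ} (hε : 0 < ε) :
    ∃ δ > 0, ∀ t ∈ Icc a b, ∀ t' ∈ Icc a b, ∀ q q' p : Eucl d, ‖q‖ ≤ ρ → ‖q'‖ ≤ ρ → ‖p‖ ≤ B →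
      |t - t'| ≤ δ → ‖q - q'‖ ≤ δ → |H t q p - H t' q' p| < ε := by
  have hK : IsCompact (Icc a b ×ˢ (Metric.closedBall (0 : Eucl d) ρ ×ˢ
      Metric.closedBall (0 : Eucl d) B)) :=
    isCompact_Icc.prod ((isCompact_closedBall _ _).prod (isCompact_closedBall _ _))
  have hu := hK.uniformContinuousOn_of_continuous hH.contDiff.continuous.continuousOn
  obtain ⟨δ, hδ, h⟩ := Metric.uniformContinuousOn_iff.1 hu ε hε
  refine ⟨δ / 2, half_pos hδ, fun t ht t' ht' q q' p hq hq' hp htt hqq => ?_⟩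
  refine h (t, q, p) ⟨ht, by simpa using hq, by simpa using hp⟩ (t', q', p)
    ⟨ht', by simpa using hq', by simpa using hp⟩ ?_
  rw [Prod.dist_eq, Prod.dist_eq, Real.dist_eq, dist_eq_norm, dist_self]
  exact max_lt (by linarith) (max_lt (by linarith) hδ)

end HamiltonianBounds
end Hamiltonian

/-! ### Test functions -/

section TestFunctions

variable {d : ℕ}

/-- The smooth Lipschitz function `q ↦ ⟪p, q - Q⟫ + M (√(1 + ‖q - Q‖²) - 1)`. -/
noncomputable def testFun (Q p : Eucl d) (M : ℝ) (q : Eucl d) : ℝ :=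
  inner ℝ p (q - Q) + M * (√(1 + ‖q - Q‖ ^ 2) - 1)

theorem one_le_sqrt_one_add_sq (r : ℝ) : 1 ≤ √(1 + r ^ 2) :=
  Real.one_le_sqrt.2 (by nlinarith [sq_nonneg r])

theorem sqrt_one_add_sq_sub_one_le (r : ℝ) : √(1 + r ^ 2) - 1 ≤ r ^ 2 / 2 := by
  have h := one_le_sqrt_one_add_sq r
  have h2 := Real.sq_sqrt (show (0 : ℝ) ≤ 1 + r ^ 2 by positivity)
  nlinarith

theorem abs_sqrt_sub_sqrt_le (r s : ℝ) : |√(1 + r ^ 2) - √(1 + s ^ 2)| ≤ |r - s| := by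
  have h1 := Real.sq_sqrt (show (0 : ℝ) ≤ 1 + r ^ 2 by positivity)
  have h2 := Real.sq_sqrt (show (0 : ℝ) ≤ 1 + s ^ 2 by positivity)
  refine sq_le_sq.1 ?_
  have h3 : 1 + r * s ≤ √(1 + r ^ 2) * √(1 + s ^ 2) := by
    rw [← Real.sqrt_mul (by positivity)]
    refine Real.le_sqrt_of_sq_le ?_
    nlinarith [sq_nonneg (r - s)]
  nlinarith

theorem contDiff_testFun (Q p : Eucl d) (M : ℝ) {n : WithTop ℕ∞} :
    ContDiff ℝ n (testFun Q p M) := by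
  unfold testFun
  have h : ContDiff ℝ n fun q : Eucl d => √(1 + ‖q - Q‖ ^ 2) :=
    (contDiff_const.add ((contDiff_id.sub contDiff_const).norm_sq ℝ)).sqrt
      fun q => by positivity
  exact (contDiff_const.inner ℝ (contDiff_id.sub contDiff_const)).add
    (contDiff_const.mul (h.sub contDiff_const))

theorem hasGradientAt_testFun (Q p : Eucl d) (M : ℝ) (q : Eucl d) :
    HasGradientAt (testFun Q p M) (p + (M / √(1 + ‖q - Q‖ ^ 2)) • (q - Q)) q := by
  rw [hasGradientAt_iff_hasFDerivAt]
  have h0 : (0 : ℝ) < √(1 + ‖q - Q‖ ^ 2) := by positivity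
  have h1 : HasFDerivAt (fun q : Eucl d => q - Q) (ContinuousLinearMap.id ℝ (Eucl d)) q :=
    (hasFDerivAt_id q).sub_const Q
  have h2 := ((h1.norm_sq).const_add 1).sqrt (by positivity)
  have h3 := ((hasFDerivAt_const p q).inner ℝ h1).add ((h2.sub_const 1).const_mul M)
  refine h3.congr_fderiv ?_
  ext v
  simp
  field_simp

theorem gradient_testFun (Q p : Eucl d) (M : ℝ) (q : Eucl d) :
    gradient (testFun Q p M) q = p + (M / √(1 + ‖q - Q‖ ^ 2)) • (q - Q) :=
  (hasGradientAt_testFun Q p M q).gradient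

theorem norm_gradient_testFun_sub_le (Q p : Eucl d) (M : ℝ) (q : Eucl d) :
    ‖gradient (testFun Q p M) q - p‖ ≤ |M| * ‖q - Q‖ := by
  rw [gradient_testFun, add_sub_cancel_left, norm_smul, norm_div, Real.norm_eq_abs,
    Real.norm_of_nonneg (Real.sqrt_nonneg _)]
  gcongr
  exact div_le_self (abs_nonneg _) (one_le_sqrt_one_add_sq _)

theorem norm_gradient_testFun_le (Q p : Eucl d) (M : ℝ) (q : Eucl d) :
    ‖gradient (testFun Q p M) q‖ ≤ ‖p‖ + |M| := by
  rw [gradient_testFun]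
  refine (norm_add_le _ _).trans (add_le_add_right ?_ _)
  have h0 : (0 : ℝ) < √(1 + ‖q - Q‖ ^ 2) := by positivity
  rw [norm_smul, norm_div, Real.norm_eq_abs, Real.norm_of_nonneg (Real.sqrt_nonneg _),
    div_mul_eq_mul_div, div_le_iff₀ h0]
  gcongr
  exact Real.le_sqrt_of_sq_le (by linarith)

/-- With `X = x - Q`, the gradient is `p` plus `M X / √(1 + ‖X‖²)`. The difference is split into the
change of `X` at a fixed weight and the change of the weight, each at most `|M| ‖x - y‖`. This
global bound makes the method of characteristics work for a uniform time. -/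
theorem norm_gradient_testFun_sub_gradient_le (Q p : Eucl d) (M : ℝ) (x y : Eucl d) :
    ‖gradient (testFun Q p M) x - gradient (testFun Q p M) y‖ ≤ 2 * |M| * ‖x - y‖ := by
  rw [gradient_testFun, gradient_testFun]
  set X := x - Q
  set Y := y - Q
  have hxy : x - y = X - Y := by simp [X, Y]
  have h1 := one_le_sqrt_one_add_sq ‖X‖
  have h2 := one_le_sqrt_one_add_sq ‖Y‖
  have h3 := (abs_sqrt_sub_sqrt_le ‖Y‖ ‖X‖).trans (abs_norm_sub_norm_le Y X)
  have h4 : ‖Y‖ ≤ √(1 + ‖Y‖ ^ 2) := Real.le_sqrt_of_sq_le (by linarith)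
  set α := √(1 + ‖X‖ ^ 2)
  set β := √(1 + ‖Y‖ ^ 2)
  have hα : 0 < α := by linarith
  have hβ : 0 < β := by linarith
  have key : p + (M / α) • X - (p + (M / β) • Y) =
      (M / α) • (X - Y) + (M * ((β - α) / (α * β))) • Y := by
    have : M * ((β - α) / (α * β)) = M / α - M / β := by field_simp
    rw [this]
    module
  rw [key, hxy]
  have e1 : ‖(M / α) • (X - Y)‖ ≤ |M| * ‖X - Y‖ := by
    rw [norm_smul, norm_div, Real.norm_eq_abs, Real.norm_of_nonneg hα.le]
    gcongr
    exact div_le_self (abs_nonneg _) h1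
  have e2 : ‖(M * ((β - α) / (α * β))) • Y‖ ≤ |M| * ‖X - Y‖ := by
    rw [norm_smul, norm_mul, norm_div, Real.norm_eq_abs, Real.norm_eq_abs,
      Real.norm_of_nonneg (by positivity : 0 ≤ α * β), mul_assoc]
    gcongr
    rw [div_mul_eq_mul_div, div_le_iff₀ (by positivity)]
    rw [norm_sub_rev] at h3
    calc |β - α| * ‖Y‖ ≤ ‖X - Y‖ * β := by gcongr
      _ ≤ ‖X - Y‖ * (α * β) := by
        gcongr
        nlinarith
  linarith [norm_add_le ((M / α) • (X - Y)) ((M * ((β - α) / (α * β))) • Y)]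

theorem abs_testFun_sub_inner_le (Q p : Eucl d) (M : ℝ) (q : Eucl d) :
    |testFun Q p M q - inner ℝ p (q - Q)| ≤ |M| * ‖q - Q‖ ^ 2 := by
  rw [testFun, add_sub_cancel_left, abs_mul]
  gcongr
  have h1 := one_le_sqrt_one_add_sq ‖q - Q‖
  have h2 := sqrt_one_add_sq_sub_one_le ‖q - Q‖
  rw [abs_of_nonneg (by linarith)]
  nlinarith [sq_nonneg ‖q - Q‖]

theorem lipschitzWith_testFun (Q p : Eucl d) (M : ℝ) :
    LipschitzWith (‖p‖ + |M|).toNNReal (testFun Q p M) := by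
  refine lipschitzWith_of_nnnorm_fderiv_le
    ((contDiff_testFun Q p M (n := 1)).differentiable (by norm_num)) fun x => ?_
  rw [← toDual_gradient, LinearIsometryEquiv.nnnorm_map]
  exact NNReal.le_toNNReal_of_coe_le (norm_gradient_testFun_le Q p M x)

/-- The test function `testFun` as a Lipschitz function. -/
noncomputable def testLip (Q p : Eucl d) (M : ℝ) : LipFun d :=
  ⟨testFun Q p M, _, lipschitzWith_testFun Q p M⟩

/-- The convex bump of a test function dominates a quadratic near the origin and a linear function
at infinity. -/
theorem div_le_sqrt_one_add_sq_sub_one {r : ℝ} (hr : 0 ≤ r) :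
    r ^ 2 / (r + 2) ≤ √(1 + r ^ 2) - 1 := by
  have h1 := one_le_sqrt_one_add_sq r
  have h2 := Real.sq_sqrt (show (0 : ℝ) ≤ 1 + r ^ 2 by positivity)
  rw [div_le_iff₀ (by linarith)]
  have h3 : √(1 + r ^ 2) ≤ 1 + r := Real.sqrt_le_iff.2 ⟨by linarith, by nlinarith⟩
  nlinarith

theorem sq_div_four_le_sqrt {r : ℝ} (hr : 0 ≤ r) (hr2 : r ≤ 2) :
    r ^ 2 / 4 ≤ √(1 + r ^ 2) - 1 := by
  refine le_trans ?_ (div_le_sqrt_one_add_sq_sub_one hr)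
  rw [div_le_div_iff₀ (by norm_num) (by linarith)]
  nlinarith [sq_nonneg r]

theorem div_two_le_sqrt {r : ℝ} (hr2 : 2 ≤ r) : r / 2 ≤ √(1 + r ^ 2) - 1 := by
  refine le_trans ?_ (div_le_sqrt_one_add_sq_sub_one (by linarith))
  rw [div_le_div_iff₀ (by norm_num) (by linarith)]
  nlinarith

end TestFunctions

/-! ### Characteristics -/

section Characteristics

variable {d : ℕ} {H : ℝ → Eucl d → Eucl d → ℝ} {C : ℝ}

/-- A solution of the Hamiltonian system on the time interval `[a, a + h]`, reparametrized by
`[0, 1]`. -/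
structure IsCharacteristic (H : ℝ → Eucl d → Eucl d → ℝ) (a h : ℝ) (q p : ℝ → Eucl d) :
    Prop where
  position : ∀ σ ∈ Icc (0 : ℝ) 1,
    HasDerivWithinAt q (h • gradP H (a + σ * h) (q σ) (p σ)) (Icc 0 1) σ
  momentum : ∀ σ ∈ Icc (0 : ℝ) 1,
    HasDerivWithinAt p (-(h • gradQ H (a + σ * h) (q σ) (p σ))) (Icc 0 1) σ

/-- The action of a reparametrized solution of the Hamiltonian system. -/
noncomputable def charAction (H : ℝ → Eucl d → Eucl d → ℝ) (a h : ℝ) (q p : ℝ → Eucl d) : ℝ :=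
  h * ∫ σ in (0 : ℝ)..1, (inner ℝ (p σ) (gradP H (a + σ * h) (q σ) (p σ)) -
    H (a + σ * h) (q σ) (p σ))

/-- An absorption argument. If `S` is the maximum of `‖p σ - p₀‖`, both velocities are at most `h C
(1 + ‖p₀‖ + S)`. Integrating from the two ends gives `S ≤ κ (1 + ‖p₀‖ + S)` with `κ = (1 + M) h C ≤
1 / 2`, hence `S ≤ 1 + ‖p₀‖`. -/
theorem IsCharacteristic.norm_sub_le (hH : HamiltonianBounds H C) {a h : ℝ} {q p : ℝ → Eucl d}
    (hc : IsCharacteristic H a h q p) (hh : 0 ≤ h) {Q p₀ : Eucl d} {M : ℝ} (hM : 0 ≤ M)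
    (hQ : q 1 = Q) (hp : ‖p 0 - p₀‖ ≤ M * ‖q 0 - Q‖) (hκ : (1 + M) * h * C ≤ 1 / 2) :
    ∀ σ ∈ Icc (0 : ℝ) 1, ‖q σ - Q‖ ≤ 2 * h * C * (1 + ‖p₀‖) ∧
      ‖p σ - p₀‖ ≤ 2 * ((1 + M) * h * C) * (1 + ‖p₀‖) := by
  have hC := hH.pos
  have hpc : ContinuousOn (fun σ => ‖p σ - p₀‖) (Icc 0 1) :=
    (ContinuousOn.sub (fun σ hσ => (hc.momentum σ hσ).continuousWithinAt) continuousOn_const).norm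
  obtain ⟨σ₀, hσ₀, hS⟩ := isCompact_Icc.exists_isMaxOn (nonempty_Icc.2 zero_le_one) hpc
  set S := ‖p σ₀ - p₀‖ with hSdef
  have hS0 : 0 ≤ S := norm_nonneg _
  have hS' : ∀ σ ∈ Icc (0 : ℝ) 1, ‖p σ - p₀‖ ≤ S := fun σ hσ => hS hσ
  have hnp : ∀ σ ∈ Icc (0 : ℝ) 1, 1 + ‖p σ‖ ≤ 1 + ‖p₀‖ + S := fun σ hσ => by
    have := norm_add_le (p σ - p₀) p₀
    rw [sub_add_cancel] at this
    linarith [hS' σ hσ]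
  have hq : ∀ σ ∈ Icc (0 : ℝ) 1, ‖q σ - Q‖ ≤ h * (C * (1 + ‖p₀‖ + S)) := fun σ hσ => by
    have := Convex.norm_image_sub_le_of_norm_hasDerivWithin_le (𝕜 := ℝ)
      (C := h * (C * (1 + ‖p₀‖ + S))) hc.position (fun τ hτ => by
        rw [norm_smul, Real.norm_of_nonneg hh]
        gcongr
        exact (hH.norm_gradP_le _ _ _).trans (mul_le_mul_of_nonneg_left (hnp τ hτ) hC.le)) (convex_Icc _ _) (right_mem_Icc.2 zero_le_one) hσ
    rw [hQ] at this
    refine this.trans (mul_le_of_le_one_right (by positivity) ?_)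
    rw [Real.norm_eq_abs, abs_le]
    constructor <;> linarith [hσ.1, hσ.2]
  have hpp : ∀ σ ∈ Icc (0 : ℝ) 1, ‖p σ - p 0‖ ≤ h * (C * (1 + ‖p₀‖ + S)) := fun σ hσ => by
    have := Convex.norm_image_sub_le_of_norm_hasDerivWithin_le (𝕜 := ℝ)
      (C := h * (C * (1 + ‖p₀‖ + S))) hc.momentum (fun τ hτ => by
        rw [norm_neg, norm_smul, Real.norm_of_nonneg hh]
        gcongr
        exact (hH.norm_gradQ_le _ _ _).trans (mul_le_mul_of_nonneg_left (hnp τ hτ) hC.le)) (convex_Icc _ _) (left_mem_Icc.2 zero_le_one) hσ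
    refine this.trans (mul_le_of_le_one_right (by positivity) ?_)
    rw [Real.norm_eq_abs, abs_le]
    constructor <;> linarith [hσ.1, hσ.2]
  have hp' : ∀ σ ∈ Icc (0 : ℝ) 1, ‖p σ - p₀‖ ≤ (1 + M) * h * C * (1 + ‖p₀‖ + S) := fun σ hσ => by
    have h1 := norm_add_le (p σ - p 0) (p 0 - p₀)
    rw [sub_add_sub_cancel] at h1
    have h2 := mul_le_mul_of_nonneg_left (hq 0 (left_mem_Icc.2 zero_le_one)) hM
    nlinarith [hpp σ hσ]
  have hSle : S ≤ (1 + M) * h * C * (1 + ‖p₀‖ + S) := hp' σ₀ hσ₀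
  have hp0 := norm_nonneg p₀
  have hS1 : S ≤ 1 + ‖p₀‖ := by nlinarith
  intro σ hσ
  constructor
  · refine (hq σ hσ).trans ?_
    have : h * (C * (1 + ‖p₀‖ + S)) ≤ h * (C * (2 * (1 + ‖p₀‖))) := by gcongr; linarith
    linarith
  · refine (hp' σ hσ).trans ?_
    have : (1 + M) * h * C * (1 + ‖p₀‖ + S) ≤ (1 + M) * h * C * (2 * (1 + ‖p₀‖)) := by
      gcongr; linarith
    linarith

theorem IsCharacteristic.continuousOn_position {a h : ℝ} {q p : ℝ → Eucl d}
    (hc : IsCharacteristic H a h q p) : ContinuousOn q (Icc 0 1) :=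
  fun σ hσ => (hc.position σ hσ).continuousWithinAt

theorem IsCharacteristic.continuousOn_momentum {a h : ℝ} {q p : ℝ → Eucl d}
    (hc : IsCharacteristic H a h q p) : ContinuousOn p (Icc 0 1) :=
  fun σ hσ => (hc.momentum σ hσ).continuousWithinAt

theorem IsCharacteristic.continuousOn_point {a h : ℝ} {q p : ℝ → Eucl d}
    (hc : IsCharacteristic H a h q p) :
    ContinuousOn (fun σ => (a + σ * h, q σ, p σ)) (Icc 0 1) :=
  (Continuous.continuousOn (by fun_prop)).prodMk
    (hc.continuousOn_position.prodMk hc.continuousOn_momentum)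

/-- The action along a short characteristic, to first order. -/
theorem IsCharacteristic.abs_action_sub_le (hH : HamiltonianBounds H C) {a h : ℝ}
    {q p : ℝ → Eucl d} (hc : IsCharacteristic H a h q p) (hh : 0 ≤ h) {Q p₀ : Eucl d} {M : ℝ}
    (hM : 0 ≤ M) (hQ : q 1 = Q) (hp : ‖p 0 - p₀‖ ≤ M * ‖q 0 - Q‖)
    (hκ : (1 + M) * h * C ≤ 1 / 2) {ψ : Eucl d → ℝ}
    (hψ : ∀ x, |ψ x - inner ℝ p₀ (x - Q)| ≤ M * ‖x - Q‖ ^ 2) {t ω : ℝ}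
    (hω : ∀ σ ∈ Icc (0 : ℝ) 1, |H (a + σ * h) Q p₀ - H t Q p₀| ≤ ω) :
    |ψ (q 0) + charAction H a h q p + h * H t Q p₀| ≤
      h * (16 * ((1 + M) * h * C) * C * (1 + ‖p₀‖) ^ 2 + ω) := by
  have hC := hH.pos
  have hb := hc.norm_sub_le hH hh hM hQ hp hκ
  set B := 1 + ‖p₀‖ with hB
  set κ := (1 + M) * h * C with hκdef
  have hB1 : 1 ≤ B := by have := norm_nonneg p₀; linarith
  have hκ0 : 0 ≤ κ := by positivity
  have hhκ : h * C ≤ κ := by rw [hκdef]; nlinarith [mul_nonneg hM (mul_nonneg hh hC.le)]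
  set G := fun σ => gradP H (a + σ * h) (q σ) (p σ) with hG
  have hGc : ContinuousOn G (Icc 0 1) :=
    hH.contDiff_gradP.continuous.comp_continuousOn hc.continuousOn_point
  have hHc : ContinuousOn (fun σ => H (a + σ * h) (q σ) (p σ)) (Icc 0 1) :=
    hH.contDiff.continuous.comp_continuousOn hc.continuousOn_point
  have hI1 : IntervalIntegrable (fun σ => inner ℝ p₀ (G σ)) MeasureTheory.volume 0 1 :=
    (ContinuousOn.inner continuousOn_const hGc).intervalIntegrable_of_Icc zero_le_one
  have hI2 : IntervalIntegrable (fun σ => inner ℝ (p σ - p₀) (G σ) -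
      H (a + σ * h) (q σ) (p σ) + H t Q p₀) MeasureTheory.volume 0 1 :=
    ((((hc.continuousOn_momentum.sub continuousOn_const).inner hGc).sub hHc).add
      continuousOn_const).intervalIntegrable_of_Icc zero_le_one
  -- The velocity of `q` is `h G` and `q 1 = Q`, so this part of the action integrates exactly. It
  -- cancels the linear part `⟪p₀, q 0 - Q⟫` of `ψ (q 0)`, which leaves `-h H` as leading term.
  have hftc : h * ∫ σ in (0 : ℝ)..1, inner ℝ p₀ (G σ) = inner ℝ p₀ (Q - q 0) := by
    have h1 : ∀ σ ∈ Icc (0 : ℝ) 1, HasDerivWithinAt (fun σ => inner ℝ p₀ (q σ))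
        (h * inner ℝ p₀ (G σ)) (Icc 0 1) σ := fun σ hσ => by
      have := (hasDerivWithinAt_const σ (Icc 0 1) p₀).inner ℝ (hc.position σ hσ)
      simpa [inner_smul_right] using this
    rw [← intervalIntegral.integral_const_mul,
      intervalIntegral.integral_eq_sub_of_hasDeriv_right_of_le zero_le_one
        (fun σ hσ => (h1 σ hσ).continuousWithinAt)
        (fun σ hσ => ((h1 σ (Ioo_subset_Icc_self hσ)).hasDerivAt
          (Icc_mem_nhds hσ.1 hσ.2)).hasDerivWithinAt) (hI1.const_mul h), hQ, inner_sub_right]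
  have hsplit : charAction H a h q p + h * H t Q p₀ = inner ℝ p₀ (Q - q 0) +
      h * ∫ σ in (0 : ℝ)..1, (inner ℝ (p σ - p₀) (G σ) -
        H (a + σ * h) (q σ) (p σ) + H t Q p₀) := by
    have hI3 : IntervalIntegrable (fun σ => inner ℝ (p σ) (G σ) - H (a + σ * h) (q σ) (p σ))
        MeasureTheory.volume 0 1 :=
      ((hc.continuousOn_momentum.inner hGc).sub hHc).intervalIntegrable_of_Icc zero_le_one
    have : h * H t Q p₀ = h * ∫ _ in (0 : ℝ)..1, H t Q p₀ := by simp
    rw [← hftc, charAction, this, ← mul_add, ← mul_add, ← intervalIntegral.integral_add hI1 hI2,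
      ← intervalIntegral.integral_add hI3 intervalIntegrable_const]
    congr 2
    funext σ
    rw [inner_sub_left]
    ring
  -- The momentum error times the speed gives `4 κ C B²`, moving the arguments of `H` to `(Q, p₀)`
  -- gives `8 κ C B²`, and freezing the time gives `ω`. The quadratic remainder of `ψ` supplies the
  -- last 4 of the constant 16.
  have hint : ‖∫ σ in (0 : ℝ)..1, (inner ℝ (p σ - p₀) (G σ) -
      H (a + σ * h) (q σ) (p σ) + H t Q p₀)‖ ≤ (12 * κ * C * B ^ 2 + ω) * |1 - 0| := by
    refine intervalIntegral.norm_integral_le_of_norm_le_const fun σ hσ => ?_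
    rw [uIoc_of_le zero_le_one] at hσ
    have hσ' : σ ∈ Icc (0 : ℝ) 1 := Ioc_subset_Icc_self hσ
    obtain ⟨b1, b2⟩ := hb σ hσ'
    have b3 : ‖p σ‖ ≤ ‖p₀‖ + B := by
      have := norm_add_le (p σ - p₀) p₀
      rw [sub_add_cancel] at this
      nlinarith
    have e1 : |inner ℝ (p σ - p₀) (G σ)| ≤ (2 * κ * B) * (C * (2 * B)) := by
      refine (abs_real_inner_le_norm _ _).trans ?_
      gcongr
      refine (hH.norm_gradP_le _ _ _).trans ?_
      gcongr
      linarith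
    have e2 : |H (a + σ * h) (q σ) (p σ) - H (a + σ * h) Q p₀| ≤
        C * (1 + (‖p₀‖ + B)) * (2 * κ * B + 2 * κ * B) := by
      refine (hH.abs_sub_le _ _ _ b3 (by linarith)).trans ?_
      gcongr
      exact b1.trans (by nlinarith)
    have e3 := hω σ hσ'
    have e4 : C * (1 + (‖p₀‖ + B)) * (2 * κ * B + 2 * κ * B) = 8 * κ * C * B ^ 2 := by
      rw [hB]; ring
    rw [Real.norm_eq_abs]
    rw [abs_le] at e1 e2 e3 ⊢
    constructor <;> nlinarith
  have h0 := (hb 0 (left_mem_Icc.2 zero_le_one)).1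
  have hψ0 : |ψ (q 0) - inner ℝ p₀ (q 0 - Q)| ≤ h * (4 * κ * C * B ^ 2) := by
    refine (hψ (q 0)).trans ?_
    calc M * ‖q 0 - Q‖ ^ 2 ≤ M * (2 * h * C * B) ^ 2 := by gcongr
      _ = h * (4 * (M * h * C) * C * B ^ 2) := by ring
      _ ≤ h * (4 * κ * C * B ^ 2) := by
        gcongr
        rw [hκdef]
        nlinarith [mul_nonneg hh hC.le]
  have hneg : inner ℝ p₀ (Q - q 0) = -inner ℝ p₀ (q 0 - Q) := by
    rw [← inner_neg_right, neg_sub]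
  rw [add_assoc, hsplit, hneg]
  rw [Real.norm_eq_abs, sub_zero, abs_one, mul_one] at hint
  have hint' : |h * ∫ σ in (0 : ℝ)..1, (inner ℝ (p σ - p₀) (G σ) -
      H (a + σ * h) (q σ) (p σ) + H t Q p₀)| ≤ h * (12 * κ * C * B ^ 2 + ω) := by
    rw [abs_mul, abs_of_nonneg hh]
    gcongr
  rw [abs_le] at hψ0 hint' ⊢
  constructor <;> nlinarith

/-- A crude bound of the action along a short characteristic. -/
theorem IsCharacteristic.abs_action_le (hH : HamiltonianBounds H C) {a h : ℝ}
    {q p : ℝ → Eucl d} (hc : IsCharacteristic H a h q p) (hh : 0 ≤ h) {Q p₀ : Eucl d} {M : ℝ}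
    (hM : 0 ≤ M) (hQ : q 1 = Q) (hp : ‖p 0 - p₀‖ ≤ M * ‖q 0 - Q‖)
    (hκ : (1 + M) * h * C ≤ 1 / 2) {ψ : Eucl d → ℝ}
    (hψ : ∀ x, |ψ x - inner ℝ p₀ (x - Q)| ≤ M * ‖x - Q‖ ^ 2) :
    |ψ (q 0) + charAction H a h q p| ≤ 11 * h * C * (1 + ‖p₀‖) ^ 2 := by
  have hC := hH.pos
  have hb : ∀ t, |H t Q p₀| ≤ C * (1 + ‖p₀‖) ^ 2 := fun t => hH.abs_le_of_norm_le t Q le_rfl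
  have h1 := hc.abs_action_sub_le hH hh hM hQ hp hκ hψ (t := a)
    (ω := 2 * (C * (1 + ‖p₀‖) ^ 2)) fun σ _ => by
      have := abs_sub (H (a + σ * h) Q p₀) (H a Q p₀)
      linarith [hb (a + σ * h), hb a]
  have h2 : |h * H a Q p₀| ≤ h * (C * (1 + ‖p₀‖) ^ 2) := by
    rw [abs_mul, abs_of_nonneg hh]
    exact mul_le_mul_of_nonneg_left (hb a) hh
  -- Here `16 κ ≤ 8`; the crude oscillation contributes 2 and the leading term 1, which makes 11.
  have h3 : h * (16 * ((1 + M) * h * C) * C * (1 + ‖p₀‖) ^ 2 + 2 * (C * (1 + ‖p₀‖) ^ 2)) ≤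
      h * (16 * (1 / 2) * C * (1 + ‖p₀‖) ^ 2 + 2 * (C * (1 + ‖p₀‖) ^ 2)) := by gcongr
  rw [abs_le] at h1 h2 ⊢
  constructor <;> nlinarith

end Characteristics

/-! ### Chains of functions and approximate subsolutions -/

section Chains

variable {d : ℕ} {H : ℝ → Eucl d → Eucl d → ℝ} {C : ℝ}

/-- The Hamiltonian whose subsolutions are the opposites of the supersolutions of `H`. -/
def negHam (H : ℝ → Eucl d → Eucl d → ℝ) (t : ℝ) (q p : Eucl d) : ℝ := -H t q (-p)

/-- A finite sequence of functions `f 0, …, f n` at the times `θ 0 ≤ ⋯ ≤ θ n` which is Lipschitz in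
space and time. -/
structure IsTimeChain (n : ℕ) (θ : ℕ → ℝ) (f : ℕ → Eucl d → ℝ) (L K₀ : ℝ) : Prop where
  mono : ∀ k < n, θ k ≤ θ (k + 1)
  space : ∀ k ≤ n, ∀ x y, |f k x - f k y| ≤ L * ‖x - y‖
  time : ∀ k < n, ∀ x, |f (k + 1) x - f k x| ≤ K₀ * (θ (k + 1) - θ k)

/-- A paraboloid touching the sequence `f 0, …, f j` from above at the time `θ j` has a derivative
that satisfies the inequality of subsolutions, up to `ε`. -/
def ApproxSub (H : ℝ → Eucl d → Eucl d → ℝ) (n : ℕ) (θ : ℕ → ℝ) (f : ℕ → Eucl d → ℝ)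
    (ε K ρ : ℝ) : Prop :=
  ∀ j ≤ n, θ 0 < θ j → ∀ (Q p : Eucl d) (a : ℝ), ‖Q‖ ≤ ρ →
    (∀ i ≤ j, ∀ q, f i q ≤ f j Q + a * (θ i - θ j) + inner ℝ p (q - Q) +
      K * ((θ i - θ j) ^ 2 + ‖q - Q‖ ^ 2)) →
    a + H (θ j) Q p ≤ ε

/-- One step of length `h` from `f` to `g` is consistent, from above, on the test functions. -/
def StepSub (H : ℝ → Eucl d → Eucl d → ℝ) (f g : Eucl d → ℝ) (t h l M ρ ε : ℝ) : Prop :=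
  ∀ (Q p : Eucl d) (c : ℝ), ‖Q‖ ≤ ρ → ‖p‖ ≤ l → (∀ q, f q ≤ c + testFun Q p M q) →
    g Q ≤ c - h * H t Q p + h * ε

namespace IsTimeChain

variable {n : ℕ} {θ : ℕ → ℝ} {f : ℕ → Eucl d → ℝ} {L K₀ : ℝ}

theorem le_of_le (h : IsTimeChain n θ f L K₀) {i j : ℕ} (hij : i ≤ j) (hj : j ≤ n) : θ i ≤ θ j := by
  induction j, hij using Nat.le_induction with
  | base => exact le_rfl
  | succ k hk ih => exact (ih (by omega)).trans (h.mono k (by omega))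

theorem abs_sub_le_of_le (h : IsTimeChain n θ f L K₀) {i j : ℕ} (hij : i ≤ j) (hj : j ≤ n)
    (x : Eucl d) : |f j x - f i x| ≤ K₀ * (θ j - θ i) := by
  induction j, hij using Nat.le_induction with
  | base => simp
  | succ k hk ih =>
    have h1 := ih (by omega)
    have h2 := h.time k (by omega) x
    have h3 := abs_sub_le (f (k + 1) x) (f k x) (f i x)
    linarith

theorem abs_sub_le (h : IsTimeChain n θ f L K₀) {i j : ℕ} (hi : i ≤ n) (hj : j ≤ n)
    (x : Eucl d) : |f j x - f i x| ≤ K₀ * |θ j - θ i| := by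
  rcases le_total i j with hij | hij
  · rw [abs_of_nonneg (sub_nonneg.2 (h.le_of_le hij hj))]
    exact h.abs_sub_le_of_le hij hj x
  · rw [abs_sub_comm, abs_sub_comm (θ j), abs_of_nonneg (sub_nonneg.2 (h.le_of_le hij hi))]
    exact h.abs_sub_le_of_le hij hi x

theorem neg (h : IsTimeChain n θ f L K₀) : IsTimeChain n θ (fun k x => -f k x) L K₀ where
  mono := h.mono
  space k hk x y := by
    have := h.space k hk x y
    rwa [neg_sub_neg, abs_sub_comm]
  time k hk x := by
    have := h.time k hk x
    rwa [neg_sub_neg, abs_sub_comm]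

end IsTimeChain

/-- Evaluated at `x = -s p` and divided by `s ‖p‖`, the inequality reads `‖p‖ ≤ L + O(s)`. -/
theorem norm_le_of_forall_inner_add_sq_nonneg {p : Eucl d} {L K : ℝ} (hL : 0 ≤ L)
    (h : ∀ x : Eucl d, 0 ≤ L * ‖x‖ + inner ℝ p x + K * ‖x‖ ^ 2) : ‖p‖ ≤ L := by
  by_contra hp
  push Not at hp
  have hp0 : 0 < ‖p‖ := hL.trans_lt hp
  have key : ∀ s : ℝ, 0 < s → ‖p‖ ≤ L + |K| * (s * ‖p‖) := fun s hs => by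
    have h1 := h (-(s • p))
    rw [norm_neg, norm_smul, inner_neg_right, inner_smul_right, real_inner_self_eq_norm_sq,
      Real.norm_of_nonneg hs.le] at h1
    have h2 : K * (s * ‖p‖) ^ 2 ≤ |K| * (s * ‖p‖) ^ 2 := by gcongr; exact le_abs_self K
    have h3 : 0 < s * ‖p‖ := by positivity
    by_contra hlt
    push Not at hlt
    nlinarith
  -- This `s` makes the quadratic error at most half of the supposed gap `‖p‖ - L`.
  have h4 := key ((‖p‖ - L) / (2 * (|K| + 1) * ‖p‖)) (by
    have := sub_pos.2 hp
    positivity)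
  have h5 : |K| * ((‖p‖ - L) / (2 * (|K| + 1) * ‖p‖) * ‖p‖) = (|K| / (|K| + 1)) * (‖p‖ - L) / 2 := by
    field_simp
  rw [h5] at h4
  have h6 : |K| / (|K| + 1) ≤ 1 := by
    rw [div_le_one (by positivity)]
    linarith
  nlinarith

theorem norm_le_of_touching {g : Eucl d → ℝ} {L K : ℝ} {Q p : Eucl d} (hL : 0 ≤ L)
    (hg : ∀ x y, |g x - g y| ≤ L * ‖x - y‖)
    (h : ∀ q, g q ≤ g Q + inner ℝ p (q - Q) + K * ‖q - Q‖ ^ 2) : ‖p‖ ≤ L := by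
  refine norm_le_of_forall_inner_add_sq_nonneg (K := K) hL fun x => ?_
  have h1 := h (Q + x)
  have h2 := (abs_le.1 (hg (Q + x) Q)).1
  rw [add_sub_cancel_left] at h1 h2
  linarith

/-- A Lipschitz function below a paraboloid is below a test function. -/
theorem le_const_add_testFun {g : Eucl d → ℝ} {L K B c : ℝ} {Q p : Eucl d} (hL : 0 ≤ L) (hK : 0 ≤ K)
    (hB : 0 ≤ B) (hp : ‖p‖ ≤ L) (hg : ∀ x y, |g x - g y| ≤ L * ‖x - y‖)
    (h : ∀ q, g q ≤ c + inner ℝ p (q - Q) + K * ‖q - Q‖ ^ 2) (hc : g Q ≤ c + B) {M : ℝ}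
    (hM : 4 * K + 4 * L + B ≤ M) (q : Eucl d) : g q ≤ c + testFun Q p M q := by
  rw [testFun]
  set r := ‖q - Q‖ with hr
  have hr0 : 0 ≤ r := norm_nonneg _
  -- Near `Q` the bump is at least `r² / 4` and beats the paraboloid. At distance at least 2 it is
  -- at least `r / 2` and beats the growth `2 L r` of `g - ⟪p, ·⟫` together with the excess `B` at
  -- the centre.
  rcases le_total r 2 with h2 | h2
  · have h3 := sq_div_four_le_sqrt hr0 h2
    have h4 := h q
    have h5 : K * r ^ 2 ≤ M * (r ^ 2 / 4) := by nlinarith [sq_nonneg r]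
    have h6 : M * (r ^ 2 / 4) ≤ M * (√(1 + r ^ 2) - 1) := by
      have : 0 ≤ M := by linarith
      gcongr
    linarith
  · have h3 := div_two_le_sqrt h2
    have h4 := (abs_le.1 (hg q Q)).2
    have h5 := neg_le_of_abs_le (abs_real_inner_le_norm p (q - Q))
    have h6 : ‖p‖ * r ≤ L * r := by gcongr
    have h7 : M * (r / 2) ≤ M * (√(1 + r ^ 2) - 1) := by
      have : 0 ≤ M := by linarith
      gcongr
    have h8 : (4 * L + B) * (r / 2) ≤ M * (r / 2) := by gcongr; linarith
    nlinarith

/-- A chain with consistent steps is an approximate subsolution. -/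
theorem IsTimeChain.approxSub {n : ℕ} {θ : ℕ → ℝ} {f : ℕ → Eucl d → ℝ} {L K₀ K ρ ε δ M : ℝ}
    (hf : IsTimeChain n θ f L K₀) (hL : 0 ≤ L) (hK₀ : 0 ≤ K₀) (hK : 0 ≤ K) {l : ℕ → ℝ}
    (hl0 : ∀ k, 0 ≤ l k) (hl : ∀ k ≤ n, ∀ x y, |f k x - f k y| ≤ l k * ‖x - y‖)
    (hlL : ∀ k ≤ n, l k ≤ L) (hδ : ∀ k < n, θ (k + 1) - θ k ≤ δ) (hδ1 : δ ≤ 1)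
    (hM : 4 * K + 4 * L + 2 * K₀ + K ≤ M)
    (hstep : ∀ k < n, θ k < θ (k + 1) →
      StepSub H (f k) (f (k + 1)) (θ (k + 1)) (θ (k + 1) - θ k) (l (k + 1)) M ρ ε) :
    ApproxSub H n θ f (ε + K * δ) K ρ := by
  intro j hj h0j Q p a hQ htouch
  -- Grid times may repeat. Let `i + 1` be the first index whose time is `θ j`: the step leaving `i`
  -- has positive length, and `f (i + 1) = f j` because the time estimate leaves no room at equal
  -- times.
  have hex : ∃ i, θ j ≤ θ i := ⟨j, le_rfl⟩
  classical
  obtain ⟨i, hi⟩ : ∃ i, Nat.find hex = i + 1 := by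
    refine Nat.exists_eq_succ_of_ne_zero fun h => ?_
    have := Nat.find_spec hex
    rw [h] at this
    linarith
  have hi1 : θ j ≤ θ (i + 1) := hi ▸ Nat.find_spec hex
  have hi2 : θ i < θ j := not_le.1 (Nat.find_min hex (by omega))
  have hij : i + 1 ≤ j := hi ▸ Nat.find_min' hex le_rfl
  have hθ : θ (i + 1) = θ j := le_antisymm (hf.le_of_le hij hj) hi1
  have hfij : ∀ x, f (i + 1) x = f j x := fun x => by
    have := hf.abs_sub_le_of_le hij hj x
    rw [hθ, sub_self, mul_zero] at this
    have := abs_nonpos_iff.1 this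
    linarith
  have hin : i + 1 ≤ n := by omega
  have hp : ‖p‖ ≤ l (i + 1) := by
    refine norm_le_of_touching (g := f (i + 1)) (Q := Q) (K := K) (hl0 _) (hl _ hin) fun q => ?_
    have := htouch (i + 1) hij q
    rw [hθ, sub_self, ← hfij] at this
    simpa using this
  set h := θ (i + 1) - θ i with hh
  have hh0 : 0 < h := by rw [hh, hθ]; linarith
  have hhδ : h ≤ δ := hδ i (by omega)
  have hθi : θ i - θ j = -h := by rw [hh, hθ]; ring
  have ht := htouch i (by omega)
  rw [hθi] at ht
  have hQi := (abs_le.1 (hf.time i (by omega) Q)).1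
  rw [hfij, ← hh] at hQi
  -- Touching at `(θ i, Q)` bounds the time slope `a` from above, so `f i Q` exceeds the constant `f
  -- j Q - a h + K h²` by at most `2 K₀ + K`.
  have hah : a * h ≤ K₀ * h + K * h ^ 2 := by
    have := ht Q
    simp only [sub_self, inner_zero_right, norm_zero] at this
    have h1 := (abs_le.1 (hf.time i (by omega) Q)).2
    rw [hfij, ← hh] at h1
    nlinarith
  -- Touching at `θ i` puts `f i` below a test function. Consistency of the step then bounds `f j Q`
  -- by itself plus `h` times the defect of the inequality, and `h` is divided out.
  have hfin := hstep i (by omega) (by rw [hθ]; exact hi2) Q p (f j Q - a * h + K * h ^ 2) hQ hp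
    (le_const_add_testFun (K := K) (B := 2 * K₀ + K) hL hK (by positivity)
      (hp.trans (hlL _ hin)) (hf.space i (by omega)) (fun q => by
        have := ht q
        linarith) (by
        have h1 : K₀ * h ≤ K₀ := mul_le_of_le_one_right hK₀ (by linarith)
        have h2 : K * h ^ 2 ≤ K := mul_le_of_le_one_right hK (by nlinarith)
        nlinarith [sq_nonneg h]) (by linarith))
  rw [hθ, hfij, ← hθ, ← hh] at hfin
  have h3 : h * (a + H (θ (i + 1)) Q p) ≤ h * (ε + K * h) := by nlinarith
  have h4 := le_of_mul_le_mul_left h3 hh0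
  rw [← hθ]
  nlinarith

end Chains

/-! ### Operators that are variational on test functions -/

section Operators

variable {d : ℕ} {H : ℝ → Eucl d → Eucl d → ℝ} {C : ℝ} {P : OpFamily d}

/-- The variational property for short times and test functions centred at the endpoint. -/
def TestVariational (H : ℝ → Eucl d → Eucl d → ℝ) (C : ℝ) (P : OpFamily d) : Prop :=
  ∀ s t : ℝ, 0 ≤ s → s ≤ t → ∀ (Q p : Eucl d) (M : ℝ), (1 + |M|) * (t - s) * C ≤ 1 / 16 →
    ∃ x y : ℝ → Eucl d, IsCharacteristic H s (t - s) x y ∧ x 1 = Q ∧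
      y 0 = gradient (testFun Q p M) (x 0) ∧
      (P s t (testLip Q p M)).1 Q = testFun Q p M (x 0) + charAction H s (t - s) x y

theorem testFun_neg_neg (Q p : Eucl d) (M : ℝ) (q : Eucl d) :
    testFun Q (-p) (-M) q = -testFun Q p M q := by
  simp only [testFun, inner_neg_left]
  ring

theorem le_of_le_const_add (hmono : OpMonotone P) (hadd : OpAdditive P) {s t : ℝ} (hs : 0 ≤ s)
    (hst : s ≤ t) {u v : LipFun d} {c : ℝ} (h : ∀ q, u.1 q ≤ c + v.1 q) (q : Eucl d) :
    (P s t u).1 q ≤ c + (P s t v).1 q := by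
  have h1 := hmono s t hs hst u (v.addConst c) h q
  rwa [hadd s t hs hst v c] at h1

theorem TestVariational.abs_apply_le (hH : HamiltonianBounds H C) (hP : TestVariational H C P)
    {s t : ℝ} (hs : 0 ≤ s) (hst : s ≤ t) (Q p : Eucl d) (M : ℝ)
    (hM : (1 + |M|) * (t - s) * C ≤ 1 / 16) :
    |(P s t (testLip Q p M)).1 Q| ≤ 11 * (t - s) * C * (1 + ‖p‖) ^ 2 := by
  obtain ⟨x, y, hc, hx, hy, hval⟩ := hP s t hs hst Q p M hM
  rw [hval]
  exact hc.abs_action_le hH (sub_nonneg.2 hst) (abs_nonneg M) hx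
    (hy ▸ norm_gradient_testFun_sub_le Q p M (x 0)) (by linarith)
    (abs_testFun_sub_inner_le Q p M)

theorem TestVariational.abs_apply_add_le (hH : HamiltonianBounds H C) (hP : TestVariational H C P)
    {s t : ℝ} (hs : 0 ≤ s) (hst : s ≤ t) (Q p : Eucl d) (M : ℝ)
    (hM : (1 + |M|) * (t - s) * C ≤ 1 / 16) {ω : ℝ}
    (hω : ∀ τ ∈ Icc s t, |H τ Q p - H t Q p| ≤ ω) :
    |(P s t (testLip Q p M)).1 Q + (t - s) * H t Q p| ≤
      (t - s) * (16 * ((1 + |M|) * (t - s) * C) * C * (1 + ‖p‖) ^ 2 + ω) := by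
  obtain ⟨x, y, hc, hx, hy, hval⟩ := hP s t hs hst Q p M hM
  rw [hval]
  refine hc.abs_action_sub_le hH (sub_nonneg.2 hst) (abs_nonneg M) hx
    (hy ▸ norm_gradient_testFun_sub_le Q p M (x 0)) (by linarith)
    (abs_testFun_sub_inner_le Q p M) fun σ hσ => hω _ ?_
  constructor <;> nlinarith [hσ.1, hσ.2, sub_nonneg.2 hst]

/-- A function below `c + testFun Q p M` has its image at `Q` below the image of that test function,
which the characteristic ending at `Q` gives to first order in `t - s`. -/
theorem TestVariational.stepSub (hH : HamiltonianBounds H C) (hP : TestVariational H C P)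
    (hmono : OpMonotone P) (hadd : OpAdditive P)
    {s t : ℝ} (hs : 0 ≤ s) (hst : s ≤ t) {M l ρ ω : ℝ} (hM0 : 0 ≤ M)
    (hM : (1 + M) * (t - s) * C ≤ 1 / 16)
    (hω : ∀ τ ∈ Icc s t, ∀ Q p : Eucl d, ‖Q‖ ≤ ρ → ‖p‖ ≤ l → |H τ Q p - H t Q p| ≤ ω)
    (u : LipFun d) :
    StepSub H u.1 (P s t u).1 t (t - s) l M ρ
      (16 * ((1 + M) * (t - s) * C) * C * (1 + l) ^ 2 + ω) := by
  intro Q p c hQ hp hle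
  have hC := hH.pos
  have hts := sub_nonneg.2 hst
  have h1 := le_of_le_const_add hmono hadd hs hst (v := testLip Q p M) hle Q
  have h2 := hP.abs_apply_add_le hH hs hst Q p M (by rwa [abs_of_nonneg hM0])
    (fun τ hτ => hω τ hτ Q p hQ hp)
  rw [abs_of_nonneg hM0] at h2
  have h3 : (t - s) * (16 * ((1 + M) * (t - s) * C) * C * (1 + ‖p‖) ^ 2 + ω) ≤
      (t - s) * (16 * ((1 + M) * (t - s) * C) * C * (1 + l) ^ 2 + ω) := by gcongr
  linarith [(abs_le.1 h2).2]

/-- The supersolution half: the hypothesis says that `u` lies above `testFun Q (-p) (-M) - c`, so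
the same first-order expansion is used with reversed signs. -/
theorem TestVariational.stepSub_neg (hH : HamiltonianBounds H C) (hP : TestVariational H C P)
    (hmono : OpMonotone P) (hadd : OpAdditive P)
    {s t : ℝ} (hs : 0 ≤ s) (hst : s ≤ t) {M l ρ ω : ℝ} (hM0 : 0 ≤ M)
    (hM : (1 + M) * (t - s) * C ≤ 1 / 16)
    (hω : ∀ τ ∈ Icc s t, ∀ Q p : Eucl d, ‖Q‖ ≤ ρ → ‖p‖ ≤ l → |H τ Q p - H t Q p| ≤ ω)
    (u : LipFun d) :
    StepSub (negHam H) (fun q => -u.1 q) (fun q => -(P s t u).1 q) t (t - s) l M ρ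
      (16 * ((1 + M) * (t - s) * C) * C * (1 + l) ^ 2 + ω) := by
  intro Q p c hQ hp hle
  have hC := hH.pos
  have hts := sub_nonneg.2 hst
  have h1 := le_of_le_const_add hmono hadd hs hst (u := testLip Q (-p) (-M)) (v := u) (c := c)
    (fun q => by
      have := hle q
      change testFun Q (-p) (-M) q ≤ _
      rw [testFun_neg_neg]
      linarith) Q
  have h2 := hP.abs_apply_add_le hH hs hst Q (-p) (-M) (by rwa [abs_neg, abs_of_nonneg hM0])
    (fun τ hτ => hω τ hτ Q (-p) hQ (by rwa [norm_neg]))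
  rw [abs_neg, abs_of_nonneg hM0, norm_neg] at h2
  have h3 : (t - s) * (16 * ((1 + M) * (t - s) * C) * C * (1 + ‖p‖) ^ 2 + ω) ≤
      (t - s) * (16 * ((1 + M) * (t - s) * C) * C * (1 + l) ^ 2 + ω) := by gcongr
  rw [negHam]
  linarith [(abs_le.1 h2).1]

/-- A cone is dominated by a smooth bump up to `L² / M`. It traps a Lipschitz function between two
test functions centred at `Q`, without any differentiability. -/
theorem mul_le_sq_div_add_mul_sqrt {L M r : ℝ} (hM : 0 < M) (hLM : 2 * L ≤ M)
    (hr : 0 ≤ r) : L * r ≤ L ^ 2 / M + M * (√(1 + r ^ 2) - 1) := by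
  rcases le_total r 2 with h2 | h2
  · have h3 := mul_le_mul_of_nonneg_left (sq_div_four_le_sqrt hr h2) hM.le
    refine le_trans ?_ (add_le_add_right h3 _)
    rw [div_add' _ _ _ hM.ne', le_div_iff₀ hM]
    nlinarith [sq_nonneg (L - M * r / 2)]
  · have h3 := mul_le_mul_of_nonneg_left (div_two_le_sqrt h2) hM.le
    have : 0 ≤ L ^ 2 / M := by positivity
    nlinarith

theorem TestVariational.abs_sub_le (hH : HamiltonianBounds H C) (hP : TestVariational H C P)
    (hmono : OpMonotone P) (hadd : OpAdditive P)
    {s t : ℝ} (hs : 0 ≤ s) (hst : s ≤ t) {L M : ℝ} (hM0 : 0 < M) (hLM : 2 * L ≤ M)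
    (hM : (1 + M) * (t - s) * C ≤ 1 / 16) {u : LipFun d}
    (hu : ∀ x y, |u.1 x - u.1 y| ≤ L * ‖x - y‖) (Q : Eucl d) :
    |(P s t u).1 Q - u.1 Q| ≤ L ^ 2 / M + 11 * (t - s) * C := by
  have key : ∀ q, L * ‖q - Q‖ ≤ L ^ 2 / M + testFun Q 0 M q := fun q => by
    simpa [testFun] using mul_le_sq_div_add_mul_sqrt hM0 hLM (norm_nonneg (q - Q))
  have h1 := le_of_le_const_add hmono hadd hs hst (u := u) (v := testLip Q 0 M)
    (c := u.1 Q + L ^ 2 / M) (fun q => by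
      change _ ≤ _ + testFun Q 0 M q
      linarith [(abs_le.1 (hu q Q)).2, key q]) Q
  have h2 := le_of_le_const_add hmono hadd hs hst (u := testLip Q 0 (-M)) (v := u)
    (c := -u.1 Q + L ^ 2 / M) (fun q => by
      change testFun Q 0 (-M) q ≤ _
      have := testFun_neg_neg Q 0 M q
      rw [neg_zero] at this
      linarith [(abs_le.1 (hu q Q)).1, key q]) Q
  have h3 := hP.abs_apply_le hH hs hst Q 0 M (by rwa [abs_of_nonneg hM0.le])
  have h4 := hP.abs_apply_le hH hs hst Q 0 (-M) (by rwa [abs_neg, abs_of_nonneg hM0.le])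
  rw [norm_zero, add_zero, one_pow, mul_one] at h3 h4
  rw [abs_le] at h3 h4 ⊢
  constructor <;> linarith

/-- The error `L² / M + 11 h C` is used with `M = 1 / (32 h C)`, of the largest order that the
smallness condition on `M` allows. When `h = 0` the parameter `M` is arbitrarily large, which forces
`P s s u = u`. -/
theorem TestVariational.abs_sub_le_mul (hH : HamiltonianBounds H C) (hP : TestVariational H C P)
    (hmono : OpMonotone P) (hadd : OpAdditive P)
    {s t : ℝ} (hs : 0 ≤ s) (hst : s ≤ t) {L : ℝ} (hL : 0 ≤ L)
    (hh : 32 * (1 + 2 * L) * (t - s) * C ≤ 1) {u : LipFun d}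
    (hu : ∀ x y, |u.1 x - u.1 y| ≤ L * ‖x - y‖) (Q : Eucl d) :
    |(P s t u).1 Q - u.1 Q| ≤ (32 * L ^ 2 + 11) * C * (t - s) := by
  have hC := hH.pos
  rcases hst.eq_or_lt with rfl | hlt
  · rw [sub_self, mul_zero]
    refine le_of_forall_pos_le_add fun η hη => ?_
    have hM0 : 0 < 2 * L + L ^ 2 / η + 1 := by positivity
    have h1 := hP.abs_sub_le hH hmono hadd hs le_rfl hM0
      (by linarith [show 0 ≤ L ^ 2 / η by positivity]) (by simp) hu Q
    refine h1.trans ?_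
    rw [sub_self, mul_zero, zero_mul, add_zero, zero_add, div_le_iff₀ hM0]
    have : η * (L ^ 2 / η) = L ^ 2 := by field_simp
    nlinarith
  · have h0 : 0 < t - s := sub_pos.2 hlt
    have hM0 : 0 < 1 / (32 * (t - s) * C) := by positivity
    have h1 := hP.abs_sub_le hH hmono hadd hs hst hM0 (by
      rw [le_div_iff₀ (by positivity)]
      nlinarith [mul_pos h0 hC]) (by
      have : (1 + 1 / (32 * (t - s) * C)) * (t - s) * C = (t - s) * C + 1 / 32 := by field_simp
      rw [this]
      nlinarith [mul_pos h0 hC, mul_nonneg hL (mul_pos h0 hC).le]) hu Q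
    refine h1.trans (le_of_eq ?_)
    field_simp

end Operators

/-! ### Comparison -/

section Comparison

variable {d : ℕ} {H : ℝ → Eucl d → Eucl d → ℝ} {C : ℝ}

/-- The penalized difference of two chains in doubled variables. -/
noncomputable def doubled (θ θ' : ℕ → ℝ) (f g : ℕ → Eucl d → ℝ) (e β σ : ℝ) (j : ℕ) (q : Eucl d)
    (k : ℕ) (q' : Eucl d) : ℝ :=
  f j q - g k q' - (‖q - q'‖ ^ 2 + (θ j - θ' k) ^ 2) / (2 * e) - β * (√(1 + ‖q‖ ^ 2) - 1) -
    σ * (θ j - θ 0)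

/-! ### Maxima of the penalized difference in doubled variables. -/

section Doubled

variable {n n' : ℕ} {θ θ' : ℕ → ℝ} {f g : ℕ → Eucl d → ℝ} {L K₀ T m m₀ e β σ : ℝ}

/-- Going back to the initial time gives `f j q - g k q' ≤ m₀ + m + 2 K₀ T + L ‖q - q'‖`. The last
term is absorbed by half of the spatial penalty (Young's inequality), so every penalty is bounded as
soon as the penalized difference is at least `m₀`. -/
theorem doubled_bounds (hf : IsTimeChain n θ f L K₀) (hg : IsTimeChain n' θ' g L K₀)
    (hK₀ : 0 ≤ K₀) (hσ : 0 ≤ σ) (hβ : 0 < β) (he : 0 < e) (he1 : e ≤ 1)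
    (h0 : θ 0 = θ' 0) (hθ0 : 0 ≤ θ 0) (hn : θ n = θ' n') (hT : θ n ≤ T)
    (hm : ∀ q, f 0 q ≤ g 0 q + m₀ + m) {j k : ℕ} (hj : j ≤ n) (hk : k ≤ n') {q q' : Eucl d}
    (hle : m₀ ≤ doubled θ θ' f g e β σ j q k q') :
    ‖q - q'‖ ^ 2 ≤ 4 * e * (m + 2 * K₀ * T + L ^ 2) ∧
      (θ j - θ' k) ^ 2 ≤ 4 * e * (m + 2 * K₀ * T + L ^ 2) ∧
      ‖q‖ ≤ (m + 2 * K₀ * T + L ^ 2) / β + 1 := by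
  rw [doubled] at hle
  have a1 := (abs_le.1 (hf.abs_sub_le_of_le (Nat.zero_le j) hj q)).2
  have a2 := (abs_le.1 (hg.abs_sub_le_of_le (Nat.zero_le k) hk q')).1
  have a3 := (abs_le.1 (hg.space 0 (Nat.zero_le _) q' q)).1
  rw [norm_sub_rev] at a3
  have b1 := hf.le_of_le hj le_rfl
  have b2 := hg.le_of_le hk le_rfl
  have b3 := hf.le_of_le (Nat.zero_le j) hj
  have b4 := hm q
  have a1' : K₀ * (θ j - θ 0) ≤ K₀ * T := by gcongr; linarith
  have a2' : K₀ * (θ' k - θ' 0) ≤ K₀ * T := by gcongr; linarith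
  set x := ‖q - q'‖
  have a4 : L * x ≤ x ^ 2 / (4 * e) + L ^ 2 := by
    rw [div_add' _ _ _ (by positivity), le_div_iff₀ (by positivity)]
    have : e ^ 2 * L ^ 2 ≤ e * L ^ 2 := by gcongr; nlinarith
    nlinarith [sq_nonneg (x - 2 * e * L)]
  have a5 : σ * (θ j - θ 0) ≥ 0 := mul_nonneg hσ (by linarith)
  have a6 : (x ^ 2 + (θ j - θ' k) ^ 2) / (2 * e) =
      x ^ 2 / (4 * e) + x ^ 2 / (4 * e) + (θ j - θ' k) ^ 2 / (2 * e) := by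
    field_simp; ring
  have a7 : 0 ≤ x ^ 2 / (4 * e) := by positivity
  have a8 : 0 ≤ (θ j - θ' k) ^ 2 / (2 * e) := by positivity
  have a9 : 0 ≤ β * (√(1 + ‖q‖ ^ 2) - 1) :=
    mul_nonneg hβ.le (sub_nonneg.2 (one_le_sqrt_one_add_sq _))
  refine ⟨?_, ?_, ?_⟩
  · have : x ^ 2 / (4 * e) ≤ m + 2 * K₀ * T + L ^ 2 := by linarith
    rw [div_le_iff₀ (by positivity)] at this
    linarith
  · have : (θ j - θ' k) ^ 2 / (2 * e) ≤ m + 2 * K₀ * T + L ^ 2 := by linarith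
    rw [div_le_iff₀ (by positivity)] at this
    nlinarith
  · have h1 : β * (√(1 + ‖q‖ ^ 2) - 1) ≤ m + 2 * K₀ * T + L ^ 2 := by linarith
    have h2 : ‖q‖ ≤ √(1 + ‖q‖ ^ 2) := Real.le_sqrt_of_sq_le (by linarith)
    have h3 : √(1 + ‖q‖ ^ 2) - 1 ≤ (m + 2 * K₀ * T + L ^ 2) / β := by
      rw [le_div_iff₀ hβ]
      linarith
    linarith

theorem continuous_of_abs_sub_le {g : Eucl d → ℝ} {L : ℝ}
    (h : ∀ x y, |g x - g y| ≤ L * ‖x - y‖) : Continuous g :=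
  (LipschitzWith.of_dist_le_mul (K := L.toNNReal) fun x y => by
    rw [Real.dist_eq, dist_eq_norm]
    refine (h x y).trans ?_
    gcongr
    exact Real.le_coe_toNNReal L).continuous

/-- There are finitely many index pairs, and the region where the level `m₀` is reached is bounded
in space, so a maximum over a compact ball is a global one. -/
theorem exists_max_doubled (hf : IsTimeChain n θ f L K₀) (hg : IsTimeChain n' θ' g L K₀) {ρ : ℝ}
    (hρ : 0 ≤ ρ) {j₀ k₀ : ℕ} (hj₀ : j₀ ≤ n) (hk₀ : k₀ ≤ n') {Q : Eucl d} (hQ : ‖Q‖ ≤ ρ)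
    (hb : ∀ j ≤ n, ∀ k ≤ n', ∀ q q', m₀ ≤ doubled θ θ' f g e β σ j q k q' → ‖q‖ ≤ ρ ∧ ‖q'‖ ≤ ρ)
    (hm₀ : m₀ ≤ doubled θ θ' f g e β σ j₀ Q k₀ Q) :
    ∃ j ≤ n, ∃ k ≤ n', ∃ q q' : Eucl d, m₀ ≤ doubled θ θ' f g e β σ j q k q' ∧
      ∀ i ≤ n, ∀ l ≤ n', ∀ x y, doubled θ θ' f g e β σ i x l y ≤
        doubled θ θ' f g e β σ j q k q' := by
  have hK : IsCompact (Metric.closedBall (0 : Eucl d) ρ ×ˢ Metric.closedBall (0 : Eucl d) ρ) :=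
    (isCompact_closedBall _ _).prod (isCompact_closedBall _ _)
  have hne : (Metric.closedBall (0 : Eucl d) ρ ×ˢ Metric.closedBall (0 : Eucl d) ρ).Nonempty :=
    ⟨(0, 0), by simpa using hρ⟩
  have h1 : ∀ i : ℕ × ℕ, ∃ z : Eucl d × Eucl d, i.1 ≤ n → i.2 ≤ n' →
      ∀ x y, ‖x‖ ≤ ρ → ‖y‖ ≤ ρ → doubled θ θ' f g e β σ i.1 x i.2 y ≤
        doubled θ θ' f g e β σ i.1 z.1 i.2 z.2 := by
    intro i
    by_cases hi : i.1 ≤ n ∧ i.2 ≤ n'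
    · have c1 := continuous_of_abs_sub_le (hf.space i.1 hi.1)
      have c2 := continuous_of_abs_sub_le (hg.space i.2 hi.2)
      have hcont : Continuous fun z : Eucl d × Eucl d =>
          doubled θ θ' f g e β σ i.1 z.1 i.2 z.2 := by
        unfold doubled
        fun_prop
      obtain ⟨z, -, hz⟩ := hK.exists_isMaxOn hne hcont.continuousOn
      exact ⟨z, fun _ _ x y hx hy => hz (show (x, y) ∈ _ by simpa using ⟨hx, hy⟩)⟩
    · exact ⟨0, fun h h' => absurd ⟨h, h'⟩ hi⟩
  choose z hz using h1
  obtain ⟨i, hi, hmax⟩ := Finset.exists_max_image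
    (Finset.range (n + 1) ×ˢ Finset.range (n' + 1))
    (fun i => doubled θ θ' f g e β σ i.1 (z i).1 i.2 (z i).2) ⟨(0, 0), by simp⟩
  simp only [Finset.mem_product, Finset.mem_range, Nat.lt_succ_iff] at hi hmax
  have hge : m₀ ≤ doubled θ θ' f g e β σ i.1 (z i).1 i.2 (z i).2 :=
    hm₀.trans ((hz (j₀, k₀) hj₀ hk₀ Q Q hQ hQ).trans (hmax (j₀, k₀) ⟨hj₀, hk₀⟩))
  refine ⟨i.1, hi.1, i.2, hi.2, (z i).1, (z i).2, hge, fun j hj k hk x y => ?_⟩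
  by_cases hlt : m₀ ≤ doubled θ θ' f g e β σ j x k y
  · obtain ⟨hx, hy⟩ := hb j hj k hk x y hlt
    exact (hz (j, k) hj hk x y hx hy).trans (hmax (j, k) ⟨hj, hk⟩)
  · exact (not_le.1 hlt).le.trans hge

/-- Semiconcavity of the localizing weight, needed because the viscosity inequalities are tested
with paraboloids only. -/
theorem sqrt_one_add_sq_le (q x : Eucl d) : √(1 + ‖q‖ ^ 2) ≤ √(1 + ‖x‖ ^ 2) +
    inner ℝ ((1 / √(1 + ‖x‖ ^ 2)) • x) (q - x) + ‖q - x‖ ^ 2 := by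
  have h1 := one_le_sqrt_one_add_sq ‖x‖
  have h2 := one_le_sqrt_one_add_sq ‖q‖
  have h3 := Real.sq_sqrt (show (0 : ℝ) ≤ 1 + ‖x‖ ^ 2 by positivity)
  have h4 := Real.sq_sqrt (show (0 : ℝ) ≤ 1 + ‖q‖ ^ 2 by positivity)
  have h5 : ‖q‖ ^ 2 = ‖x‖ ^ 2 + 2 * inner ℝ x (q - x) + ‖q - x‖ ^ 2 := by
    have := norm_add_sq_real x (q - x)
    rwa [add_sub_cancel] at this
  rw [real_inner_smul_left]
  set α := √(1 + ‖x‖ ^ 2)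
  set γ := √(1 + ‖q‖ ^ 2)
  have hα : 0 < α := by linarith
  have h6 : α * γ ≤ α * (α + 1 / α * inner ℝ x (q - x) + ‖q - x‖ ^ 2) := by
    have : α * (α + 1 / α * inner ℝ x (q - x) + ‖q - x‖ ^ 2) =
        α ^ 2 + inner ℝ x (q - x) + α * ‖q - x‖ ^ 2 := by field_simp
    rw [this]
    nlinarith [sq_nonneg (α - γ), sq_nonneg ‖q - x‖]
  exact le_of_mul_le_mul_left h6 hα

theorem norm_inv_sqrt_smul_le (x : Eucl d) : ‖(1 / √(1 + ‖x‖ ^ 2)) • x‖ ≤ 1 := by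
  have h0 : 0 < √(1 + ‖x‖ ^ 2) := by positivity
  rw [norm_smul, norm_div, norm_one, Real.norm_of_nonneg h0.le, one_div, inv_mul_le_iff₀ h0,
    mul_one]
  exact Real.le_sqrt_of_sq_le (by linarith)

theorem norm_sub_sq_eq (x q y : Eucl d) : ‖x - y‖ ^ 2 = ‖q - y‖ ^ 2 +
    2 * inner ℝ (q - y) (x - q) + ‖x - q‖ ^ 2 := by
  have := norm_add_sq_real (q - y) (x - q)
  rwa [show q - y + (x - q) = x - y by abel] at this

/-- The inequality satisfied by the derivatives at a maximum of the penalized difference. -/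
theorem le_of_max_doubled (hL : 0 ≤ L) (hg : IsTimeChain n' θ' g L K₀)
    {ε K ρ : ℝ} (he : 0 < e) (hβ : 0 ≤ β) (hK : 1 / (2 * e) + β ≤ K)
    (hsub : ApproxSub H n θ f ε K ρ) (hsup : ApproxSub (negHam H) n' θ' (fun k x => -g k x) ε K ρ)
    {j k : ℕ} (hj : j ≤ n) (hk : k ≤ n') {q q' : Eucl d} (hq : ‖q‖ ≤ ρ) (hq' : ‖q'‖ ≤ ρ)
    (hθj : θ 0 < θ j) (hθk : θ' 0 < θ' k)
    (hmax : ∀ i ≤ n, ∀ l ≤ n', ∀ x y, doubled θ θ' f g e β σ i x l y ≤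
        doubled θ θ' f g e β σ j q k q') :
    ‖(1 / e) • (q - q')‖ ≤ L ∧
    σ + H (θ j) q ((1 / e) • (q - q') + β • ((1 / √(1 + ‖q‖ ^ 2)) • q)) -
      H (θ' k) q' ((1 / e) • (q - q')) ≤ 2 * ε := by
  -- Freezing `(k, q')` in the maximality, the chain `f` is touched from above at `(j, q)` by a
  -- paraboloid of time slope `(θ j - θ' k) / e + σ`.
  have h1 := hsub j hj hθj q ((1 / e) • (q - q') + β • ((1 / √(1 + ‖q‖ ^ 2)) • q))
    ((θ j - θ' k) / e + σ) hq fun i hi x => by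
      have h2 := hmax i (hi.trans hj) k hk x q'
      simp only [doubled] at h2
      have h3 := mul_le_mul_of_nonneg_left (sqrt_one_add_sq_le x q) hβ
      have h4 := norm_sub_sq_eq x q q'
      have h5 : (θ i - θ' k) ^ 2 = (θ j - θ' k) ^ 2 + 2 * (θ j - θ' k) * (θ i - θ j) +
        (θ i - θ j) ^ 2 := by ring
      have h6 : (1 / (2 * e) + β) * ((θ i - θ j) ^ 2 + ‖x - q‖ ^ 2) ≤
        K * ((θ i - θ j) ^ 2 + ‖x - q‖ ^ 2) := by gcongr
      rw [h4, h5] at h2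
      rw [inner_add_left, real_inner_smul_left, real_inner_smul_left _ _ β]
      have h7 : (‖q - q'‖ ^ 2 + 2 * inner ℝ (q - q') (x - q) + ‖x - q‖ ^ 2 +
          ((θ j - θ' k) ^ 2 + 2 * (θ j - θ' k) * (θ i - θ j) + (θ i - θ j) ^ 2)) / (2 * e) =
          (‖q - q'‖ ^ 2 + (θ j - θ' k) ^ 2) / (2 * e) + 1 / e * inner ℝ (q - q') (x - q) +
          (θ j - θ' k) / e * (θ i - θ j) + 1 / (2 * e) * ((θ i - θ j) ^ 2 + ‖x - q‖ ^ 2) := by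
        field_simp; ring
      rw [h7] at h2
      have h8 : 0 ≤ β * (θ i - θ j) ^ 2 := by positivity
      nlinarith
  -- Freezing `(j, q)` instead, `-g` is touched from above at `(k, q')` with the opposite time
  -- slope, without `σ`.
  have h2' : ∀ i ≤ n', ∀ x, -g i x ≤ -g k q' + (θ' k - θ j) / e * (θ' i - θ' k) +
      inner ℝ ((1 / e) • (q' - q)) (x - q') + K * ((θ' i - θ' k) ^ 2 + ‖x - q'‖ ^ 2) := by
    intro i hi x
    have h2 := hmax j hj i hi q x
    simp only [doubled] at h2
    have h4 := norm_sub_sq_eq x q' q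
    rw [norm_sub_rev x q, norm_sub_rev q' q] at h4
    have h5 : (θ j - θ' i) ^ 2 = (θ j - θ' k) ^ 2 + 2 * (θ' k - θ j) * (θ' i - θ' k) +
      (θ' i - θ' k) ^ 2 := by ring
    have h6 : (1 / (2 * e)) * ((θ' i - θ' k) ^ 2 + ‖x - q'‖ ^ 2) ≤
      K * ((θ' i - θ' k) ^ 2 + ‖x - q'‖ ^ 2) := by gcongr; linarith
    rw [h4, h5] at h2
    rw [real_inner_smul_left]
    have h7 : (‖q - q'‖ ^ 2 + 2 * inner ℝ (q' - q) (x - q') + ‖x - q'‖ ^ 2 +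
        ((θ j - θ' k) ^ 2 + 2 * (θ' k - θ j) * (θ' i - θ' k) + (θ' i - θ' k) ^ 2)) / (2 * e) =
        (‖q - q'‖ ^ 2 + (θ j - θ' k) ^ 2) / (2 * e) + 1 / e * inner ℝ (q' - q) (x - q') +
        (θ' k - θ j) / e * (θ' i - θ' k) + 1 / (2 * e) * ((θ' i - θ' k) ^ 2 + ‖x - q'‖ ^ 2) := by
      field_simp; ring
    rw [h7] at h2
    linarith
  have h2 := hsup k hk hθk q' ((1 / e) • (q' - q)) ((θ' k - θ j) / e) hq'
    fun i hi x => h2' i (hi.trans hk) x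
  have hneg : -((1 / e) • (q' - q)) = (1 / e) • (q - q') := by rw [← smul_neg, neg_sub]
  -- The bound on the momentum is read off on the side of `g`, where the weight `β` does not enter.
  have hp : ‖(1 / e) • (q' - q)‖ ≤ L :=
    norm_le_of_touching (g := fun x => -g k x) (K := K) (Q := q') hL (hg.neg.space k hk) fun x => by
      have := h2' k hk x
      simpa using this
  refine ⟨by rwa [← hneg, norm_neg], ?_⟩
  rw [negHam, hneg] at h2
  have h3 : (θ' k - θ j) / e = -((θ j - θ' k) / e) := by ring
  rw [h3] at h2
  linarith

end Doubled

/-- Comparison of an approximate subsolution with an approximate supersolution on two different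
time grids. -/
theorem exists_comparison (hH : HamiltonianBounds H C) {L K₀ T ρ₀ m η : ℝ} (hL : 0 ≤ L)
    (hK₀ : 0 ≤ K₀) (hT : 0 ≤ T) (hρ₀ : 0 ≤ ρ₀) (hm : 0 ≤ m) (hη : 0 < η) :
    ∃ ε > 0, ∃ K > 0, ∃ ρ > 0, ∀ (n n' : ℕ) (θ θ' : ℕ → ℝ) (f g : ℕ → Eucl d → ℝ) (m₀ : ℝ),
      IsTimeChain n θ f L K₀ → IsTimeChain n' θ' g L K₀ → θ 0 = θ' 0 → 0 ≤ θ 0 → θ n = θ' n' →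
      θ n ≤ T → ApproxSub H n θ f ε K ρ → ApproxSub (negHam H) n' θ' (fun k x => -g k x) ε K ρ →
      (∀ q, f 0 q ≤ g 0 q + m₀ + m) → (∀ q, ‖q‖ ≤ ρ → f 0 q ≤ g 0 q + m₀) →
      ∀ Q, ‖Q‖ ≤ ρ₀ → f n Q ≤ g n' Q + m₀ + η := by
  have hC := hH.pos
  -- `σ` makes the subsolution strict and `β` confines the maximum in space. Together they cost at
  -- most `η / 2` at the final point, and `β` changes the Hamiltonian by at most `σ / 4`.
  obtain ⟨σ, hσ, hσT⟩ : ∃ σ > 0, σ * T ≤ η / 4 := by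
    refine ⟨η / (4 * (T + 1)), by positivity, ?_⟩
    rw [div_mul_eq_mul_div, div_le_div_iff₀ (by positivity) (by norm_num)]
    nlinarith
  obtain ⟨β, hβ, hβ1, hβρ, hβC⟩ : ∃ β > 0, β ≤ 1 ∧ β * ρ₀ ≤ η / 4 ∧ C * (1 + (L + 1)) * β ≤ σ / 4 := by
    refine ⟨min 1 (min (η / (4 * (ρ₀ + 1))) (σ / (4 * (C * (1 + (L + 1)))))), by positivity,
      min_le_left _ _, ?_, ?_⟩
    · have h1 : min 1 (min (η / (4 * (ρ₀ + 1))) (σ / (4 * (C * (1 + (L + 1)))))) ≤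
        η / (4 * (ρ₀ + 1)) := (min_le_right _ _).trans (min_le_left _ _)
      refine (mul_le_mul_of_nonneg_right h1 hρ₀).trans ?_
      rw [div_mul_eq_mul_div, div_le_div_iff₀ (by positivity) (by norm_num)]
      nlinarith
    · have h1 : min 1 (min (η / (4 * (ρ₀ + 1))) (σ / (4 * (C * (1 + (L + 1)))))) ≤
        σ / (4 * (C * (1 + (L + 1)))) := (min_le_right _ _).trans (min_le_right _ _)
      refine (mul_le_mul_of_nonneg_left h1 (by positivity)).trans (le_of_eq ?_)
      field_simp
  -- The global initial gap `m` enters only through `B`, that is, through the radius `ρ` that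
  -- contains the maximum. At the initial time the sharper bound on this ball is then enough.
  set B := m + 2 * K₀ * T + L ^ 2 with hB
  have hB0 : 0 ≤ B := by positivity
  set ρ := B / β + 2 + ρ₀ with hρ
  have hBβ : 0 ≤ B / β := by positivity
  obtain ⟨δ₁, hδ₁, hHδ⟩ := hH.exists_abs_sub_lt 0 T ρ L (show 0 < σ / 4 by positivity)
  obtain ⟨δ, hδ, hδδ, hδ1, hδη⟩ : ∃ δ > 0, δ ≤ δ₁ ∧ δ ≤ 1 ∧ (L + K₀) * δ < η / 2 := by
    refine ⟨min δ₁ (min 1 (η / (4 * (L + K₀ + 1)))), by positivity, min_le_left _ _,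
      (min_le_right _ _).trans (min_le_left _ _), ?_⟩
    have h1 : min δ₁ (min 1 (η / (4 * (L + K₀ + 1)))) ≤ η / (4 * (L + K₀ + 1)) :=
      (min_le_right _ _).trans (min_le_right _ _)
    refine (mul_le_mul_of_nonneg_left h1 (by positivity)).trans_lt ?_
    rw [mul_div_assoc', div_lt_div_iff₀ (by positivity) (by norm_num)]
    nlinarith
  obtain ⟨e, he, he1, heB⟩ : ∃ e > 0, e ≤ 1 ∧ 4 * e * B ≤ δ ^ 2 := by
    refine ⟨min 1 (δ ^ 2 / (4 * (B + 1))), by positivity, min_le_left _ _, ?_⟩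
    have h1 : min 1 (δ ^ 2 / (4 * (B + 1))) ≤ δ ^ 2 / (4 * (B + 1)) := min_le_right _ _
    have h2 : 4 * min 1 (δ ^ 2 / (4 * (B + 1))) * B ≤ 4 * (δ ^ 2 / (4 * (B + 1))) * B := by gcongr
    refine h2.trans ?_
    rw [mul_div_assoc', div_mul_eq_mul_div, div_le_iff₀ (by positivity)]
    nlinarith [sq_nonneg δ]
  -- The error budget at the maximum is `2 ε = σ / 4`, plus `σ / 4` from `β`, plus `σ / 4` from the
  -- modulus of continuity of `H`, which stays below `σ`.
  refine ⟨σ / 8, by positivity, 1 / (2 * e) + β, by positivity, ρ, by positivity, ?_⟩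
  intro n n' θ θ' f g m₀ hf hg h0 hθ0 hn hnT hsub hsup hinit hinitρ Q hQ
  by_contra hcon
  push Not at hcon
  have hbd : ∀ j ≤ n, ∀ k ≤ n', ∀ q q', m₀ + η / 2 ≤ doubled θ θ' f g e β σ j q k q' →
      ‖q - q'‖ ≤ δ ∧ |θ j - θ' k| ≤ δ ∧ ‖q‖ ≤ ρ ∧ ‖q'‖ ≤ ρ := by
    intro j hj k hk q q' h
    obtain ⟨h1, h2, h3⟩ := doubled_bounds hf hg hK₀ hσ.le hβ he he1 h0 hθ0 hn hnT hinit hj hk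
      ((by linarith : m₀ ≤ m₀ + η / 2).trans h)
    have h4 : ‖q - q'‖ ≤ δ := le_of_sq_le_sq (h1.trans heB) hδ.le
    have h5 : ‖q'‖ ≤ ‖q‖ + ‖q - q'‖ := by
      have := norm_sub_le q (q - q')
      rwa [sub_sub_cancel] at this
    refine ⟨h4, abs_le_of_sq_le_sq (h2.trans heB) hδ.le, by linarith, by linarith⟩
  have hstart : m₀ + η / 2 ≤ doubled θ θ' f g e β σ n Q n' Q := by
    rw [doubled, hn]
    have h1 : β * (√(1 + ‖Q‖ ^ 2) - 1) ≤ β * ρ₀ := by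
      gcongr
      have : √(1 + ‖Q‖ ^ 2) ≤ 1 + ‖Q‖ :=
        Real.sqrt_le_iff.2 ⟨by positivity, by nlinarith [norm_nonneg Q]⟩
      linarith
    have h2 : σ * (θ' n' - θ 0) ≤ σ * T := by gcongr; linarith
    simp only [sub_self, norm_zero]
    norm_num
    linarith
  obtain ⟨j, hj, k, hk, q, q', hge, hmax⟩ := exists_max_doubled hf hg (by positivity) le_rfl le_rfl
    (hQ.trans (by linarith)) (fun j hj k hk q q' h => (hbd j hj k hk q q' h).2.2) hstart
  obtain ⟨b1, b2, b3, b4⟩ := hbd j hj k hk q q' hge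
  have hβ0 : 0 ≤ β * (√(1 + ‖q‖ ^ 2) - 1) :=
    mul_nonneg hβ.le (sub_nonneg.2 (one_le_sqrt_one_add_sq _))
  have hσ0 : 0 ≤ σ * (θ j - θ 0) :=
    mul_nonneg hσ.le (sub_nonneg.2 (hf.le_of_le (Nat.zero_le _) hj))
  have he0 : 0 ≤ (‖q - q'‖ ^ 2 + (θ j - θ' k) ^ 2) / (2 * e) := by positivity
  have hdiff : m₀ + η / 2 ≤ f j q - g k q' := by
    rw [doubled] at hge
    linarith
  have hLδ : L * ‖q - q'‖ ≤ L * δ := by gcongr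
  have hKδ : K₀ * |θ j - θ' k| ≤ K₀ * δ := by gcongr
  -- If either time at the maximum is initial, the other is within `δ`; the initial inequality and
  -- the Lipschitz bounds then contradict the value `m₀ + η / 2`.
  rcases (hf.le_of_le (Nat.zero_le _) hj).eq_or_lt with hj0 | hj0
  · have c1 := (abs_le.1 (hf.abs_sub_le (Nat.zero_le _) hj q)).2
    have c2 := (abs_le.1 (hg.abs_sub_le (Nat.zero_le _) hk q)).1
    have c3 := (abs_le.1 (hg.space k hk q q')).2
    have c4 := hinitρ q b3
    rw [← hj0, sub_self, abs_zero, mul_zero] at c1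
    rw [← h0, hj0, abs_sub_comm] at c2
    linarith
  rcases (hg.le_of_le (Nat.zero_le _) hk).eq_or_lt with hk0 | hk0
  · have c1 := (abs_le.1 (hf.abs_sub_le (Nat.zero_le _) hj q)).2
    have c2 := (abs_le.1 (hg.abs_sub_le (Nat.zero_le _) hk q')).1
    have c3 := (abs_le.1 (hg.space 0 (Nat.zero_le _) q q')).2
    have c4 := hinitρ q b3
    rw [← hk0, sub_self, abs_zero, mul_zero] at c2
    rw [h0, hk0] at c1
    linarith
  obtain ⟨hP, hfin⟩ := le_of_max_doubled hL hg he hβ.le le_rfl hsub hsup hj hk b3 b4 hj0 hk0 hmax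
  have hv := norm_inv_sqrt_smul_le q
  have hβv : ‖β • ((1 / √(1 + ‖q‖ ^ 2)) • q)‖ ≤ β := by
    rw [norm_smul, Real.norm_of_nonneg hβ.le]
    exact mul_le_of_le_one_right hβ.le hv
  have d1 := hH.abs_sub_le_snd (θ j) q
    (p := (1 / e) • (q - q') + β • ((1 / √(1 + ‖q‖ ^ 2)) • q)) (p' := (1 / e) • (q - q'))
    (B := L + 1) ((norm_add_le _ _).trans (by linarith)) (by linarith)
  rw [add_sub_cancel_left] at d1
  have d2 : C * (1 + (L + 1)) * ‖β • ((1 / √(1 + ‖q‖ ^ 2)) • q)‖ ≤ C * (1 + (L + 1)) * β := by gcongr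
  have d3 := hHδ (θ j) ⟨by linarith, (hf.le_of_le hj le_rfl).trans hnT⟩ (θ' k)
    ⟨by linarith, (hg.le_of_le hk le_rfl).trans (hn ▸ hnT)⟩ q q' _ b3 b4 hP (b2.trans hδδ)
    (b1.trans hδδ)
  have d4 := (abs_le.1 d1).1
  have d5 := (abs_lt.1 d3).1
  linarith

end Comparison

/-! ### A monotone scheme -/

section Scheme

variable {d : ℕ} {H : ℝ → Eucl d → Eucl d → ℝ} {C : ℝ}

/-- One explicit step of length `h` from the time `t` of a monotone scheme for functions with
gradient bounded by `l`. -/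
noncomputable def schemeStep (H : ℝ → Eucl d → Eucl d → ℝ) (C t h l : ℝ) (u : Eucl d → ℝ)
    (q : Eucl d) : ℝ :=
  ⨅ p : Metric.closedBall (0 : Eucl d) l,
    (⨆ y : Metric.closedBall (0 : Eucl d) (h * (C * (1 + l))), (u (q + y) - inner ℝ (p : Eucl d) y)) -
      h * H t q p

/-! ### One step of the scheme: Lipschitz bounds and consistency. -/

section Step

variable {t h l L : ℝ} {u v : Eucl d → ℝ} {q q' : Eucl d}

theorem bddAbove_schemeStep (hL : 0 ≤ L) (hu : ∀ x y, |u x - u y| ≤ L * ‖x - y‖) (p : Eucl d)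
    (r : ℝ) : BddAbove (range fun y : Metric.closedBall (0 : Eucl d) r =>
      u (q + y) - inner ℝ p (y : Eucl d)) := by
  refine ⟨u q + L * r + ‖p‖ * r, ?_⟩
  rintro _ ⟨⟨y, hy⟩, rfl⟩
  have hy' : ‖y‖ ≤ r := by simpa using hy
  have h1 := (abs_le.1 (hu (q + y) q)).2
  rw [add_sub_cancel_left] at h1
  have h2 := neg_le_of_abs_le (abs_real_inner_le_norm p y)
  have h3 : L * ‖y‖ ≤ L * r := by gcongr
  have h4 : ‖p‖ * ‖y‖ ≤ ‖p‖ * r := by gcongr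
  dsimp only
  linarith

theorem le_iSup_schemeStep (hL : 0 ≤ L) (hu : ∀ x y, |u x - u y| ≤ L * ‖x - y‖) (p : Eucl d)
    {r : ℝ} {y : Eucl d} (hy : ‖y‖ ≤ r) : u (q + y) - inner ℝ p y ≤
      ⨆ y : Metric.closedBall (0 : Eucl d) r, (u (q + y) - inner ℝ p (y : Eucl d)) :=
  le_ciSup (bddAbove_schemeStep hL hu p r)
    (⟨y, by simpa using hy⟩ : Metric.closedBall (0 : Eucl d) r)

theorem bddBelow_schemeStep (hH : HamiltonianBounds H C) (hh : 0 ≤ h) (hl : 0 ≤ l) (hL : 0 ≤ L)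
    (hu : ∀ x y, |u x - u y| ≤ L * ‖x - y‖) :
    BddBelow (range fun p : Metric.closedBall (0 : Eucl d) l =>
      (⨆ y : Metric.closedBall (0 : Eucl d) (h * (C * (1 + l))),
        (u (q + y) - inner ℝ (p : Eucl d) y)) - h * H t q p) := by
  have hC := hH.pos
  refine ⟨u q - h * (C * (1 + l) ^ 2), ?_⟩
  rintro _ ⟨⟨p, hp⟩, rfl⟩
  have hp' : ‖p‖ ≤ l := by simpa using hp
  have h1 := le_iSup_schemeStep (q := q) hL hu p (r := h * (C * (1 + l))) (y := 0)
    (by rw [norm_zero]; positivity)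
  rw [add_zero, inner_zero_right, sub_zero] at h1
  have h2 : h * H t q p ≤ h * (C * (1 + l) ^ 2) := by
    gcongr
    exact (le_abs_self _).trans (hH.abs_le_of_norm_le t q hp')
  dsimp only
  linarith

theorem schemeStep_le (hH : HamiltonianBounds H C) (hh : 0 ≤ h) (hl : 0 ≤ l) (hL : 0 ≤ L)
    (hu : ∀ x y, |u x - u y| ≤ L * ‖x - y‖) {p : Eucl d} (hp : ‖p‖ ≤ l) {c : ℝ}
    (hc : ∀ y, ‖y‖ ≤ h * (C * (1 + l)) → u (q + y) - inner ℝ p y ≤ c) :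
    schemeStep H C t h l u q ≤ c - h * H t q p := by
  have hC := hH.pos
  refine (ciInf_le (bddBelow_schemeStep hH hh hl hL hu)
    (⟨p, by simpa using hp⟩ : Metric.closedBall (0 : Eucl d) l)).trans ?_
  have : Nonempty (Metric.closedBall (0 : Eucl d) (h * (C * (1 + l)))) :=
    ⟨⟨0, by rw [Metric.mem_closedBall, dist_self]; positivity⟩⟩
  have hle : ∀ y : Metric.closedBall (0 : Eucl d) (h * (C * (1 + l))),
      u (q + y) - inner ℝ p (y : Eucl d) ≤ c := fun y => hc y (mem_closedBall_zero_iff.1 y.2)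
  exact sub_le_sub_right (ciSup_le hle) _

theorem le_schemeStep (hl : 0 ≤ l) (hL : 0 ≤ L)
    (hu : ∀ x y, |u x - u y| ≤ L * ‖x - y‖) {c : ℝ}
    (hc : ∀ p : Eucl d, ‖p‖ ≤ l → ∃ y : Eucl d, ‖y‖ ≤ h * (C * (1 + l)) ∧
      c ≤ u (q + y) - inner ℝ p y - h * H t q p) :
    c ≤ schemeStep H C t h l u q := by
  have : Nonempty (Metric.closedBall (0 : Eucl d) l) :=
    ⟨⟨0, by rwa [Metric.mem_closedBall, dist_self]⟩⟩
  refine le_ciInf fun p => ?_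
  obtain ⟨y, hy, hcy⟩ := hc p (mem_closedBall_zero_iff.1 p.2)
  exact hcy.trans (sub_le_sub_right (le_iSup_schemeStep hL hu (p : Eucl d) hy) _)

theorem schemeStep_le_add (hH : HamiltonianBounds H C) (hh : 0 ≤ h) (hl : 0 ≤ l) (hL : 0 ≤ L)
    (hu : ∀ x y, |u x - u y| ≤ L * ‖x - y‖) :
    schemeStep H C t h l u q ≤ schemeStep H C t h l u q' +
      (L + h * (C * (1 + l))) * ‖q - q'‖ := by
  have hC := hH.pos
  rw [← sub_le_iff_le_add]
  have : Nonempty (Metric.closedBall (0 : Eucl d) l) :=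
    ⟨⟨0, by rwa [Metric.mem_closedBall, dist_self]⟩⟩
  refine le_ciInf fun p => ?_
  have hp : ‖(p : Eucl d)‖ ≤ l := mem_closedBall_zero_iff.1 p.2
  set S := ⨆ y : Metric.closedBall (0 : Eucl d) (h * (C * (1 + l))),
        (u (q' + y) - inner ℝ (p : Eucl d) y) with hS
  have h1 := schemeStep_le (t := t) (q := q) hH hh hl hL hu hp (c := S + L * ‖q - q'‖) fun y hy => by
    have h2 := le_iSup_schemeStep (q := q') hL hu (p : Eucl d) hy
    have h3 := (abs_le.1 (hu (q + y) (q' + y))).2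
    rw [add_sub_add_right_eq_sub] at h3
    linarith
  have h2 := (abs_le.1 (hH.abs_sub_le_fst t q q' p)).1
  have h3 : C * (1 + ‖(p : Eucl d)‖) * ‖q - q'‖ ≤ C * (1 + l) * ‖q - q'‖ := by gcongr
  have h4 : h * (H t q' p - H t q p) ≤ h * (C * (1 + l) * ‖q - q'‖) := by
    gcongr
    linarith
  linarith

theorem abs_schemeStep_sub_le (hH : HamiltonianBounds H C) (hh : 0 ≤ h) (hl : 0 ≤ l) (hL : 0 ≤ L)
    (hu : ∀ x y, |u x - u y| ≤ L * ‖x - y‖) (q q' : Eucl d) :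
    |schemeStep H C t h l u q - schemeStep H C t h l u q'| ≤
      (L + h * (C * (1 + l))) * ‖q - q'‖ := by
  have h1 := schemeStep_le_add (t := t) (q := q) (q' := q') hH hh hl hL hu
  have h2 := schemeStep_le_add (t := t) (q := q') (q' := q) hH hh hl hL hu
  rw [norm_sub_rev] at h2
  rw [abs_le]
  constructor <;> linarith

/-- The momentum `p = 0` gives the upper bound and the displacement `y = 0` the lower one. -/
theorem abs_schemeStep_sub_self_le (hH : HamiltonianBounds H C) (hh : 0 ≤ h) (hl : 0 ≤ l)
    (hu : ∀ x y, |u x - u y| ≤ l * ‖x - y‖) (q : Eucl d) :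
    |schemeStep H C t h l u q - u q| ≤ 2 * C * (1 + l) ^ 2 * h := by
  have hC := hH.pos
  have h1 := schemeStep_le (t := t) (q := q) hH hh hl hl hu (p := 0) (by simpa using hl)
    (c := u q + l * (h * (C * (1 + l)))) fun y hy => by
      have h3 := (abs_le.1 (hu (q + y) q)).2
      rw [add_sub_cancel_left] at h3
      rw [inner_zero_left]
      have : l * ‖y‖ ≤ l * (h * (C * (1 + l))) := by gcongr
      linarith
  have h2 := le_schemeStep (H := H) (C := C) (t := t) (h := h) (q := q) hl hl hu
    (c := u q - h * (C * (1 + l) ^ 2)) fun p hp => by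
      refine ⟨0, by rw [norm_zero]; positivity, ?_⟩
      rw [add_zero, inner_zero_right, sub_zero]
      gcongr
      exact (le_abs_self _).trans (hH.abs_le_of_norm_le t q hp)
  have h3 : |h * H t q 0| ≤ h * (C * (1 + l) ^ 2) := by
    rw [abs_mul, abs_of_nonneg hh]
    gcongr
    exact hH.abs_le_of_norm_le t q (by simpa using hl)
  have h4 : l * (h * (C * (1 + l))) ≤ (1 + l) * (h * (C * (1 + l))) := by gcongr; linarith
  have h5 : 0 ≤ h * (C * (1 + l) ^ 2) := by positivity
  rw [abs_le] at h3 ⊢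
  constructor <;> nlinarith

/-- The infimum is bounded by its value at the slope `p` of the test function; displacements then
cost only the quadratic part, at most `M (h C (1 + l))²`. -/
theorem stepSub_schemeStep (hH : HamiltonianBounds H C) (hh : 0 ≤ h) (hl : 0 ≤ l) (hL : 0 ≤ L)
    (hu : ∀ x y, |u x - u y| ≤ L * ‖x - y‖) {M ρ ω t' : ℝ} (hM : 0 ≤ M)
    (hω : ∀ Q p : Eucl d, ‖Q‖ ≤ ρ → ‖p‖ ≤ l → |H t Q p - H t' Q p| ≤ ω) :
    StepSub H u (schemeStep H C t h l u) t' h l M ρ (M * h * (C * (1 + l)) ^ 2 + ω) := by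
  have hC := hH.pos
  intro Q p c hQ hp hle
  have h1 := schemeStep_le (t := t) (q := Q) hH hh hl hL hu hp
    (c := c + M * (h * (C * (1 + l))) ^ 2) fun y hy => by
      have h2 := hle (Q + y)
      have h3 := (abs_le.1 (abs_testFun_sub_inner_le Q p M (Q + y))).2
      rw [add_sub_cancel_left, abs_of_nonneg hM] at h3
      have h4 : M * ‖y‖ ^ 2 ≤ M * (h * (C * (1 + l))) ^ 2 := by gcongr
      linarith
  have h2 := (abs_le.1 (hω Q p hQ hp)).1
  have h3 : h * (H t' Q p - H t Q p) ≤ h * ω := by gcongr; linarith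
  linarith

/-- For each competitor `p'`, the supremum over displacements gains `r ‖-p - p'‖`, where `r` is `h`
times the Lipschitz constant of `H` on momenta of norm at most `l`. This outweighs `h (H p' - H
(-p))`, and it dictates the radius in `schemeStep`. -/
theorem stepSub_neg_schemeStep (hH : HamiltonianBounds H C) (hh : 0 ≤ h) (hl : 0 ≤ l) (hL : 0 ≤ L)
    (hu : ∀ x y, |u x - u y| ≤ L * ‖x - y‖) {M ρ ω t' : ℝ} (hM : 0 ≤ M)
    (hω : ∀ Q p : Eucl d, ‖Q‖ ≤ ρ → ‖p‖ ≤ l → |H t Q p - H t' Q p| ≤ ω) :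
    StepSub (negHam H) (fun x => -u x) (fun x => -schemeStep H C t h l u x) t' h l M ρ
      (M * h * (C * (1 + l)) ^ 2 + ω) := by
  have hC := hH.pos
  intro Q p c hQ hp hle
  set r := h * (C * (1 + l)) with hr
  have hr0 : 0 ≤ r := by positivity
  have h1 := le_schemeStep (H := H) (C := C) (t := t) (h := h) (q := Q) hl hL hu
    (c := -c - M * r ^ 2 - h * H t Q (-p)) fun p' hp' => by
      -- `y` has length `r` and points along `-p - p'`; if this vector vanishes, `y = 0` serves.
      obtain ⟨y, hy, hy'⟩ : ∃ y : Eucl d, ‖y‖ ≤ r ∧ inner ℝ (-p - p') y = r * ‖-p - p'‖ := by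
        by_cases h0 : -p - p' = 0
        · exact ⟨0, by simpa using hr0, by simp [h0]⟩
        · have h0' : 0 < ‖-p - p'‖ := norm_pos_iff.2 h0
          refine ⟨(r / ‖-p - p'‖) • (-p - p'), ?_, ?_⟩
          · rw [norm_smul, norm_div, norm_norm, Real.norm_of_nonneg hr0,
              div_mul_cancel₀ _ h0'.ne']
          · rw [inner_smul_right, real_inner_self_eq_norm_sq]
            field_simp
      refine ⟨y, hy, ?_⟩
      have h2 := hle (Q + y)
      have h3 := (abs_le.1 (abs_testFun_sub_inner_le Q p M (Q + y))).2
      rw [add_sub_cancel_left, abs_of_nonneg hM] at h3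
      have h4 : M * ‖y‖ ^ 2 ≤ M * r ^ 2 := by gcongr
      have h5 := (abs_le.1 (hH.abs_sub_le_snd t Q hp' (p' := -p) (by rwa [norm_neg]))).2
      rw [norm_sub_rev] at h5
      have h6 : h * (H t Q p' - H t Q (-p)) ≤ h * (C * (1 + l) * ‖-p - p'‖) := by gcongr
      rw [inner_sub_left, inner_neg_left] at hy'
      rw [hr] at hy'
      linarith
  have h2 := (abs_le.1 (hω Q (-p) hQ (by rwa [norm_neg]))).2
  have h3 : h * (H t Q (-p) - H t' Q (-p)) ≤ h * ω := by gcongr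
  rw [negHam]
  have h4 : M * r ^ 2 = h * (M * h * (C * (1 + l)) ^ 2) := by rw [hr]; ring
  linarith

end Step

/-- The Lipschitz constant at the time `τ` of the solutions of the scheme. -/
noncomputable def schemeLip (C s₀ B τ : ℝ) : ℝ := Real.exp (2 * C * (τ - s₀)) * B - 1

/-- The iteration of the scheme along the times `θ`, from the initial value `u`. -/
noncomputable def schemeChain (H : ℝ → Eucl d → Eucl d → ℝ) (C : ℝ) (l : ℝ → ℝ) (θ : ℕ → ℝ)
    (u : Eucl d → ℝ) : ℕ → Eucl d → ℝ
  | 0 => u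
  | k + 1 => schemeStep H C (θ k) (θ (k + 1) - θ k) (l (θ (k + 1))) (schemeChain H C l θ u k)

/-! ### Iteration of the scheme. -/

section SchemeChain

variable {s₀ B : ℝ} {θ : ℕ → ℝ} {n : ℕ} {u : Eucl d → ℝ}

theorem schemeLip_mono (hC : 0 ≤ C) (hB : 1 ≤ B) {τ τ' : ℝ} (h : τ ≤ τ') :
    schemeLip C s₀ B τ ≤ schemeLip C s₀ B τ' := by
  unfold schemeLip
  gcongr

theorem schemeLip_nonneg (hC : 0 ≤ C) (hB : 1 ≤ B) {τ : ℝ} (h : s₀ ≤ τ) :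
    0 ≤ schemeLip C s₀ B τ := by
  have h1 : 1 ≤ Real.exp (2 * C * (τ - s₀)) :=
    Real.one_le_exp (mul_nonneg (by positivity) (by linarith))
  unfold schemeLip
  nlinarith

/-- A discrete Gronwall estimate, implicit because the step uses the slope bound at its end. With `x
= C (τ' - τ)` it reduces to `exp (2 x) (1 - x) ≥ 1`, which holds for `0 ≤ x ≤ 1 / 2`; this is why
the rate is `2 C`. -/
theorem schemeLip_step (hC : 0 ≤ C) (hB : 1 ≤ B) {τ τ' : ℝ} (h : τ ≤ τ')
    (hδ : (τ' - τ) * C ≤ 1 / 2) :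
    schemeLip C s₀ B τ + (τ' - τ) * (C * (1 + schemeLip C s₀ B τ')) ≤ schemeLip C s₀ B τ' := by
  unfold schemeLip
  have h1 : Real.exp (2 * C * (τ' - s₀)) =
      Real.exp (2 * C * (τ' - τ)) * Real.exp (2 * C * (τ - s₀)) := by
    rw [← Real.exp_add]; ring_nf
  rw [h1]
  have h2 := Real.add_one_le_exp (2 * C * (τ' - τ))
  set x := (τ' - τ) * C with hx
  have hx0 : 0 ≤ x := mul_nonneg (by linarith) hC
  have h3 : 1 ≤ Real.exp (2 * C * (τ' - τ)) * (1 - x) := by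
    have : (2 * C * (τ' - τ) + 1) * (1 - x) ≤ Real.exp (2 * C * (τ' - τ)) * (1 - x) :=
      mul_le_mul_of_nonneg_right h2 (by linarith)
    nlinarith
  have h4 : 0 ≤ Real.exp (2 * C * (τ - s₀)) * B := by positivity
  have h5 := mul_le_mul_of_nonneg_right h3 h4
  have h6 : (τ' - τ) * (C * (1 + (Real.exp (2 * C * (τ' - τ)) * Real.exp (2 * C * (τ - s₀)) * B - 1)))
    = x * (Real.exp (2 * C * (τ' - τ)) * (Real.exp (2 * C * (τ - s₀)) * B)) := by
    rw [hx]; ring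
  rw [h6]
  linarith

theorem abs_schemeChain_sub_le (hH : HamiltonianBounds H C) (hB : 1 ≤ B) (hs : s₀ ≤ θ 0)
    (hmono : ∀ k < n, θ k ≤ θ (k + 1)) (hδ : ∀ k < n, (θ (k + 1) - θ k) * C ≤ 1 / 2)
    (hu : ∀ x y, |u x - u y| ≤ schemeLip C s₀ B (θ 0) * ‖x - y‖) :
    ∀ k ≤ n, s₀ ≤ θ k ∧ ∀ x y, |schemeChain H C (schemeLip C s₀ B) θ u k x -
      schemeChain H C (schemeLip C s₀ B) θ u k y| ≤ schemeLip C s₀ B (θ k) * ‖x - y‖ := by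
  have hC := hH.pos
  intro k
  induction k with
  | zero => exact fun _ => ⟨hs, hu⟩
  | succ k ih =>
    intro hk
    obtain ⟨h1, h2⟩ := ih (by omega)
    have h3 := hmono k (by omega)
    refine ⟨h1.trans h3, fun x y => ?_⟩
    refine (abs_schemeStep_sub_le hH (sub_nonneg.2 h3) (schemeLip_nonneg hC.le hB (h1.trans h3))
      (schemeLip_nonneg hC.le hB h1) h2 x y).trans ?_
    gcongr
    exact schemeLip_step hC.le hB h3 (hδ k (by omega))

theorem isTimeChain_schemeChain (hH : HamiltonianBounds H C) (hB : 1 ≤ B) (hs : s₀ ≤ θ 0)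
    (hmono : ∀ k < n, θ k ≤ θ (k + 1)) (hδ : ∀ k < n, (θ (k + 1) - θ k) * C ≤ 1 / 2)
    (hu : ∀ x y, |u x - u y| ≤ schemeLip C s₀ B (θ 0) * ‖x - y‖) {L : ℝ}
    (hL : ∀ k ≤ n, schemeLip C s₀ B (θ k) ≤ L) :
    IsTimeChain n θ (schemeChain H C (schemeLip C s₀ B) θ u) L (2 * C * (1 + L) ^ 2) := by
  have hC := hH.pos
  have key := abs_schemeChain_sub_le hH hB hs hmono hδ hu
  refine ⟨hmono, fun k hk x y => ((key k hk).2 x y).trans ?_, fun k hk x => ?_⟩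
  · gcongr
    exact hL k hk
  · have h3 := hmono k hk
    have h4 := (key k hk.le).1
    have h5 := schemeLip_nonneg hC.le hB h4
    have h6 := schemeLip_mono (s₀ := s₀) hC.le hB h3
    refine (abs_schemeStep_sub_self_le hH (sub_nonneg.2 h3) (h5.trans h6) (fun x y =>
      ((key k hk.le).2 x y).trans (by gcongr)) x).trans ?_
    have h7 := hL (k + 1) hk
    have h8 := h5.trans h6
    have : 0 ≤ θ (k + 1) - θ k := sub_nonneg.2 h3
    gcongr

/-- The solutions of the scheme on fine grids are approximate solutions. -/
theorem exists_approxSub_schemeChain (hH : HamiltonianBounds H C) {T L ε K ρ : ℝ} (hL : 0 ≤ L)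
    (hε : 0 < ε) (hK : 0 ≤ K) :
    ∃ δ > 0, ∀ (s₀ B : ℝ) (n : ℕ) (θ : ℕ → ℝ) (u : Eucl d → ℝ), 1 ≤ B → s₀ ≤ θ 0 → 0 ≤ θ 0 →
      θ n ≤ T → (∀ k < n, θ k ≤ θ (k + 1)) → (∀ k < n, θ (k + 1) - θ k ≤ δ) →
      (∀ x y, |u x - u y| ≤ schemeLip C s₀ B (θ 0) * ‖x - y‖) →
      (∀ k ≤ n, schemeLip C s₀ B (θ k) ≤ L) →
      IsTimeChain n θ (schemeChain H C (schemeLip C s₀ B) θ u) L (2 * C * (1 + L) ^ 2) ∧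
      ApproxSub H n θ (schemeChain H C (schemeLip C s₀ B) θ u) ε K ρ ∧
      ApproxSub (negHam H) n θ (fun k x => -schemeChain H C (schemeLip C s₀ B) θ u k x) ε K ρ := by
  have hC := hH.pos
  set K₀ := 2 * C * (1 + L) ^ 2 with hK₀
  set M := 4 * K + 4 * L + 2 * K₀ + K with hM
  have hM0 : 0 ≤ M := by positivity
  obtain ⟨δ₁, hδ₁, hω⟩ := hH.exists_abs_sub_lt 0 T ρ L (show 0 < ε / 3 by positivity)
  -- Each summand of `D` is one smallness condition on the mesh; `δ D ≤ 1` implies all of them.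
  set D := 1 + 2 * C + 3 * K / ε + 3 * M * (C * (1 + L)) ^ 2 / ε with hD
  have hKε : 0 ≤ 3 * K / ε := by positivity
  have hMε : 0 ≤ 3 * M * (C * (1 + L)) ^ 2 / ε := by positivity
  have hD0 : 0 < D := by positivity
  refine ⟨min δ₁ (1 / D), by positivity, ?_⟩
  intro s₀ B n θ u hB hs hθ0 hθT hmono hδ hu hl
  set δ := min δ₁ (1 / D) with hδdef
  have hδD : δ * D ≤ 1 := by
    have : δ ≤ 1 / D := min_le_right _ _
    rwa [le_div_iff₀ hD0] at this
  have hδ0 : 0 < δ := by positivity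
  have hδ1 : δ ≤ 1 := by nlinarith
  have hδC : δ * C ≤ 1 / 2 := by nlinarith
  have hδK : K * δ ≤ ε / 3 := by
    have h1 : δ * (3 * K / ε) ≤ 1 := by nlinarith
    rw [mul_div_assoc', div_le_one hε] at h1
    linarith
  have hδM : M * δ * (C * (1 + L)) ^ 2 ≤ ε / 3 := by
    have h1 : δ * (3 * M * (C * (1 + L)) ^ 2 / ε) ≤ 1 := by nlinarith
    rw [mul_div_assoc', div_le_one hε] at h1
    linarith
  have hδC' : ∀ k < n, (θ (k + 1) - θ k) * C ≤ 1 / 2 := fun k hk =>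
    (mul_le_mul_of_nonneg_right (hδ k hk) hC.le).trans hδC
  have hchain := isTimeChain_schemeChain hH hB hs hmono hδC' hu hl
  have key := abs_schemeChain_sub_le hH hB hs hmono hδC' hu
  have hθ : ∀ k ≤ n, θ k ∈ Icc 0 T := fun k hk =>
    ⟨hθ0.trans (hchain.le_of_le (Nat.zero_le k) hk), (hchain.le_of_le hk le_rfl).trans hθT⟩
  have hl0 : ∀ k ≤ n, 0 ≤ schemeLip C s₀ B (θ k) := fun k hk =>
    schemeLip_nonneg hC.le hB (key k hk).1
  have hstepω : ∀ k < n, ∀ Q p : Eucl d, ‖Q‖ ≤ ρ → ‖p‖ ≤ schemeLip C s₀ B (θ (k + 1)) →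
      |H (θ k) Q p - H (θ (k + 1)) Q p| ≤ ε / 3 := fun k hk Q p hQ hp => by
    refine (hω _ (hθ k hk.le) _ (hθ (k + 1) hk) Q Q p hQ hQ (hp.trans (hl _ hk)) ?_ ?_).le
    · rw [abs_sub_comm, abs_of_nonneg (sub_nonneg.2 (hmono k hk))]
      exact (hδ k hk).trans (min_le_left _ _)
    · rw [sub_self, norm_zero]
      exact hδ₁.le
  have herr : ∀ k < n, M * (θ (k + 1) - θ k) * (C * (1 + schemeLip C s₀ B (θ (k + 1)))) ^ 2 + ε / 3 ≤
      2 * ε / 3 := fun k hk => by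
    have h1 := hδ k hk
    have h2 := hl (k + 1) hk
    have h3 := hl0 (k + 1) hk
    have : M * (θ (k + 1) - θ k) * (C * (1 + schemeLip C s₀ B (θ (k + 1)))) ^ 2 ≤
      M * δ * (C * (1 + L)) ^ 2 := by
      have := sub_nonneg.2 (hmono k hk)
      gcongr
    linarith
  have hmonoStep : ∀ {H' : ℝ → Eucl d → Eucl d → ℝ} {f g : Eucl d → ℝ} {t h l e e' : ℝ},
      0 ≤ h → e ≤ e' → StepSub H' f g t h l M ρ e → StepSub H' f g t h l M ρ e' := by
    intro H' f g t h l e e' hh he hst Q p c hQ hp hle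
    have h1 := hst Q p c hQ hp hle
    have h2 : h * e ≤ h * e' := by gcongr
    linarith
  -- `IsTimeChain.approxSub` asks for nonnegative slope bounds at every index, while `schemeLip` is
  -- known to be nonnegative only up to `n`.
  have hlift : ∀ k : ℕ, 0 ≤ max 0 (schemeLip C s₀ B (θ k)) := fun k => le_max_left _ _
  have hmax : ∀ k ≤ n, max 0 (schemeLip C s₀ B (θ k)) = schemeLip C s₀ B (θ k) := fun k hk =>
    max_eq_right (hl0 k hk)
  refine ⟨hchain, ?_, ?_⟩
  · have h1 := hchain.approxSub (H := H) (K := K) (ρ := ρ) (ε := 2 * ε / 3) (δ := δ) (M := M) hL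
      (by positivity) hK (l := fun k => max 0 (schemeLip C s₀ B (θ k))) hlift
      (fun k hk x y => by rw [hmax k hk]; exact (key k hk).2 x y)
      (fun k hk => by rw [hmax k hk]; exact hl k hk) hδ hδ1 le_rfl fun k hk hlt => by
        rw [hmax _ hk]
        exact hmonoStep (sub_nonneg.2 hlt.le) (herr k hk) (stepSub_schemeStep hH
          (sub_nonneg.2 hlt.le) (hl0 _ hk) (hl0 k hk.le) (key k hk.le).2 hM0 (hstepω k hk))
    intro j hj h0j Q p a hQ ht
    exact (h1 j hj h0j Q p a hQ ht).trans (by linarith)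
  · have h1 := hchain.neg.approxSub (H := negHam H) (K := K) (ρ := ρ) (ε := 2 * ε / 3) (δ := δ)
      (M := M) hL (by positivity) hK (l := fun k => max 0 (schemeLip C s₀ B (θ k))) hlift
      (fun k hk x y => by
        rw [hmax k hk, neg_sub_neg, abs_sub_comm]
        exact (key k hk).2 x y)
      (fun k hk => by rw [hmax k hk]; exact hl k hk) hδ hδ1 le_rfl fun k hk hlt => by
        rw [hmax _ hk]
        exact hmonoStep (sub_nonneg.2 hlt.le) (herr k hk) (stepSub_neg_schemeStep hH
          (sub_nonneg.2 hlt.le) (hl0 _ hk) (hl0 k hk.le) (key k hk.le).2 hM0 (hstepω k hk))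
    intro j hj h0j Q p a hQ ht
    exact (h1 j hj h0j Q p a hQ ht).trans (by linarith)

end SchemeChain

end Scheme

/-! ### Calculus in spaces of continuous paths -/

section PathCalculus

open ContinuousLinearMap in
/-- Pointwise application of a continuous family of linear maps to a continuous function. -/
noncomputable def applyPath (T F G : Type*) [TopologicalSpace T] [CompactSpace T]
    [NormedAddCommGroup F] [NormedSpace ℝ F] [NormedAddCommGroup G] [NormedSpace ℝ G] :
    C(T, F →L[ℝ] G) →L[ℝ] C(T, F) →L[ℝ] C(T, G) :=
  LinearMap.mkContinuous₂
    (LinearMap.mk₂ ℝ (fun (A : C(T, F →L[ℝ] G)) (v : C(T, F)) =>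
        (⟨fun τ => A τ (v τ), A.continuous.clm_apply v.continuous⟩ : C(T, G)))
      (fun A B v => by ext; simp) (fun c A v => by ext; simp)
      (fun A v w => by ext; simp) (fun c A v => by ext; simp)) 1 fun A v => by
    rw [one_mul, ContinuousMap.norm_le _ (by positivity)]
    exact fun τ => (le_opNorm _ _).trans (mul_le_mul (A.norm_coe_le_norm τ) (v.norm_coe_le_norm τ)
      (norm_nonneg (v τ)) (norm_nonneg A))

variable {T F G : Type*} [TopologicalSpace T] [CompactSpace T]
    [NormedAddCommGroup F] [NormedSpace ℝ F] [NormedAddCommGroup G] [NormedSpace ℝ G]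

/-- The derivative of a `C¹` map as a continuous map. -/
noncomputable def fderivMap (g : F → G) (hg : ContDiff ℝ 1 g) : C(F, F →L[ℝ] G) :=
  ⟨fderiv ℝ g, hg.continuous_fderiv (by norm_num)⟩

/-- Composition with a `C¹` map is differentiable on spaces of continuous functions. -/
theorem hasFDerivAt_postcomp (g : F → G) (hg : ContDiff ℝ 1 g) (z : C(T, F)) :
    HasFDerivAt (fun z : C(T, F) => (⟨g, hg.continuous⟩ : C(F, G)).comp z)
      (applyPath T F G ((fderivMap g hg).comp z)) z := by
  rw [hasFDerivAt_iff_isLittleO_nhds_zero, Asymptotics.isLittleO_iff]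
  intro c hc
  have hcont : Continuous fun z : C(T, F) => (fderivMap g hg).comp z :=
    ContinuousMap.continuous_postcomp (fderivMap g hg)
  -- Continuity of `z ↦ fderiv g ∘ z` in the uniform norm makes the pointwise mean value estimate
  -- uniform in `τ`.
  obtain ⟨δ, hδ, hball⟩ := Metric.eventually_nhds_iff.1 (Metric.tendstoUniformly_iff.1
    (ContinuousMap.tendsto_iff_tendstoUniformly.1 (hcont.tendsto z)) c hc)
  filter_upwards [Metric.ball_mem_nhds (0 : C(T, F)) hδ] with v hv
  rw [mem_ball_zero_iff] at hv
  rw [ContinuousMap.norm_le _ (by positivity)]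
  intro τ
  have h1 : ‖g (z τ + v τ) - g (z τ) - fderiv ℝ g (z τ) (z τ + v τ - z τ)‖ ≤
      c * ‖z τ + v τ - z τ‖ := by
    refine Convex.norm_image_sub_le_of_norm_hasFDerivWithin_le' (𝕜 := ℝ) (f := g)
      (f' := fderiv ℝ g) (s := segment ℝ (z τ) (z τ + v τ))
      (fun x _ => ((hg.differentiable (by norm_num)) x).hasFDerivAt.hasFDerivWithinAt)
      (fun x hx => ?_) (convex_segment _ _) (left_mem_segment _ _ _) (right_mem_segment _ _ _)
    rw [segment_eq_image'] at hx
    obtain ⟨r, hr, rfl⟩ := hx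
    have h2 := hball (y := z + r • v) (by
      rw [dist_eq_norm, add_sub_cancel_left, norm_smul, Real.norm_of_nonneg hr.1]
      exact (mul_le_of_le_one_left (norm_nonneg _) hr.2).trans_lt hv) τ
    rw [dist_comm, dist_eq_norm] at h2
    simpa [fderivMap] using h2.le
  rw [add_sub_cancel_left] at h1
  refine h1.trans ?_
  gcongr
  exact v.norm_coe_le_norm τ

theorem contDiff_postcomp (g : F → G) (hg : ContDiff ℝ 1 g) :
    ContDiff ℝ 1 (fun z : C(T, F) => (⟨g, hg.continuous⟩ : C(F, G)).comp z) :=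
  contDiff_one_iff_hasFDerivAt.2 ⟨_, (applyPath T F G).continuous.comp
    (ContinuousMap.continuous_postcomp (fderivMap g hg)), hasFDerivAt_postcomp g hg⟩

/-- The constant paths. -/
noncomputable def constPath (E : Type*) [NormedAddCommGroup E] [NormedSpace ℝ E] :
    E →L[ℝ] C(unitInterval, E) :=
  LinearMap.mkContinuous
    { toFun := fun x => ContinuousMap.const _ x
      map_add' := fun _ _ => rfl
      map_smul' := fun _ _ => rfl } 1 fun x => by
    rw [one_mul, ContinuousMap.norm_le _ (norm_nonneg _)]
    exact fun _ => le_rfl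

@[simp]
theorem constPath_apply {E : Type*} [NormedAddCommGroup E] [NormedSpace ℝ E] (x : E)
    (σ : unitInterval) : constPath E x σ = x := rfl

variable {E : Type*} [NormedAddCommGroup E] [NormedSpace ℝ E]

/-- The primitive of a continuous path. -/
noncomputable def primitive (y : C(unitInterval, E)) (σ : ℝ) : E :=
  ∫ τ in (0 : ℝ)..σ, IccExtend zero_le_one y τ

theorem hasDerivAt_primitive [CompleteSpace E] (y : C(unitInterval, E)) (σ : ℝ) :
    HasDerivAt (primitive y) (IccExtend zero_le_one y σ) σ :=
  (continuous_IccExtend_iff.2 y.continuous).integral_hasStrictDerivAt 0 σ |>.hasDerivAt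

theorem norm_primitive_le (y : C(unitInterval, E)) {σ : ℝ} (hσ : σ ∈ Icc (0 : ℝ) 1) :
    ‖primitive y σ‖ ≤ ‖y‖ := by
  have h1 : ‖primitive y σ‖ ≤ ‖y‖ * |σ - 0| :=
    intervalIntegral.norm_integral_le_of_norm_le_const fun τ _ => y.norm_coe_le_norm _
  refine h1.trans (mul_le_of_le_one_right (norm_nonneg _) ?_)
  rw [sub_zero, abs_of_nonneg hσ.1]
  exact hσ.2

/-- The primitive as an operator on continuous paths. -/
noncomputable def primitivePath (E : Type*) [NormedAddCommGroup E] [NormedSpace ℝ E]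
    [CompleteSpace E] : C(unitInterval, E) →L[ℝ] C(unitInterval, E) :=
  LinearMap.mkContinuous
    { toFun := fun y => ⟨fun σ => primitive y σ,
        (continuous_iff_continuousAt.2 fun σ =>
          (hasDerivAt_primitive y σ).continuousAt).comp continuous_subtype_val⟩
      map_add' := fun y y' => by
        ext σ
        exact intervalIntegral.integral_add
          ((continuous_IccExtend_iff.2 y.continuous).intervalIntegrable _ _)
          ((continuous_IccExtend_iff.2 y'.continuous).intervalIntegrable _ _)
      map_smul' := fun c y => by
        ext σ
        exact intervalIntegral.integral_smul c _ } 1 fun y => by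
    rw [one_mul, ContinuousMap.norm_le _ (norm_nonneg _)]
    exact fun σ => norm_primitive_le y σ.2

@[simp]
theorem primitivePath_apply [CompleteSpace E] (y : C(unitInterval, E)) (σ : unitInterval) :
    primitivePath E y σ = primitive y σ := rfl

theorem primitive_zero (y : C(unitInterval, E)) : primitive y 0 = 0 := by simp [primitive]

/-- A parametrized contraction of class `C¹` has a fixed point of class `C¹`. -/
theorem exists_contDiffAt_fixedPoint {Λ X : Type*} [NormedAddCommGroup Λ] [NormedSpace ℝ Λ]
    [CompleteSpace Λ] [NormedAddCommGroup X] [NormedSpace ℝ X] [CompleteSpace X] {Φ : Λ × X → X}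
    (hΦ : ContDiff ℝ 1 Φ) {U : Set Λ} (hU : IsOpen U) {k : Λ → ℝ≥0} (hk : ∀ v ∈ U, k v < 1)
    (hlip : ∀ v ∈ U, LipschitzWith (k v) fun x => Φ (v, x)) :
    ∃ x : Λ → X, (∀ v ∈ U, Φ (v, x v) = x v) ∧ ∀ v ∈ U, ContDiffAt ℝ 1 x v := by
  have hc : ∀ v ∈ U, ContractingWith (k v) fun x => Φ (v, x) := fun v hv => ⟨hk v hv, hlip v hv⟩
  classical
  obtain ⟨x, hxv⟩ : ∃ x : Λ → X, ∀ v ∈ U, Φ (v, x v) = x v :=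
    ⟨fun v => if hv : v ∈ U then ContractingWith.fixedPoint _ (hc v hv) else 0, fun v hv => by
      dsimp only
      rw [dif_pos hv]
      exact (hc v hv).fixedPoint_isFixedPt⟩
  refine ⟨x, hxv, ?_⟩
  · intro v hv
    have hf : ContDiff ℝ 1 fun w : Λ × X => w.2 - Φ w := contDiff_snd.sub hΦ
    set f := fun w : Λ × X => w.2 - Φ w with hfdef
    -- The partial derivative of `Φ` in the second variable has norm at most `k v < 1`. By the
    -- Neumann series, the implicit function theorem applies to `x - Φ (v, x)`.
    have hinv : (fderiv ℝ f (v, x v) ∘L .inr ℝ Λ X).IsInvertible := by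
      have h1 : HasFDerivAt (fun y => Φ (v, y))
          ((fderiv ℝ Φ (v, x v)).comp (.inr ℝ Λ X)) (x v) :=
        ((hΦ.differentiable (by norm_num)) (v, x v)).hasFDerivAt.comp (x v)
          (hasFDerivAt_prodMk_right v (x v))
      have h2 : ‖(fderiv ℝ Φ (v, x v)).comp (.inr ℝ Λ X)‖ < 1 := by
        rw [← h1.fderiv]
        exact (norm_fderiv_le_of_lipschitz ℝ (hlip v hv)).trans_lt (hk v hv)
      have h3 : fderiv ℝ f (v, x v) ∘L .inr ℝ Λ X =
          1 - (fderiv ℝ Φ (v, x v)).comp (.inr ℝ Λ X) := by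
        have h4 : HasFDerivAt f (ContinuousLinearMap.snd ℝ Λ X - fderiv ℝ Φ (v, x v)) (v, x v) :=
          hasFDerivAt_snd.sub ((hΦ.differentiable (by norm_num)) (v, x v)).hasFDerivAt
        rw [h4.fderiv]
        ext y
        simp
      rw [h3]
      obtain ⟨e, he⟩ := isUnit_one_sub_of_norm_lt_one h2
      refine ContinuousLinearMap.IsInvertible.of_inverse (g := (↑e⁻¹ : X →L[ℝ] X)) ?_ ?_
      · rw [← he]
        exact e.mul_inv
      · rw [← he]
        exact e.inv_mul
    have hcd : ContDiffAt ℝ 1 f (v, x v) := hf.contDiffAt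
    have h5 := hcd.contDiffAt_implicitFunction one_ne_zero hinv
    refine h5.congr_of_eventuallyEq ?_
    -- The implicit function also consists of fixed points; uniqueness identifies it with `x` near
    -- `v`.
    filter_upwards [hcd.eventually_apply_implicitFunction one_ne_zero hinv, hU.mem_nhds hv]
      with w hw hwU
    have h6 : f (v, x v) = 0 := by
      rw [hfdef]
      exact sub_eq_zero.2 (hxv v hv).symm
    rw [h6] at hw
    have h7 : Φ (w, hcd.implicitFunction one_ne_zero hinv w) =
      hcd.implicitFunction one_ne_zero hinv w := (sub_eq_zero.1 hw).symm
    exact (hc w hwU).fixedPoint_unique' (hxv w hwU) h7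

end PathCalculus

/-! ### Classical solutions by characteristics -/

section ClassicalSolution

variable {d : ℕ} {H : ℝ → Eucl d → Eucl d → ℝ} {C : ℝ}

/-- The Hamiltonian vector field. -/
noncomputable def charField (H : ℝ → Eucl d → Eucl d → ℝ) (x : ℝ × Eucl d × Eucl d) :
    Eucl d × Eucl d :=
  (gradP H x.1 x.2.1 x.2.2, -gradQ H x.1 x.2.1 x.2.2)

theorem HamiltonianBounds.contDiff_charField (hH : HamiltonianBounds H C) :
    ContDiff ℝ 1 (charField H) :=
  hH.contDiff_gradP.prodMk hH.contDiff_gradQ.neg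

theorem HamiltonianBounds.norm_charField_sub_le (hH : HamiltonianBounds H C) (t : ℝ)
    (x y : Eucl d × Eucl d) : ‖charField H (t, x) - charField H (t, y)‖ ≤ 2 * C * ‖x - y‖ := by
  have hC := hH.pos
  have h1 : ‖x.1 - y.1‖ ≤ ‖x - y‖ := norm_fst_le (x - y)
  have h2 : ‖x.2 - y.2‖ ≤ ‖x - y‖ := norm_snd_le (x - y)
  have h3 : C * (‖x.1 - y.1‖ + ‖x.2 - y.2‖) ≤ 2 * C * ‖x - y‖ := by nlinarith
  refine norm_prod_le_iff.2 ⟨(hH.norm_gradP_sub_le t _ _ _ _).trans h3, ?_⟩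
  refine le_trans (le_of_eq ?_) ((hH.norm_gradQ_sub_le t x.1 x.2 y.1 y.2).trans h3)
  rw [← norm_neg]
  congr 1
  simp [charField]
  abel

/-- A path in phase space together with its time parameter, which runs from `a` to `t`. -/
def phasePath (a t : ℝ) (x : C(unitInterval, Eucl d × Eucl d)) : C(unitInterval, ℝ × Eucl d × Eucl d) :=
  ⟨fun σ => (a + σ * (t - a), x σ), by fun_prop⟩

theorem contDiff_phasePath (a : ℝ) : ContDiff ℝ 1
    fun v : ℝ × C(unitInterval, Eucl d × Eucl d) => phasePath a v.1 v.2 := by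
  have h : (fun v : ℝ × C(unitInterval, Eucl d × Eucl d) => phasePath a v.1 v.2) = fun v =>
      (ContinuousLinearMap.inl ℝ ℝ (Eucl d × Eucl d)).compLeftContinuous ℝ unitInterval
        (constPath ℝ a + (v.1 - a) • (⟨fun σ => (σ : ℝ), continuous_subtype_val⟩ : C(unitInterval, ℝ))) +
      (ContinuousLinearMap.inr ℝ ℝ (Eucl d × Eucl d)).compLeftContinuous ℝ unitInterval v.2 := by
    funext v
    ext σ : 1
    simp [phasePath, mul_comm]
  rw [h]
  refine ContDiff.add (ContinuousLinearMap.contDiff _ |>.comp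
    (contDiff_const.add ((contDiff_fst.sub contDiff_const).smul contDiff_const)))
    (ContinuousLinearMap.contDiff _ |>.comp contDiff_snd)

/-- The reparametrized Hamiltonian vector field along a path. -/
noncomputable def charPath (hH : HamiltonianBounds H C) (a : ℝ)
    (v : ℝ × C(unitInterval, Eucl d × Eucl d)) : C(unitInterval, Eucl d × Eucl d) :=
  (v.1 - a) • (⟨charField H, hH.contDiff_charField.continuous⟩ :
    C(ℝ × Eucl d × Eucl d, Eucl d × Eucl d)).comp (phasePath a v.1 v.2)

@[simp]
theorem charPath_apply (hH : HamiltonianBounds H C) (a : ℝ) (v : ℝ × C(unitInterval, Eucl d × Eucl d))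
    (σ : unitInterval) : charPath hH a v σ = (v.1 - a) • charField H (a + σ * (v.1 - a), v.2 σ) := rfl

theorem contDiff_charPath (hH : HamiltonianBounds H C) (a : ℝ) :
    ContDiff ℝ 1 (charPath hH a) :=
  (contDiff_fst.sub contDiff_const).smul
    ((contDiff_postcomp _ hH.contDiff_charField).comp (contDiff_phasePath a))

theorem norm_charPath_sub_le (hH : HamiltonianBounds H C) (a t : ℝ)
    (x y : C(unitInterval, Eucl d × Eucl d)) :
    ‖charPath hH a (t, x) - charPath hH a (t, y)‖ ≤ 2 * C * |t - a| * ‖x - y‖ := by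
  have hC := hH.pos
  rw [ContinuousMap.norm_le _ (by positivity)]
  intro σ
  rw [ContinuousMap.sub_apply, charPath_apply, charPath_apply, ← smul_sub, norm_smul,
    Real.norm_eq_abs]
  calc |t - a| * ‖charField H (a + σ * (t - a), x σ) - charField H (a + σ * (t - a), y σ)‖
      ≤ |t - a| * (2 * C * ‖x - y‖) := by
        gcongr
        refine (hH.norm_charField_sub_le _ _ _).trans ?_
        gcongr
        exact (x - y).norm_coe_le_norm σ
    _ = _ := by ring

theorem contDiff_gradient {ψ : Eucl d → ℝ} (hψ : ContDiff ℝ 2 ψ) : ContDiff ℝ 1 (gradient ψ) :=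
  (InnerProductSpace.toDual ℝ (Eucl d)).symm.contDiff.comp (hψ.fderiv_right (by norm_num))

/-- The initial position of the characteristic with prescribed final position. -/
noncomputable def charStart (hH : HamiltonianBounds H C) (a : ℝ)
    (w : (ℝ × Eucl d) × C(unitInterval, Eucl d × Eucl d)) : Eucl d :=
  w.1.2 - (primitive (charPath hH a (w.1.1, w.2)) 1).1

/-- The Picard operator of the boundary value problem for characteristics. -/
noncomputable def charMap (hH : HamiltonianBounds H C) (ψ : Eucl d → ℝ) (a : ℝ)
    (w : (ℝ × Eucl d) × C(unitInterval, Eucl d × Eucl d)) : C(unitInterval, Eucl d × Eucl d) :=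
  constPath _ (charStart hH a w, gradient ψ (charStart hH a w)) +
    primitivePath _ (charPath hH a (w.1.1, w.2))

theorem contDiff_primitivePath_charPath (hH : HamiltonianBounds H C) (a : ℝ) :
    ContDiff ℝ 1 fun w : (ℝ × Eucl d) × C(unitInterval, Eucl d × Eucl d) =>
      primitivePath _ (charPath hH a (w.1.1, w.2)) :=
  (primitivePath _).contDiff.comp ((contDiff_charPath hH a).comp
    ((contDiff_fst.comp contDiff_fst).prodMk contDiff_snd))

theorem contDiff_charStart (hH : HamiltonianBounds H C) (a : ℝ) :
    ContDiff ℝ 1 (charStart hH a) :=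
  (contDiff_snd.comp contDiff_fst).sub (((ContinuousLinearMap.fst ℝ (Eucl d) (Eucl d)).comp
    (ContinuousMap.evalCLM ℝ (1 : unitInterval))).contDiff.comp
      (contDiff_primitivePath_charPath hH a))

theorem contDiff_charMap (hH : HamiltonianBounds H C) {ψ : Eucl d → ℝ} (hψ : ContDiff ℝ 2 ψ)
    (a : ℝ) : ContDiff ℝ 1 (charMap hH ψ a) := by
  have h1 : ContDiff ℝ 1 fun w => (charStart hH a w, gradient ψ (charStart hH a w)) :=
    (contDiff_charStart hH a).prodMk ((contDiff_gradient hψ).comp (contDiff_charStart hH a))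
  have h2 : ContDiff ℝ 1 fun w => constPath (Eucl d × Eucl d)
      (charStart hH a w, gradient ψ (charStart hH a w)) :=
    (constPath (Eucl d × Eucl d)).contDiff.comp h1
  exact h2.add (contDiff_primitivePath_charPath hH a)

/-- The vector field changes by at most `D`, the starting point follows with the same bound, and the
initial momentum with `M D`. The total `(1 + M) D + D` is a contraction for short times. -/
theorem norm_charMap_sub_le (hH : HamiltonianBounds H C) {ψ : Eucl d → ℝ} {M : ℝ} (hM : 0 ≤ M)
    (hψM : ∀ x y, ‖gradient ψ x - gradient ψ y‖ ≤ M * ‖x - y‖) (a : ℝ) (v : ℝ × Eucl d)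
    (y z : C(unitInterval, Eucl d × Eucl d)) :
    ‖charMap hH ψ a (v, y) - charMap hH ψ a (v, z)‖ ≤
      4 * (1 + M) * C * |v.1 - a| * ‖y - z‖ := by
  have hC := hH.pos
  have hD : ‖primitivePath _ (charPath hH a (v.1, y) - charPath hH a (v.1, z))‖ ≤
      2 * C * |v.1 - a| * ‖y - z‖ := by
    refine le_trans ?_ (norm_charPath_sub_le hH a v.1 y z)
    rw [ContinuousMap.norm_le _ (norm_nonneg _)]
    exact fun σ => norm_primitive_le _ σ.2
  set D := 2 * C * |v.1 - a| * ‖y - z‖ with hDdef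
  have hD0 : 0 ≤ D := by positivity
  have hΛD : ‖charStart hH a (v, y) - charStart hH a (v, z)‖ ≤ D := by
    have : charStart hH a (v, y) - charStart hH a (v, z) =
        -(primitivePath _ (charPath hH a (v.1, y) - charPath hH a (v.1, z)) 1).1 := by
      rw [map_sub]
      simp [charStart]
    rw [this, norm_neg]
    exact (norm_fst_le _).trans ((ContinuousMap.norm_coe_le_norm _ _).trans hD)
  have hsplit : charMap hH ψ a (v, y) - charMap hH ψ a (v, z) =
      constPath _ (charStart hH a (v, y) - charStart hH a (v, z),
        gradient ψ (charStart hH a (v, y)) - gradient ψ (charStart hH a (v, z))) +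
      primitivePath _ (charPath hH a (v.1, y) - charPath hH a (v.1, z)) := by
    rw [← Prod.mk_sub_mk, map_sub, map_sub, charMap, charMap]
    abel
  have hconst : ‖constPath (Eucl d × Eucl d) (charStart hH a (v, y) - charStart hH a (v, z),
      gradient ψ (charStart hH a (v, y)) - gradient ψ (charStart hH a (v, z)))‖ ≤
      (1 + M) * D := by
    rw [ContinuousMap.norm_le _ (by positivity)]
    refine fun σ => norm_prod_le_iff.2 ⟨?_, (hψM _ _).trans ?_⟩
    · exact hΛD.trans (by nlinarith)
    · have := mul_le_mul_of_nonneg_left hΛD hM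
      linarith
  rw [hsplit]
  refine (norm_add_le _ _).trans ?_
  have := mul_nonneg hM hD0
  have e : 4 * (1 + M) * C * |v.1 - a| * ‖y - z‖ = 2 * (1 + M) * D := by rw [hDdef]; ring
  rw [e]
  linarith

/-- Short characteristics starting on the graph of a gradient are determined by their end point,
and depend differentiably on it. -/
theorem exists_characteristics (hH : HamiltonianBounds H C) {ψ : Eucl d → ℝ}
    (hψ : ContDiff ℝ 2 ψ) {M : ℝ} (hM : 0 ≤ M)
    (hψM : ∀ x y, ‖gradient ψ x - gradient ψ y‖ ≤ M * ‖x - y‖) (a : ℝ) :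
    ∃ x : ℝ × Eucl d → C(unitInterval, Eucl d × Eucl d),
      ∀ v : ℝ × Eucl d, 4 * (1 + M) * C * |v.1 - a| < 1 →
        x v = charMap hH ψ a (v, x v) ∧ ContDiffAt ℝ 1 x v := by
  have hC := hH.pos
  have hU : IsOpen {v : ℝ × Eucl d | 4 * (1 + M) * C * |v.1 - a| < 1} :=
    isOpen_lt (by fun_prop) continuous_const
  obtain ⟨x, hx, hxc⟩ := exists_contDiffAt_fixedPoint (contDiff_charMap hH hψ a) hU
    (k := fun v => (4 * (1 + M) * C * |v.1 - a|).toNNReal)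
    (fun v hv => by rw [Real.toNNReal_lt_one]; exact hv) (fun v _ => by
      refine LipschitzWith.of_dist_le_mul fun y z => ?_
      rw [Real.coe_toNNReal _ (by positivity), dist_eq_norm, dist_eq_norm]
      exact norm_charMap_sub_le hH hM hψM a v y z)
  exact ⟨x, fun v hv => ⟨(hx v hv).symm, hxc v hv⟩⟩

end ClassicalSolution

/-! ### First variation of the action along characteristics. -/

section FirstVariation

variable {d : ℕ} {H : ℝ → Eucl d → Eucl d → ℝ} {C : ℝ}

theorem HamiltonianBounds.fderiv_apply (hH : HamiltonianBounds H C) (t : ℝ) (q p : Eucl d)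
    (e : ℝ) (u v : Eucl d) :
    fderiv ℝ (fun x : ℝ × Eucl d × Eucl d => H x.1 x.2.1 x.2.2) (t, q, p) (e, u, v) =
      e * fderiv ℝ (fun x : ℝ × Eucl d × Eucl d => H x.1 x.2.1 x.2.2) (t, q, p) (1, 0, 0) +
        inner ℝ (gradQ H t q p) u + inner ℝ (gradP H t q p) v := by
  rw [← hH.fderiv_apply_snd_fst, ← hH.fderiv_apply_snd_snd, ← smul_eq_mul, ← map_smul, ← map_add,
    ← map_add]
  simp

/-- The position component of the curve reconstructed from a path by the Picard operator. -/
noncomputable def charPos (hH : HamiltonianBounds H C) (a : ℝ)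
    (w : (ℝ × Eucl d) × C(unitInterval, Eucl d × Eucl d)) (σ : ℝ) : Eucl d :=
  charStart hH a w + (primitive (charPath hH a (w.1.1, w.2)) σ).1

/-- The momentum component of the curve reconstructed from a path by the Picard operator. -/
noncomputable def charMom (hH : HamiltonianBounds H C) (ψ : Eucl d → ℝ) (a : ℝ)
    (w : (ℝ × Eucl d) × C(unitInterval, Eucl d × Eucl d)) (σ : ℝ) : Eucl d :=
  gradient ψ (charStart hH a w) + (primitive (charPath hH a (w.1.1, w.2)) σ).2

/-- The Lagrangian along a path. -/
noncomputable def lagPath (hH : HamiltonianBounds H C) (a : ℝ)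
    (v : ℝ × C(unitInterval, Eucl d × Eucl d)) : C(unitInterval, ℝ) :=
  (v.1 - a) • (⟨fun x : ℝ × Eucl d × Eucl d =>
    inner ℝ x.2.2 (gradP H x.1 x.2.1 x.2.2) - H x.1 x.2.1 x.2.2,
      ((continuous_snd.comp continuous_snd).inner hH.contDiff_gradP.continuous).sub
        hH.contDiff.continuous⟩ : C(ℝ × Eucl d × Eucl d, ℝ)).comp (phasePath a v.1 v.2)

theorem contDiff_lagPath (hH : HamiltonianBounds H C) (a : ℝ) : ContDiff ℝ 1 (lagPath hH a) :=
  (contDiff_fst.sub contDiff_const).smul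
    ((contDiff_postcomp (fun x : ℝ × Eucl d × Eucl d =>
      inner ℝ x.2.2 (gradP H x.1 x.2.1 x.2.2) - H x.1 x.2.1 x.2.2)
      (((contDiff_snd.comp contDiff_snd).inner ℝ hH.contDiff_gradP).sub
        (hH.contDiff.of_le (by norm_num)))).comp (contDiff_phasePath a))

theorem lagPath_apply (hH : HamiltonianBounds H C) (a : ℝ)
    (v : ℝ × C(unitInterval, Eucl d × Eucl d)) (σ : unitInterval) :
    lagPath hH a v σ = inner ℝ (v.2 σ).2 (charPath hH a v σ).1 -
      (v.1 - a) * H (a + σ * (v.1 - a)) (v.2 σ).1 (v.2 σ).2 := by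
  have : lagPath hH a v σ = (v.1 - a) * (inner ℝ (v.2 σ).2
      (gradP H (a + σ * (v.1 - a)) (v.2 σ).1 (v.2 σ).2) -
        H (a + σ * (v.1 - a)) (v.2 σ).1 (v.2 σ).2) := rfl
  rw [this, charPath_apply, charField, Prod.smul_mk, inner_smul_right]
  ring

/-- The value at the end point of a characteristic. -/
noncomputable def charValue (hH : HamiltonianBounds H C) (ψ : Eucl d → ℝ) (a : ℝ)
    (w : (ℝ × Eucl d) × C(unitInterval, Eucl d × Eucl d)) : ℝ :=
  ψ (charStart hH a w) + primitive (lagPath hH a (w.1.1, w.2)) 1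

variable {ψ : Eucl d → ℝ} {a : ℝ}

theorem charPos_zero (hH : HamiltonianBounds H C)
    (w : (ℝ × Eucl d) × C(unitInterval, Eucl d × Eucl d)) :
    charPos hH a w 0 = charStart hH a w := by
  rw [charPos, primitive_zero, Prod.fst_zero, add_zero]

theorem charMom_zero (hH : HamiltonianBounds H C)
    (w : (ℝ × Eucl d) × C(unitInterval, Eucl d × Eucl d)) :
    charMom hH ψ a w 0 = gradient ψ (charStart hH a w) := by
  rw [charMom, primitive_zero, Prod.snd_zero, add_zero]

theorem charPos_one (hH : HamiltonianBounds H C)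
    (w : (ℝ × Eucl d) × C(unitInterval, Eucl d × Eucl d)) : charPos hH a w 1 = w.1.2 := by
  rw [charPos, charStart, sub_add_cancel]

theorem apply_eq_of_eq_charMap {hH : HamiltonianBounds H C}
    {w : (ℝ × Eucl d) × C(unitInterval, Eucl d × Eucl d)} (hw : w.2 = charMap hH ψ a w)
    (σ : unitInterval) : w.2 σ = (charPos hH a w σ, charMom hH ψ a w σ) := by
  conv_lhs => rw [hw]
  rfl

theorem hasDerivAt_charPos (hH : HamiltonianBounds H C)
    (w : (ℝ × Eucl d) × C(unitInterval, Eucl d × Eucl d)) (σ : unitInterval) :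
    HasDerivAt (charPos hH a w) (charPath hH a (w.1.1, w.2) σ).1 σ := by
  have h := hasDerivAt_primitive (charPath hH a (w.1.1, w.2)) σ
  rw [IccExtend_val] at h
  exact ((ContinuousLinearMap.fst ℝ (Eucl d) (Eucl d)).hasFDerivAt.comp_hasDerivAt
    (σ : ℝ) h).const_add _

theorem hasDerivAt_charMom (hH : HamiltonianBounds H C)
    (w : (ℝ × Eucl d) × C(unitInterval, Eucl d × Eucl d)) (σ : unitInterval) :
    HasDerivAt (charMom hH ψ a w) (charPath hH a (w.1.1, w.2) σ).2 σ := by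
  have h := hasDerivAt_primitive (charPath hH a (w.1.1, w.2)) σ
  rw [IccExtend_val] at h
  exact ((ContinuousLinearMap.snd ℝ (Eucl d) (Eucl d)).hasFDerivAt.comp_hasDerivAt
    (σ : ℝ) h).const_add _

theorem isCharacteristic_of_eq_charMap {hH : HamiltonianBounds H C}
    {w : (ℝ × Eucl d) × C(unitInterval, Eucl d × Eucl d)} (hw : w.2 = charMap hH ψ a w) :
    IsCharacteristic H a (w.1.1 - a) (charPos hH a w) (charMom hH ψ a w) := by
  constructor
  · intro σ hσ
    have h := hasDerivAt_charPos (a := a) hH w ⟨σ, hσ⟩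
    rw [charPath_apply, apply_eq_of_eq_charMap hw] at h
    exact h.hasDerivWithinAt
  · intro σ hσ
    have h := hasDerivAt_charMom (ψ := ψ) (a := a) hH w ⟨σ, hσ⟩
    rw [charPath_apply, apply_eq_of_eq_charMap hw] at h
    simp only [charField, Prod.smul_mk, smul_neg] at h
    exact h.hasDerivWithinAt

theorem charValue_eq_of_eq_charMap {hH : HamiltonianBounds H C}
    {w : (ℝ × Eucl d) × C(unitInterval, Eucl d × Eucl d)} (hw : w.2 = charMap hH ψ a w) :
    charValue hH ψ a w = ψ (charPos hH a w 0) +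
      charAction H a (w.1.1 - a) (charPos hH a w) (charMom hH ψ a w) := by
  rw [charValue, charPos_zero, charAction, ← intervalIntegral.integral_const_mul, primitive]
  congr 1
  refine intervalIntegral.integral_congr fun σ hσ => ?_
  rw [uIcc_of_le zero_le_one] at hσ
  have h := lagPath_apply hH a (w.1.1, w.2) ⟨σ, hσ⟩
  rw [charPath_apply, apply_eq_of_eq_charMap hw] at h
  simp only [charField, Prod.smul_mk, inner_smul_right, ← mul_sub] at h
  rw [IccExtend_of_mem _ _ hσ, h]

/-- The directional derivative of a path-valued map, evaluated at a point of the path. -/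
theorem hasDerivAt_line_apply {Λ G : Type*} [NormedAddCommGroup Λ] [NormedSpace ℝ Λ]
    [NormedAddCommGroup G] [NormedSpace ℝ G] {f : Λ → C(unitInterval, G)} {v : Λ}
    (hf : DifferentiableAt ℝ f v) (η : Λ) (σ : unitInterval) :
    HasDerivAt (fun ξ : ℝ => f (v + ξ • η) σ) (fderiv ℝ f v η σ) 0 :=
  (ContinuousMap.evalCLM ℝ σ : C(unitInterval, G) →L[ℝ] G).hasFDerivAt.comp_hasDerivAt (0 : ℝ)
    (hf.hasFDerivAt.hasLineDerivAt η)

/-- The variation of the characteristics and of their Lagrangian in a given direction. -/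
theorem exists_variation (hH : HamiltonianBounds H C)
    {x : ℝ × Eucl d → C(unitInterval, Eucl d × Eucl d)} {v : ℝ × Eucl d}
    (hx : ∀ᶠ v in 𝓝 v, x v = charMap hH ψ a (v, x v)) (hxc : ContDiffAt ℝ 1 x v)
    (η : ℝ × Eucl d) :
    ∃ (x' y' : C(unitInterval, Eucl d × Eucl d)) (l' : C(unitInterval, ℝ)),
      (∀ σ, (x' σ).1 = η.2 - (primitive y' 1).1 + (primitive y' σ).1) ∧
      (∀ σ, l' σ = inner ℝ (x v σ).2 (y' σ).1 + inner ℝ (x' σ).2 (charPath hH a (v.1, x v) σ).1 -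
        (η.1 * H (a + σ * (v.1 - a)) (x v σ).1 (x v σ).2 + (v.1 - a) *
          fderiv ℝ (fun x : ℝ × Eucl d × Eucl d => H x.1 x.2.1 x.2.2)
            (a + σ * (v.1 - a), x v σ) (σ * η.1, x' σ))) ∧
      HasDerivAt (fun ξ : ℝ => charStart hH a (v + ξ • η, x (v + ξ • η)))
        (η.2 - (primitive y' 1).1) 0 ∧
      HasDerivAt (fun ξ : ℝ => primitive (lagPath hH a ((v + ξ • η).1, x (v + ξ • η))) 1)
        (primitive l' 1) 0 := by
  have hxd : DifferentiableAt ℝ x v := hxc.differentiableAt (by norm_num)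
  have hpair : DifferentiableAt ℝ (fun v => (v.1, x v)) v := differentiableAt_fst.prodMk hxd
  have hYd : DifferentiableAt ℝ (fun v => charPath hH a (v.1, x v)) v :=
    DifferentiableAt.comp (g := charPath hH a) (f := fun v => (v.1, x v)) v
      ((contDiff_charPath hH a).differentiable (by norm_num) (v.1, x v)) hpair
  have hLd : DifferentiableAt ℝ (fun v => lagPath hH a (v.1, x v)) v :=
    DifferentiableAt.comp (g := lagPath hH a) (f := fun v => (v.1, x v)) v
      ((contDiff_lagPath hH a).differentiable (by norm_num) (v.1, x v)) hpair
  have hline : HasDerivAt (fun ξ : ℝ => v + ξ • η) η 0 := by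
    simpa using ((hasDerivAt_id (0 : ℝ)).smul_const η).const_add v
  have hline1 : HasDerivAt (fun ξ : ℝ => (v + ξ • η).1) η.1 0 :=
    (ContinuousLinearMap.fst ℝ ℝ (Eucl d)).hasFDerivAt.comp_hasDerivAt (0 : ℝ) hline
  have hline2 : HasDerivAt (fun ξ : ℝ => (v + ξ • η).2) η.2 0 :=
    (ContinuousLinearMap.snd ℝ ℝ (Eucl d)).hasFDerivAt.comp_hasDerivAt (0 : ℝ) hline
  have hline0 : v + (0 : ℝ) • η = v := by simp
  set x' := fderiv ℝ x v η with hx'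
  set y' := fderiv ℝ (fun v => charPath hH a (v.1, x v)) v η with hy'
  set l' := fderiv ℝ (fun v => lagPath hH a (v.1, x v)) v η with hl'
  have hx1 : ∀ σ, HasDerivAt (fun ξ : ℝ => x (v + ξ • η) σ) (x' σ) 0 :=
    fun σ => hasDerivAt_line_apply hxd η σ
  have hx11 : ∀ σ, HasDerivAt (fun ξ : ℝ => (x (v + ξ • η) σ).1) (x' σ).1 0 := fun σ =>
    (ContinuousLinearMap.fst ℝ (Eucl d) (Eucl d)).hasFDerivAt.comp_hasDerivAt (0 : ℝ) (hx1 σ)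
  have hx12 : ∀ σ, HasDerivAt (fun ξ : ℝ => (x (v + ξ • η) σ).2) (x' σ).2 0 := fun σ =>
    (ContinuousLinearMap.snd ℝ (Eucl d) (Eucl d)).hasFDerivAt.comp_hasDerivAt (0 : ℝ) (hx1 σ)
  have hy1 : ∀ σ, HasDerivAt (fun ξ : ℝ => (charPath hH a ((v + ξ • η).1, x (v + ξ • η)) σ).1)
      (y' σ).1 0 := fun σ =>
    (ContinuousLinearMap.fst ℝ (Eucl d) (Eucl d)).hasFDerivAt.comp_hasDerivAt (0 : ℝ)
      (hasDerivAt_line_apply hYd η σ)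
  have hJ : ∀ σ : unitInterval, HasDerivAt
      (fun ξ : ℝ => (primitive (charPath hH a ((v + ξ • η).1, x (v + ξ • η))) σ).1)
      (primitive y' σ).1 0 := fun σ =>
    ((ContinuousLinearMap.fst ℝ (Eucl d) (Eucl d)).comp ((ContinuousMap.evalCLM ℝ σ).comp
      (primitivePath (Eucl d × Eucl d)))).hasFDerivAt.comp_hasDerivAt (0 : ℝ)
        (hYd.hasFDerivAt.hasLineDerivAt η)
  have hstart : HasDerivAt (fun ξ : ℝ => charStart hH a (v + ξ • η, x (v + ξ • η)))
      (η.2 - (primitive y' 1).1) 0 := hline2.sub (hJ 1)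
  refine ⟨x', y', l', fun σ => ?_, fun σ => ?_, hstart, ?_⟩
  -- The fixed point equation holds at all nearby parameters, so its position component can be
  -- differentiated.
  · refine (hx11 σ).unique ((hstart.add (hJ σ)).congr_of_eventuallyEq ?_)
    have htend : Tendsto (fun ξ : ℝ => v + ξ • η) (𝓝 0) (𝓝 v) := by
      have := hline.continuousAt.tendsto
      rwa [hline0] at this
    filter_upwards [htend.eventually hx] with ξ hξ
    have h := apply_eq_of_eq_charMap (w := (v + ξ • η, x (v + ξ • η))) hξ σ
    exact congrArg Prod.fst h
  · have h1 := (hx12 σ).inner ℝ (hy1 σ)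
    have h2 : HasDerivAt (fun ξ : ℝ => (a + σ * ((v + ξ • η).1 - a), x (v + ξ • η) σ))
        ((σ : ℝ) * η.1, x' σ) 0 :=
      (((hline1.sub_const a).const_mul (σ : ℝ)).const_add a).prodMk (hx1 σ)
    have h3 := (hH.hasFDerivAt_uncurry (a + σ * (v.1 - a), x v σ)).comp_hasDerivAt_of_eq
      (0 : ℝ) h2 (by rw [hline0])
    have h4 := h1.sub ((hline1.sub_const a).mul h3)
    have h5 := hasDerivAt_line_apply hLd η σ
    have h6 := h5.unique (h4.congr_of_eventuallyEq (Eventually.of_forall fun ξ => by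
      exact lagPath_apply hH a _ σ))
    rw [← hl'] at h6
    rw [h6]
    simp only [hline0, Function.comp_apply]
  · exact ((ContinuousMap.evalCLM ℝ (1 : unitInterval)).comp
      (primitivePath ℝ)).hasFDerivAt.comp_hasDerivAt (0 : ℝ)
        (hLd.hasFDerivAt.hasLineDerivAt η)

/-- The first variation formula along a line. -/
theorem hasLineDerivAt_charValue (hH : HamiltonianBounds H C) (hψ : ContDiff ℝ 2 ψ)
    {x : ℝ × Eucl d → C(unitInterval, Eucl d × Eucl d)} {v : ℝ × Eucl d}
    (hx : ∀ᶠ v in 𝓝 v, x v = charMap hH ψ a (v, x v)) (hxc : ContDiffAt ℝ 1 x v)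
    (η : ℝ × Eucl d) :
    HasLineDerivAt ℝ (fun v => charValue hH ψ a (v, x v))
      (inner ℝ (charMom hH ψ a (v, x v) 1) η.2 -
        H v.1 v.2 (charMom hH ψ a (v, x v) 1) * η.1) v η := by
  obtain ⟨x', y', l', hx', hl', hstart, hlag⟩ := exists_variation hH hx hxc η
  have hxv : x v = charMap hH ψ a (v, x v) := hx.self_of_nhds
  have happ : ∀ σ : unitInterval, x v σ = (charPos hH a (v, x v) σ, charMom hH ψ a (v, x v) σ) :=
    apply_eq_of_eq_charMap (w := (v, x v)) hxv
  set r' := η.2 - (primitive y' 1).1 with hr'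
  have hψd : HasDerivAt (fun ξ : ℝ => ψ (charStart hH a (v + ξ • η, x (v + ξ • η))))
      (inner ℝ (gradient ψ (charStart hH a (v, x v))) r') 0 := by
    have h := ((hψ.differentiable (by norm_num)) (charStart hH a (v, x v))).hasGradientAt
    exact (h.hasFDerivAt.comp_hasDerivAt_of_eq (0 : ℝ) hstart (by simp)).congr_deriv (by simp)
  set q := charPos hH a (v, x v) with hq
  set p := charMom hH ψ a (v, x v) with hp
  -- By Hamilton's equations the varied Lagrangian is the exact derivative of `⟪p, δq⟫ - η.1 σ H`,
  -- where `δq` is the variation of position; terms with the variation of momentum cancel.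
  have hint : primitive l' 1 =
      (inner ℝ (p 1) (r' + (primitive y' 1).1) - η.1 * (1 * H (a + 1 * (v.1 - a)) (q 1) (p 1))) -
      (inner ℝ (p 0) (r' + (primitive y' 0).1) - η.1 * (0 * H (a + 0 * (v.1 - a)) (q 0) (p 0))) := by
    refine intervalIntegral.integral_eq_sub_of_hasDerivAt
      (f := fun σ => inner ℝ (p σ) (r' + (primitive y' σ).1) -
        η.1 * (σ * H (a + σ * (v.1 - a)) (q σ) (p σ))) (fun σ hσ => ?_)
      ((continuous_IccExtend_iff.2 l'.continuous).intervalIntegrable _ _)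
    rw [uIcc_of_le zero_le_one] at hσ
    have h1 := hasDerivAt_charPos (a := a) hH (v, x v) ⟨σ, hσ⟩
    have h2 := hasDerivAt_charMom (ψ := ψ) (a := a) hH (v, x v) ⟨σ, hσ⟩
    have h3 : HasDerivAt (fun σ => r' + (primitive y' σ).1) (y' ⟨σ, hσ⟩).1 σ := by
      have h := hasDerivAt_primitive y' σ
      rw [IccExtend_of_mem _ _ hσ] at h
      exact ((ContinuousLinearMap.fst ℝ (Eucl d) (Eucl d)).hasFDerivAt.comp_hasDerivAt
        σ h).const_add _
    have h4 : HasDerivAt (fun σ : ℝ => a + σ * (v.1 - a)) (v.1 - a) σ := by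
      simpa using ((hasDerivAt_id σ).mul_const (v.1 - a)).const_add a
    have h5 := (hH.hasFDerivAt_uncurry (a + σ * (v.1 - a), q σ, p σ)).comp_hasDerivAt σ
      (h4.prodMk (h1.prodMk h2))
    have h6 := (h2.inner ℝ h3).sub (((hasDerivAt_id σ).mul h5).const_mul η.1)
    rw [IccExtend_of_mem _ _ hσ, hl']
    refine h6.congr_deriv ?_
    have e1 : x' ⟨σ, hσ⟩ = (r' + (primitive y' σ).1, (x' ⟨σ, hσ⟩).2) :=
      Prod.ext (hx' ⟨σ, hσ⟩) rfl
    have e2 : x v ⟨σ, hσ⟩ = (q σ, p σ) := happ ⟨σ, hσ⟩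
    rw [e1]
    simp only [charPath_apply, e2, charField, Prod.smul_mk, Function.comp_apply, id]
    rw [hH.fderiv_apply _ _ _ (σ * η.1), hH.fderiv_apply _ _ _ (v.1 - a)]
    simp only [real_inner_smul_right, real_inner_smul_left, inner_neg_left, inner_neg_right,
      smul_neg]
    rw [real_inner_comm (x' ⟨σ, hσ⟩).2 (gradP H (a + σ * (v.1 - a)) (q σ) (p σ)),
      real_inner_comm (gradQ H (a + σ * (v.1 - a)) (q σ) (p σ))
        (gradP H (a + σ * (v.1 - a)) (q σ) (p σ)), ← hq, ← hp]
    ring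
  -- The boundary term at `0` cancels the derivative of `ψ` because `p 0` is the gradient of `ψ` at
  -- the starting point.
  have hsum := hψd.add hlag
  rw [hint] at hsum
  refine hsum.congr_deriv ?_
  have hq1 : q 1 = v.2 := charPos_one hH (v, x v)
  have hp0 : p 0 = gradient ψ (charStart hH a (v, x v)) := charMom_zero hH (v, x v)
  rw [hq1, hp0, primitive_zero, hr']
  simp
  ring

/-- Differentiability comes from composition, so the line derivatives identify the differential as
`p dQ - H dt`. This is the Hamilton-Jacobi equation. -/
theorem hasFDerivAt_charValue (hH : HamiltonianBounds H C) (hψ : ContDiff ℝ 2 ψ)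
    {x : ℝ × Eucl d → C(unitInterval, Eucl d × Eucl d)} {v : ℝ × Eucl d}
    (hx : ∀ᶠ v in 𝓝 v, x v = charMap hH ψ a (v, x v)) (hxc : ContDiffAt ℝ 1 x v) :
    HasFDerivAt (fun v => charValue hH ψ a (v, x v))
      ((innerSL ℝ (charMom hH ψ a (v, x v) 1)).comp (.snd ℝ ℝ (Eucl d)) -
        H v.1 v.2 (charMom hH ψ a (v, x v) 1) • (.fst ℝ ℝ (Eucl d))) v := by
  have hxd : DifferentiableAt ℝ x v := hxc.differentiableAt (by norm_num)
  have hpair : DifferentiableAt ℝ (fun v => (v.1, x v)) v := differentiableAt_fst.prodMk hxd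
  have hLd : DifferentiableAt ℝ (fun v => lagPath hH a (v.1, x v)) v :=
    DifferentiableAt.comp (g := lagPath hH a) (f := fun v => (v.1, x v)) v
      ((contDiff_lagPath hH a).differentiable (by norm_num) (v.1, x v)) hpair
  have h1 : DifferentiableAt ℝ (fun v => charStart hH a (v, x v)) v :=
    DifferentiableAt.comp (g := charStart hH a) (f := fun v => (v, x v)) v
      ((contDiff_charStart hH a).differentiable (by norm_num) (v, x v))
      (differentiableAt_id.prodMk hxd)
  have h2 : DifferentiableAt ℝ (fun v => ψ (charStart hH a (v, x v))) v :=
    (hψ.differentiable (by norm_num) _).comp v h1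
  have h3 : DifferentiableAt ℝ (fun v => primitive (lagPath hH a (v.1, x v)) 1) v :=
    (((ContinuousMap.evalCLM ℝ (1 : unitInterval)).comp
      (primitivePath ℝ)).differentiableAt).comp v hLd
  have hWd : DifferentiableAt ℝ (fun v => charValue hH ψ a (v, x v)) v := h2.add h3
  refine hWd.hasFDerivAt.congr_fderiv ?_
  refine ContinuousLinearMap.ext fun η => ?_
  exact ((hWd.hasFDerivAt.hasLineDerivAt η).unique
    (hasLineDerivAt_charValue hH hψ hx hxc η)).trans (by simp)

end FirstVariation

/-! ### Short-time existence of classical solutions. -/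

section ClassicalSolutionExists

variable {d : ℕ} {H : ℝ → Eucl d → Eucl d → ℝ} {C : ℝ}

theorem contDiffOn_two_of_hasFDerivAt {E F : Type*} [NormedAddCommGroup E] [NormedSpace ℝ E]
    [NormedAddCommGroup F] [NormedSpace ℝ F] {f : E → F} {f' : E → E →L[ℝ] F} {U : Set E}
    (hU : IsOpen U) (hf : ∀ x ∈ U, HasFDerivAt f (f' x) x) (hf' : ContDiffOn ℝ 1 f' U) :
    ContDiffOn ℝ 2 f U := by
  have h : ContDiffOn ℝ (1 + 1) f U := by
    rw [contDiffOn_succ_iff_fderiv_of_isOpen hU]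
    refine ⟨fun x hx => (hf x hx).differentiableAt.differentiableWithinAt, fun h => ?_,
      hf'.congr fun x hx => (hf x hx).fderiv⟩
    exact absurd h (by decide)
  exact h.of_le (by rw [one_add_one_eq_two])

/-- The method of characteristics: short-time classical solutions with `C²` initial data that have
Lipschitz gradients. -/
theorem exists_classicalSolution (hH : HamiltonianBounds H C) {ψ : Eucl d → ℝ}
    (hψ : ContDiff ℝ 2 ψ) {M : ℝ} (hM : 0 ≤ M)
    (hψM : ∀ x y, ‖gradient ψ x - gradient ψ y‖ ≤ M * ‖x - y‖) {L : ℝ}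
    (hψL : ∀ x, ‖gradient ψ x‖ ≤ L) (a : ℝ) {η : ℝ} (hη : 0 < η) (hs : (1 + M) * η * C ≤ 1 / 8) :
    ∃ w : ℝ → Eucl d → ℝ, IsClassicalSolution H a (a + η) w ∧ w a = ψ ∧
      (∃ K : ℝ≥0, LipschitzOnWith K (fun x : ℝ × Eucl d => w x.1 x.2)
        (Icc a (a + η) ×ˢ univ)) ∧
      ∀ t ∈ Icc a (a + η), ∀ Q : Eucl d, ∃ q p : ℝ → Eucl d, IsCharacteristic H a (t - a) q p ∧
        p 0 = gradient ψ (q 0) ∧ q 1 = Q ∧ w t Q = ψ (q 0) + charAction H a (t - a) q p := by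
  have hC := hH.pos
  have hL0 : 0 ≤ L := (norm_nonneg _).trans (hψL 0)
  obtain ⟨x, hx⟩ := exists_characteristics hH hψ hM hψM a
  set U : Set (ℝ × Eucl d) := {v | 4 * (1 + M) * C * |v.1 - a| < 1} with hUdef
  have hU : IsOpen U := isOpen_lt (by fun_prop) continuous_const
  have hIccU : Icc a (a + η) ×ˢ univ ⊆ U := by
    rintro ⟨t, Q⟩ ⟨ht, -⟩
    have h1 : |t - a| ≤ η := by
      rw [abs_of_nonneg (by linarith [ht.1])]
      linarith [ht.2]
    have h2 : 4 * (1 + M) * C * |t - a| ≤ 4 * (1 + M) * C * η := by gcongr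
    show 4 * (1 + M) * C * |t - a| < 1
    linarith
  set P : ℝ × Eucl d → Eucl d := fun v => (x v 1).2 with hP
  have hPeq : ∀ v ∈ U, P v = charMom hH ψ a (v, x v) 1 := fun v hv =>
    congrArg Prod.snd (apply_eq_of_eq_charMap (w := (v, x v)) (hx v hv).1 1)
  have hPc : ContDiffOn ℝ 1 P U := fun v hv =>
    (((ContinuousLinearMap.snd ℝ (Eucl d) (Eucl d)).comp
      (ContinuousMap.evalCLM ℝ (1 : unitInterval) :
        C(unitInterval, Eucl d × Eucl d) →L[ℝ] _)).contDiff.contDiffAt.comp v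
      (hx v hv).2).contDiffWithinAt
  have hD : ∀ v ∈ U, HasFDerivAt (fun v => charValue hH ψ a (v, x v))
      ((innerSL ℝ (P v)).comp (.snd ℝ ℝ (Eucl d)) - H v.1 v.2 (P v) • (.fst ℝ ℝ (Eucl d))) v := by
    intro v hv
    rw [hPeq v hv]
    refine hasFDerivAt_charValue hH hψ ?_ (hx v hv).2
    filter_upwards [hU.mem_nhds hv] with v' hv' using (hx v' hv').1
  have hchar : ∀ v ∈ U, IsCharacteristic H a (v.1 - a) (charPos hH a (v, x v))
      (charMom hH ψ a (v, x v)) := fun v hv =>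
    isCharacteristic_of_eq_charMap (w := (v, x v)) (hx v hv).1
  refine ⟨fun t Q => charValue hH ψ a ((t, Q), x (t, Q)), ⟨?_, ?_⟩, ?_, ?_, ?_⟩
  -- The characteristics are only `C¹` in the parameters, but the value is `C²`: its derivative is
  -- expressed through the `C¹` end momentum `P`.
  · refine ContDiffOn.mono (contDiffOn_two_of_hasFDerivAt hU hD ?_) hIccU
    refine ContDiffOn.sub ?_ ?_
    · exact ((innerSL ℝ (E := Eucl d)).contDiff.comp_contDiffOn hPc).clm_comp contDiffOn_const
    · have h1 : ContDiff ℝ 1 (fun x : ℝ × Eucl d × Eucl d => H x.1 x.2.1 x.2.2) :=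
        hH.contDiff.of_le (by norm_num)
      have h2 : ContDiffOn ℝ 1 (fun v => (v.1, v.2, P v)) U :=
        contDiffOn_fst.prodMk (contDiffOn_snd.prodMk hPc)
      exact (h1.comp_contDiffOn h2).smul contDiffOn_const
  · intro t ht Q
    have hv : (t, Q) ∈ U := hIccU ⟨ht, mem_univ _⟩
    have h1 : HasDerivAt (fun τ => charValue hH ψ a ((τ, Q), x (τ, Q)))
        (-H t Q (P (t, Q))) t := by
      have h := (hD _ hv).comp_hasDerivAt t ((hasDerivAt_id t).prodMk (hasDerivAt_const t Q))
      exact h.congr_deriv (by simp)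
    have h2 : HasGradientAt (fun Q => charValue hH ψ a ((t, Q), x (t, Q))) (P (t, Q)) Q := by
      rw [hasGradientAt_iff_hasFDerivAt]
      have h := (hD _ hv).comp Q (hasFDerivAt_prodMk_right t Q)
      refine h.congr_fderiv ?_
      ext y
      simp
    rw [h1.hasDerivWithinAt.derivWithin (uniqueDiffOn_Icc (by linarith) t ht), h2.gradient]
    ring
  -- At `t = a` the rescaled vector field and Lagrangian vanish, so the characteristic starts at its
  -- end point and carries no action.
  · funext Q
    have h0 : charPath hH a (a, x (a, Q)) = 0 := by
      ext σ : 1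
      rw [charPath_apply]
      simp
    have h1 : lagPath hH a (a, x (a, Q)) = 0 := by
      ext σ : 1
      rw [lagPath_apply, h0]
      simp
    have h2 : primitive (0 : C(unitInterval, ℝ)) 1 = 0 :=
      congrArg (fun y : C(unitInterval, ℝ) => y 1) (map_zero (primitivePath ℝ))
    have h3 : primitive (0 : C(unitInterval, Eucl d × Eucl d)) 1 = 0 :=
      congrArg (fun y : C(unitInterval, Eucl d × Eucl d) => y 1)
        (map_zero (primitivePath (Eucl d × Eucl d)))
    simp only [charValue, charStart, h0, h1, h2, h3, Prod.fst_zero, sub_zero, add_zero]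
  -- The end momentum stays close to the gradient of `ψ` at `Q`, hence bounded, and with it the
  -- derivative `(-H, p)` of the value.
  · set B := 1 + 2 * L with hB
    have hPB : ∀ v ∈ Icc a (a + η) ×ˢ (univ : Set (Eucl d)), ‖P v‖ ≤ B := by
      rintro ⟨t, Q⟩ hv
      have hvU := hIccU hv
      obtain ⟨⟨ht1, ht2⟩, -⟩ := hv
      dsimp only at ht1 ht2
      have hκ : (1 + M) * (t - a) * C ≤ 1 / 8 := by
        refine le_trans ?_ hs
        gcongr
        linarith
      have h := ((hchar _ hvU).norm_sub_le hH (by dsimp only; linarith) hM (charPos_one hH _)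
        (p₀ := gradient ψ Q) (by
          rw [charMom_zero, charPos_zero]
          exact hψM _ _) (by dsimp only; linarith) 1 (right_mem_Icc.2 zero_le_one)).2
      rw [← hPeq _ hvU] at h
      have h1 := norm_add_le (P (t, Q) - gradient ψ Q) (gradient ψ Q)
      rw [sub_add_cancel] at h1
      have h2 := hψL Q
      have h3 : 2 * ((1 + M) * (t - a) * C) * (1 + ‖gradient ψ Q‖) ≤ 2 * (1 / 8) * (1 + L) := by
        gcongr
      dsimp only at h
      linarith
    refine ⟨(B + C * (1 + B) ^ 2).toNNReal, Convex.lipschitzOnWith_of_nnnorm_hasFDerivWithin_le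
      (fun v hv => (hD v (hIccU hv)).hasFDerivWithinAt) (fun v hv => ?_)
      ((convex_Icc _ _).prod convex_univ)⟩
    refine NNReal.le_toNNReal_of_coe_le ?_
    rw [coe_nnnorm]
    refine (norm_sub_le _ _).trans (add_le_add ?_ ?_)
    · refine (ContinuousLinearMap.opNorm_comp_le _ _).trans ?_
      rw [innerSL_apply_norm]
      exact (mul_le_of_le_one_right (norm_nonneg _)
        (ContinuousLinearMap.norm_snd_le _ _ _)).trans (hPB v hv)
    · rw [norm_smul]
      exact (mul_le_of_le_one_right (norm_nonneg _)
        (ContinuousLinearMap.norm_fst_le _ _ _)).trans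
          (hH.abs_le_of_norm_le v.1 v.2 (hPB v hv))
  · intro t ht Q
    have hv : (t, Q) ∈ U := hIccU ⟨ht, mem_univ _⟩
    refine ⟨_, _, hchar _ hv, ?_, charPos_one hH _, ?_⟩
    · rw [charMom_zero, charPos_zero]
    · exact charValue_eq_of_eq_charMap (w := ((t, Q), x (t, Q))) (hx _ hv).1

end ClassicalSolutionExists

/-! ### Viscosity and variational operators are variational on test functions -/

section TestVariationalOperators

variable {d : ℕ} {H : ℝ → Eucl d → Eucl d → ℝ} {C : ℝ}

/-- The test function is the initial value of a Lipschitz classical solution that carries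
characteristics, and compatibility forces the operator to return it. Its gradient has Lipschitz
constant `2 |M|`, and the threshold `1 / 16` keeps `t` within the lifespan `1 / (8 (1 + 2 |M|) C)`.
-/
theorem OpCompatible.testVariational (hH : HamiltonianBounds H C) {W : OpFamily d}
    (hW : OpCompatible H W) : TestVariational H C W := by
  intro s t hs hst Q p M hM
  have hC := hH.pos
  have hη : 0 < 1 / (8 * (1 + 2 * |M|) * C) := by positivity
  obtain ⟨w, hw, hw0, hwL, hchar⟩ := exists_classicalSolution hH (contDiff_testFun Q p M)
    (by positivity : 0 ≤ 2 * |M|) (norm_gradient_testFun_sub_gradient_le Q p M)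
    (norm_gradient_testFun_le Q p M) s hη (le_of_eq (by field_simp))
  have ht : t ∈ Icc s (s + 1 / (8 * (1 + 2 * |M|) * C)) := by
    refine ⟨hst, ?_⟩
    rw [← sub_le_iff_le_add', le_div_iff₀ (by positivity)]
    nlinarith [mul_nonneg (sub_nonneg.2 hst) hC.le]
  obtain ⟨x, y, hxy, hy, hx, hval⟩ := hchar t ht Q
  refine ⟨x, y, hxy, hx, hy, ?_⟩
  rw [hW s _ w (by linarith) hw hwL s (left_mem_Icc.2 (by linarith)) t ht hs hst
    (testLip Q p M) hw0.symm, hval]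

theorem OpVariational.testVariational {R : OpFamily d} (hR : OpVariational H R) :
    TestVariational H C R := by
  intro s t hs hst Q p M _
  obtain ⟨x, y, hxy, hy, hx, hval⟩ := hR s t hs hst (testLip Q p M) (contDiff_testFun Q p M) Q
  have hline : ∀ σ : ℝ, HasDerivAt (fun σ : ℝ => s + σ * (t - s)) (t - s) σ := fun σ => by
    simpa using ((hasDerivAt_id σ).mul_const (t - s)).const_add s
  refine ⟨fun σ => x (s + σ * (t - s)), fun σ => y (s + σ * (t - s)), ⟨fun σ _ => ?_, fun σ _ => ?_⟩,
    ?_, ?_, ?_⟩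
  · exact ((hxy _).1.scomp σ (hline σ)).hasDerivWithinAt
  · have h := ((hxy (s + σ * (t - s))).2.scomp σ (hline σ)).hasDerivWithinAt (s := Icc 0 1)
    rw [smul_neg] at h
    exact h
  · dsimp only
    rw [one_mul, add_sub_cancel, hx]
  · dsimp only
    rw [zero_mul, add_zero, hy]
    rfl
  · rw [hval]
    dsimp only
    rw [zero_mul, add_zero]
    congr 1
    rw [hamiltonianAction, charAction]
    have h := intervalIntegral.mul_integral_comp_add_mul (a := 0) (b := 1)
      (f := fun τ => inner ℝ (y τ) (deriv x τ) - H τ (x τ) (y τ)) (t - s) s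
    rw [mul_zero, add_zero, mul_one, add_sub_cancel] at h
    rw [← h]
    congr 1
    refine intervalIntegral.integral_congr fun σ _ => ?_
    rw [(hxy _).1.deriv, mul_comm (t - s)]
    rfl

end TestVariationalOperators

/-! ### Approximate solutions -/

section ApproximateSolutions

variable {d : ℕ} {H : ℝ → Eucl d → Eucl d → ℝ} {C : ℝ}

theorem ApproxSub.mono {n : ℕ} {θ : ℕ → ℝ} {f : ℕ → Eucl d → ℝ} {ε K ρ ε' K' ρ' : ℝ}
    (h : ApproxSub H n θ f ε K ρ) (hε : ε ≤ ε') (hK : K' ≤ K) (hρ : ρ' ≤ ρ) :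
    ApproxSub H n θ f ε' K' ρ' := by
  intro j hj h0j Q p a hQ htouch
  refine (h j hj h0j Q p a (hQ.trans hρ) fun i hi q => (htouch i hi q).trans ?_).trans hε
  gcongr

/-- Sequences of functions that are Lipschitz in space and time, and both approximate
subsolutions and approximate supersolutions. -/
structure ApproxSol (H : ℝ → Eucl d → Eucl d → ℝ) (L K₀ ε K ρ : ℝ) (n : ℕ) (θ : ℕ → ℝ)
    (f : ℕ → Eucl d → ℝ) : Prop where
  chain : IsTimeChain n θ f L K₀
  sub : ApproxSub H n θ f ε K ρ
  super : ApproxSub (negHam H) n θ (fun k x => -f k x) ε K ρ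

theorem IsTimeChain.le_le {n : ℕ} {θ : ℕ → ℝ} {f : ℕ → Eucl d → ℝ} {L K₀ L' K₀' : ℝ}
    (h : IsTimeChain n θ f L K₀) (hL : L ≤ L') (hK₀ : K₀ ≤ K₀') : IsTimeChain n θ f L' K₀' where
  mono := h.mono
  space k hk x y := (h.space k hk x y).trans (by gcongr)
  time k hk x := (h.time k hk x).trans
    (mul_le_mul_of_nonneg_right hK₀ (sub_nonneg.2 (h.mono k hk)))

theorem ApproxSol.mono {n : ℕ} {θ : ℕ → ℝ} {f : ℕ → Eucl d → ℝ}
    {L K₀ ε K ρ L' K₀' ε' K' ρ' : ℝ} (h : ApproxSol H L K₀ ε K ρ n θ f) (hL : L ≤ L')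
    (hK₀ : K₀ ≤ K₀') (hε : ε ≤ ε') (hK : K' ≤ K) (hρ : ρ' ≤ ρ) :
    ApproxSol H L' K₀' ε' K' ρ' n θ f :=
  ⟨h.chain.le_le hL hK₀, h.sub.mono hε hK hρ, h.super.mono hε hK hρ⟩

/-- Iterations of operators that are variational on test functions are approximate solutions. -/
theorem exists_approxSol_of_testVariational (hH : HamiltonianBounds H C) {T L ε K ρ : ℝ}
    (hL : 0 ≤ L) (hε : 0 < ε) (hK : 0 ≤ K) :
    ∃ δ > 0, ∀ (P : OpFamily d), TestVariational H C P → OpMonotone P → OpAdditive P →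
      ∀ (n : ℕ) (θ : ℕ → ℝ) (F : ℕ → LipFun d), 0 ≤ θ 0 → θ n ≤ T →
      (∀ k < n, θ k ≤ θ (k + 1)) → (∀ k < n, θ (k + 1) - θ k ≤ δ) →
      (∀ k ≤ n, ∀ x y, |(F k).1 x - (F k).1 y| ≤ L * ‖x - y‖) →
      (∀ k < n, F (k + 1) = P (θ k) (θ (k + 1)) (F k)) →
      ApproxSol H L ((32 * L ^ 2 + 11) * C) ε K ρ n θ (fun k => (F k).1) := by
  have hC := hH.pos
  set K₀ := (32 * L ^ 2 + 11) * C with hK₀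
  have hK₀0 : 0 ≤ K₀ := by positivity
  set M := 4 * K + 4 * L + 2 * K₀ + K with hM
  have hM0 : 0 ≤ M := by positivity
  obtain ⟨δ₁, hδ₁, hω⟩ := hH.exists_abs_sub_lt 0 T ρ L (show 0 < ε / 3 by positivity)
  -- Conditions on the mesh: short characteristics (`a₁`), the Lipschitz bound in time (`a₂`), the
  -- first-order error of a step (`a₃`) and the loss `K δ` in `IsTimeChain.approxSub` (`a₄`).
  set a₁ := 16 * (1 + M) * C with ha₁
  set a₂ := 32 * (1 + 2 * L) * C with ha₂
  set a₃ := 3 * (16 * ((1 + M) * C) * C * (1 + L) ^ 2) / ε with ha₃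
  set a₄ := 3 * K / ε with ha₄
  have h₁ : 0 ≤ a₁ := by positivity
  have h₂ : 0 ≤ a₂ := by positivity
  have h₃ : 0 ≤ a₃ := by positivity
  have h₄ : 0 ≤ a₄ := by positivity
  set D := 1 + a₁ + a₂ + a₃ + a₄ with hD
  have hD0 : 0 < D := by positivity
  refine ⟨min δ₁ (1 / D), by positivity, ?_⟩
  intro P hP hmono hadd n θ F hθ0 hθT hθ hδ hF hstep
  set δ := min δ₁ (1 / D) with hδdef
  have hδ0 : 0 < δ := by positivity
  have hδD : δ * D ≤ 1 := by
    have : δ ≤ 1 / D := min_le_right _ _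
    rwa [le_div_iff₀ hD0] at this
  have hδD' : δ + δ * a₁ + δ * a₂ + δ * a₃ + δ * a₄ ≤ 1 := by
    rw [hD] at hδD
    linarith
  have i₁ := mul_nonneg hδ0.le h₁
  have i₂ := mul_nonneg hδ0.le h₂
  have i₃ := mul_nonneg hδ0.le h₃
  have i₄ := mul_nonneg hδ0.le h₄
  have e₃ : 16 * ((1 + M) * δ * C) * C * (1 + L) ^ 2 ≤ ε / 3 := by
    have h : 16 * ((1 + M) * δ * C) * C * (1 + L) ^ 2 = (δ * a₃) * (ε / 3) := by
      rw [ha₃]; field_simp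
    rw [h]
    exact mul_le_of_le_one_left (by positivity) (by linarith)
  have e₄ : K * δ ≤ ε / 3 := by
    have h : K * δ = (δ * a₄) * (ε / 3) := by rw [ha₄]; field_simp
    rw [h]
    exact mul_le_of_le_one_left (by positivity) (by linarith)
  have hle : ∀ k ≤ n, 0 ≤ θ k := by
    intro k
    induction k with
    | zero => exact fun _ => hθ0
    | succ k ih => exact fun hk => (ih (by omega)).trans (hθ k (by omega))
  have hleT : ∀ k ≤ n, θ k ≤ T := fun k hk => by
    refine Nat.decreasingInduction' (P := fun k => θ k ≤ T) (fun j hj _ h => (hθ j hj).trans h) hk hθT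
  have hchain : IsTimeChain n θ (fun k => (F k).1) L K₀ := by
    refine ⟨hθ, hF, fun k hk x => ?_⟩
    rw [hstep k hk]
    refine hP.abs_sub_le_mul hH hmono hadd (hle k hk.le) (hθ k hk) hL ?_ (hF k hk.le) x
    calc 32 * (1 + 2 * L) * (θ (k + 1) - θ k) * C ≤ 32 * (1 + 2 * L) * δ * C := by
          gcongr
          exact hδ k hk
      _ = δ * a₂ := by rw [ha₂]; ring
      _ ≤ 1 := by linarith
  have hMk : ∀ k < n, (1 + M) * (θ (k + 1) - θ k) * C ≤ 1 / 16 := fun k hk => by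
    have h : (1 + M) * (θ (k + 1) - θ k) * C ≤ (1 + M) * δ * C := by
      gcongr
      exact hδ k hk
    have h' : 16 * ((1 + M) * δ * C) = δ * a₁ := by rw [ha₁]; ring
    linarith
  have hωk : ∀ k < n, ∀ τ ∈ Icc (θ k) (θ (k + 1)), ∀ Q p : Eucl d, ‖Q‖ ≤ ρ → ‖p‖ ≤ L →
      |H τ Q p - H (θ (k + 1)) Q p| ≤ ε / 3 := fun k hk τ hτ Q p hQ hp =>
    (hω τ ⟨(hle k hk.le).trans hτ.1, hτ.2.trans (hleT _ hk)⟩ (θ (k + 1))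
      ⟨hle _ hk, hleT _ hk⟩ Q Q p hQ hQ hp (by
        rw [abs_sub_comm, abs_of_nonneg (sub_nonneg.2 hτ.2)]
        have := hδ k hk
        have h' : δ ≤ δ₁ := min_le_left _ _
        linarith [hτ.1]) (by rw [sub_self, norm_zero]; exact hδ₁.le)).le
  have herr : ∀ k < n, 16 * ((1 + M) * (θ (k + 1) - θ k) * C) * C * (1 + L) ^ 2 + ε / 3 ≤
      2 * ε / 3 := fun k hk => by
    have h : 16 * ((1 + M) * (θ (k + 1) - θ k) * C) * C * (1 + L) ^ 2 ≤
        16 * ((1 + M) * δ * C) * C * (1 + L) ^ 2 := by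
      gcongr
      exact hδ k hk
    linarith
  refine ⟨hchain, ?_, ?_⟩
  · refine ApproxSub.mono (hchain.approxSub (l := fun _ => L) (ε := 2 * ε / 3) hL hK₀0 hK
      (fun _ => hL) hF (fun _ _ => le_rfl) hδ (by linarith) hM.ge fun k hk _ => ?_)
      (by linarith) le_rfl le_rfl
    rw [hstep k hk]
    intro Q p c hQ hp hle'
    refine (hP.stepSub hH hmono hadd (hle k hk.le) (hθ k hk) hM0 (hMk k hk) (hωk k hk) (F k)
      Q p c hQ hp hle').trans ?_
    have := mul_le_mul_of_nonneg_left (herr k hk) (sub_nonneg.2 (hθ k hk))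
    linarith
  · refine ApproxSub.mono (hchain.neg.approxSub (l := fun _ => L) (ε := 2 * ε / 3) hL hK₀0 hK
      (fun _ => hL) hchain.neg.space (fun _ _ => le_rfl) hδ (by linarith) hM.ge fun k hk _ => ?_)
      (by linarith) le_rfl le_rfl
    rw [hstep k hk]
    intro Q p c hQ hp hle'
    refine (hP.stepSub_neg hH hmono hadd (hle k hk.le) (hθ k hk) hM0 (hMk k hk) (hωk k hk) (F k)
      Q p c hQ hp hle').trans ?_
    have := mul_le_mul_of_nonneg_left (herr k hk) (sub_nonneg.2 (hθ k hk))
    linarith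

end ApproximateSolutions

/-! ### Classical solutions sampled on a grid. -/

section ClassicalChains

variable {d : ℕ} {H : ℝ → Eucl d → Eucl d → ℝ} {a b : ℝ} {w : ℝ → Eucl d → ℝ}

theorem IsClassicalSolution.neg (hw : IsClassicalSolution H a b w) :
    IsClassicalSolution (negHam H) a b (fun t q => -w t q) where
  contDiffOn := hw.contDiffOn.neg
  equation t ht q := by
    have h1 : gradient (fun q => -w t q) q = -gradient (w t) q := by
      simp only [gradient]
      rw [fderiv_fun_neg, map_neg]
    have h2 := hw.equation t ht q
    rw [h1, negHam, neg_neg, derivWithin.fun_neg]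
    linarith

theorem IsClassicalSolution.hasGradientAt (hw : IsClassicalSolution H a b w) {t : ℝ}
    (ht : t ∈ Icc a b) (q : Eucl d) : HasGradientAt (w t) (gradient (w t) q) q := by
  refine DifferentiableAt.hasGradientAt ?_
  have h1 : ContDiffOn ℝ 2 (fun q => w t q) univ :=
    hw.contDiffOn.comp (f := fun q : Eucl d => (t, q))
      (contDiffOn_const.prodMk contDiffOn_id) fun q _ => ⟨ht, mem_univ _⟩
  exact (contDiffOn_univ.1 h1).differentiable (by norm_num) q

theorem IsClassicalSolution.hasDerivWithinAt (hw : IsClassicalSolution H a b w) {t : ℝ}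
    (ht : t ∈ Icc a b) (q : Eucl d) :
    HasDerivWithinAt (fun τ => w τ q)
      (fderivWithin ℝ (fun x : ℝ × Eucl d => w x.1 x.2) (Icc a b ×ˢ univ) (t, q) (1, 0))
      (Icc a b) t := by
  have h1 := (hw.contDiffOn.differentiableOn (by norm_num) (t, q) ⟨ht, mem_univ _⟩).hasFDerivWithinAt
  have h2 : MapsTo (fun τ : ℝ => (τ, q)) (Icc a b) (Icc a b ×ˢ univ) := fun τ hτ =>
    ⟨hτ, mem_univ _⟩
  exact h1.comp_hasDerivWithinAt t ((hasDerivWithinAt_id t _).prodMk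
    (hasDerivWithinAt_const t _ q)) h2

theorem eq_gradient_of_touching {g : Eucl d → ℝ} {Q p v : Eucl d} {K : ℝ}
    (hg : HasGradientAt g v Q) (h : ∀ q, g q ≤ g Q + inner ℝ p (q - Q) + K * ‖q - Q‖ ^ 2) :
    p = v := by
  have h1 : HasFDerivAt (fun q => g q - inner ℝ p (q - Q) - K * ‖q - Q‖ ^ 2)
      (InnerProductSpace.toDual ℝ _ v - innerSL ℝ p) Q := by
    have h2 : HasFDerivAt (fun q : Eucl d => q - Q) (ContinuousLinearMap.id ℝ (Eucl d)) Q :=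
      (hasFDerivAt_id Q).sub_const Q
    have h3 := (hg.hasFDerivAt.sub ((innerSL ℝ p).hasFDerivAt.comp Q h2)).sub
      ((h2.norm_sq).const_mul K)
    refine h3.congr_fderiv ?_
    ext y
    simp
  have h4 : IsLocalMax (fun q => g q - inner ℝ p (q - Q) - K * ‖q - Q‖ ^ 2) Q :=
    Eventually.of_forall fun q => by
      have := h q
      simp only [sub_self, inner_zero_right, norm_zero]
      linarith
  have h5 := h4.hasFDerivAt_eq_zero h1
  have h6 := congrArg (fun L : Eucl d →L[ℝ] ℝ => L (v - p)) h5
  simp only [sub_apply, InnerProductSpace.toDual_apply_apply,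
    innerSL_apply_apply, zero_apply, ← inner_sub_left] at h6
  exact (sub_eq_zero.1 (inner_self_eq_zero.1 h6)).symm

/-- The values of a classical solution on a fine grid form an approximate subsolution. -/
theorem IsClassicalSolution.exists_approxSub (hw : IsClassicalSolution H a b w) (hab : a < b)
    {ε K ρ : ℝ} (hε : 0 < ε) (hK : 0 ≤ K) :
    ∃ δ > 0, ∀ (n : ℕ) (θ : ℕ → ℝ), (∀ k ≤ n, θ k ∈ Icc a b) → (∀ k < n, θ k ≤ θ (k + 1)) →
      (∀ k < n, θ (k + 1) - θ k ≤ δ) → ApproxSub H n θ (fun k => w (θ k)) ε K ρ := by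
  set D : ℝ × Eucl d → ℝ := fun x =>
    fderivWithin ℝ (fun x : ℝ × Eucl d => w x.1 x.2) (Icc a b ×ˢ univ) x (1, 0) with hD
  have hDc : ContinuousOn D (Icc a b ×ˢ Metric.closedBall 0 ρ) :=
    ((hw.contDiffOn.continuousOn_fderivWithin
      ((uniqueDiffOn_Icc hab).prod uniqueDiffOn_univ) (by norm_num)).clm_apply
        continuousOn_const).mono (prod_mono_right (subset_univ _))
  have hDu := (isCompact_Icc.prod (isCompact_closedBall (0 : Eucl d) ρ)).uniformContinuousOn_of_continuous
    hDc
  obtain ⟨δ₁, hδ₁, hmod⟩ := Metric.uniformContinuousOn_iff.1 hDu (ε / 2) (by positivity)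
  refine ⟨min (δ₁ / 2) (ε / (2 * (K + 1))), by positivity, ?_⟩
  intro n θ hθ hmono hδ j hj h0j Q p c hQ htouch
  have hle : ∀ i k, i ≤ k → k ≤ n → θ i ≤ θ k := by
    intro i k hik
    induction k, hik using Nat.le_induction with
    | base => exact fun _ => le_rfl
    | succ k hk ih => exact fun hk' => (ih (by omega)).trans (hmono k (by omega))
  have hex : ∃ i, θ j ≤ θ i := ⟨j, le_rfl⟩
  classical
  obtain ⟨i, hi⟩ : ∃ i, Nat.find hex = i + 1 := by
    refine Nat.exists_eq_succ_of_ne_zero fun h => ?_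
    have := Nat.find_spec hex
    rw [h] at this
    linarith
  have hi1 : θ j ≤ θ (i + 1) := hi ▸ Nat.find_spec hex
  have hi2 : θ i < θ j := not_le.1 (Nat.find_min hex (by omega))
  have hij : i + 1 ≤ j := hi ▸ Nat.find_min' hex le_rfl
  have hθij : θ j - θ i ≤ min (δ₁ / 2) (ε / (2 * (K + 1))) :=
    le_trans (by linarith) (hδ i (by omega))
  have hδ1 : θ j - θ i ≤ δ₁ / 2 := hθij.trans (min_le_left _ _)
  have hδ2 : (θ j - θ i) * (2 * (K + 1)) ≤ ε := by
    have := hθij.trans (min_le_right _ _)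
    rwa [le_div_iff₀ (by positivity)] at this
  have hp : p = gradient (w (θ j)) Q := by
    refine eq_gradient_of_touching (K := K) (hw.hasGradientAt (hθ j hj) Q) fun q => ?_
    have := htouch j le_rfl q
    simpa using this
  have hti := htouch i (by omega) Q
  simp only [sub_self, inner_zero_right, norm_zero] at hti
  have hderiv : ∀ t ∈ Icc (θ i) (θ j), HasDerivWithinAt (fun τ => w τ Q) (D (t, Q)) (Icc a b) t :=
    fun t ht => hw.hasDerivWithinAt ⟨(hθ i (by omega)).1.trans ht.1, ht.2.trans (hθ j hj).2⟩ Q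
  -- Touching at `(θ i, Q)` bounds `c` by a difference quotient of `w` in time, which is a
  -- derivative at some intermediate `ξ`. Uniform continuity transfers it to `θ j`, where the
  -- equation holds.
  obtain ⟨ξ, hξ, hξ'⟩ := exists_hasDerivAt_eq_slope (fun τ => w τ Q) (fun t => D (t, Q)) hi2
    (fun t ht => ((hderiv t ht).continuousWithinAt).mono
      (Icc_subset_Icc (hθ i (by omega)).1 (hθ j hj).2))
    (fun t ht => (hderiv t (Ioo_subset_Icc_self ht)).hasDerivAt
      (Icc_mem_nhds ((hθ i (by omega)).1.trans_lt ht.1) (ht.2.trans_le (hθ j hj).2)))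
  have hDj : D (θ j, Q) = -H (θ j) Q p := by
    have h1 := hw.equation (θ j) (hθ j hj) Q
    rw [(hderiv (θ j) (right_mem_Icc.2 hi2.le)).derivWithin (uniqueDiffOn_Icc hab _ (hθ j hj)),
      ← hp] at h1
    linarith
  have hclose : |D (ξ, Q) - D (θ j, Q)| < ε / 2 := by
    refine hmod (ξ, Q) ⟨⟨(hθ i (by omega)).1.trans hξ.1.le, hξ.2.le.trans (hθ j hj).2⟩, by
      simpa using hQ⟩ (θ j, Q) ⟨hθ j hj, by simpa using hQ⟩ ?_
    rw [dist_prod_same_right, Real.dist_eq, abs_sub_comm, abs_of_nonneg (by linarith [hξ.2])]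
    linarith [hξ.1]
  have h0 : 0 < θ j - θ i := by linarith
  rw [eq_div_iff h0.ne'] at hξ'
  have h1 : c * (θ j - θ i) ≤ (D (ξ, Q) + K * (θ j - θ i)) * (θ j - θ i) := by nlinarith
  have h2 := le_of_mul_le_mul_right h1 h0
  have h3 := (abs_lt.1 hclose).2
  nlinarith

/-- The values of a Lipschitz classical solution on a fine grid form an approximate solution. -/
theorem IsClassicalSolution.exists_approxSol (hw : IsClassicalSolution H a b w) (hab : a < b)
    {L : ℝ≥0} (hL : LipschitzOnWith L (fun x : ℝ × Eucl d => w x.1 x.2) (Icc a b ×ˢ univ))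
    {ε K ρ : ℝ} (hε : 0 < ε) (hK : 0 ≤ K) :
    ∃ δ > 0, ∀ (n : ℕ) (θ : ℕ → ℝ), (∀ k ≤ n, θ k ∈ Icc a b) → (∀ k < n, θ k ≤ θ (k + 1)) →
      (∀ k < n, θ (k + 1) - θ k ≤ δ) → ApproxSol H L L ε K ρ n θ (fun k => w (θ k)) := by
  obtain ⟨δ₁, hδ₁, h₁⟩ := hw.exists_approxSub hab (ρ := ρ) hε hK
  obtain ⟨δ₂, hδ₂, h₂⟩ := hw.neg.exists_approxSub hab (ρ := ρ) hε hK
  refine ⟨min δ₁ δ₂, by positivity, fun n θ hθ hmono hδ => ⟨⟨hmono, ?_, ?_⟩,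
    h₁ n θ hθ hmono fun k hk => (hδ k hk).trans (min_le_left _ _),
    h₂ n θ hθ hmono fun k hk => (hδ k hk).trans (min_le_right _ _)⟩⟩
  · intro k hk x y
    have h := hL.dist_le_mul (θ k, x) ⟨hθ k hk, mem_univ _⟩ (θ k, y) ⟨hθ k hk, mem_univ _⟩
    rwa [dist_prod_same_left, Real.dist_eq, dist_eq_norm] at h
  · intro k hk x
    have h := hL.dist_le_mul (θ (k + 1), x) ⟨hθ _ hk, mem_univ _⟩ (θ k, x) ⟨hθ k hk.le, mem_univ _⟩
    rwa [dist_prod_same_right, Real.dist_eq, Real.dist_eq,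
      abs_of_nonneg (sub_nonneg.2 (hmono k hk))] at h

end ClassicalChains

/-! ### The value operator -/

section Value

variable {d : ℕ} {H : ℝ → Eucl d → Eucl d → ℝ} {C : ℝ}

/-- Comparison of approximate solutions. -/
theorem exists_comparison_approxSol (hH : HamiltonianBounds H C) {L K₀ T ρ₀ m η : ℝ} (hL : 0 ≤ L)
    (hK₀ : 0 ≤ K₀) (hT : 0 ≤ T) (hρ₀ : 0 ≤ ρ₀) (hm : 0 ≤ m) (hη : 0 < η) :
    ∃ ε > 0, ∃ K > 0, ∃ ρ > 0, ∀ (n n' : ℕ) (θ θ' : ℕ → ℝ) (f g : ℕ → Eucl d → ℝ) (m₀ : ℝ),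
      ApproxSol H L K₀ ε K ρ n θ f → ApproxSol H L K₀ ε K ρ n' θ' g → θ 0 = θ' 0 → 0 ≤ θ 0 →
      θ n = θ' n' → θ n ≤ T →
      (∀ q, f 0 q ≤ g 0 q + m₀ + m) → (∀ q, ‖q‖ ≤ ρ → f 0 q ≤ g 0 q + m₀) →
      ∀ Q, ‖Q‖ ≤ ρ₀ → f n Q ≤ g n' Q + m₀ + η := by
  obtain ⟨ε, hε, K, hK, ρ, hρ, h⟩ := exists_comparison hH hL hK₀ hT hρ₀ hm hη
  exact ⟨ε, hε, K, hK, ρ, hρ, fun n n' θ θ' f g m₀ hf hg h0 h0' hn hnT hm₀ hm₁ =>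
    h n n' θ θ' f g m₀ hf.chain hg.chain h0 h0' hn hnT hf.sub hg.super hm₀ hm₁⟩

/-- The solutions of the scheme on fine grids are approximate solutions with uniform Lipschitz
constants. -/
theorem exists_approxSol_schemeChain (hH : HamiltonianBounds H C) {T ℓ ε K ρ : ℝ} (hT : 0 ≤ T)
    (hℓ : 0 ≤ ℓ) (hε : 0 < ε) (hK : 0 ≤ K) :
    ∃ δ > 0, ∀ (s₀ : ℝ) (n : ℕ) (θ : ℕ → ℝ) (u : Eucl d → ℝ), 0 ≤ s₀ → s₀ ≤ θ 0 → θ n ≤ T →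
      (∀ k < n, θ k ≤ θ (k + 1)) → (∀ k < n, θ (k + 1) - θ k ≤ δ) →
      (∀ x y, |u x - u y| ≤ schemeLip C s₀ (1 + ℓ) (θ 0) * ‖x - y‖) →
      ApproxSol H (schemeLip C 0 (1 + ℓ) T) (2 * C * (1 + schemeLip C 0 (1 + ℓ) T) ^ 2) ε K ρ n θ
        (schemeChain H C (schemeLip C s₀ (1 + ℓ)) θ u) := by
  have hC := hH.pos
  have hB : 1 ≤ 1 + ℓ := by linarith
  obtain ⟨δ, hδ, h⟩ := exists_approxSub_schemeChain hH (T := T) (ρ := ρ)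
    (schemeLip_nonneg (s₀ := 0) hC.le hB hT) hε hK
  refine ⟨δ, hδ, fun s₀ n θ u hs hs0 hθT hmono hmesh hu => ?_⟩
  obtain ⟨h1, h2, h3⟩ := h s₀ (1 + ℓ) n θ u hB hs0 (hs.trans hs0) hθT hmono hmesh hu
    (fun k hk => by
      have hk' : θ k ≤ T := Nat.decreasingInduction' (P := fun k => θ k ≤ T)
        (fun j hj _ h => (hmono j hj).trans h) hk hθT
      unfold schemeLip
      gcongr)
  exact ⟨h1, h2, h3⟩

/-- The grid with `N + 1` equal steps from `s` to `t`. -/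
noncomputable def uniformGrid (s t : ℝ) (N k : ℕ) : ℝ := s + k * ((t - s) / (N + 1))

theorem uniformGrid_zero (s t : ℝ) (N : ℕ) : uniformGrid s t N 0 = s := by simp [uniformGrid]

theorem uniformGrid_last (s t : ℝ) (N : ℕ) : uniformGrid s t N (N + 1) = t := by
  rw [uniformGrid]
  push_cast
  field_simp
  ring

theorem uniformGrid_succ_sub (s t : ℝ) (N k : ℕ) :
    uniformGrid s t N (k + 1) - uniformGrid s t N k = (t - s) / (N + 1) := by
  rw [uniformGrid, uniformGrid]
  push_cast
  ring

theorem uniformGrid_le_succ {s t : ℝ} (hst : s ≤ t) (N k : ℕ) :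
    uniformGrid s t N k ≤ uniformGrid s t N (k + 1) := by
  have h := uniformGrid_succ_sub s t N k
  have : 0 ≤ (t - s) / (N + 1) := div_nonneg (sub_nonneg.2 hst) (by positivity)
  linarith

theorem uniformGrid_mem_Icc {s t : ℝ} (hst : s ≤ t) {N k : ℕ} (hk : k ≤ N + 1) :
    uniformGrid s t N k ∈ Icc s t := by
  have h := monotone_nat_of_le_succ (uniformGrid_le_succ hst N)
  exact ⟨(uniformGrid_zero s t N).ge.trans (h (Nat.zero_le k)),
    (h hk).trans (uniformGrid_last s t N).le⟩

theorem eventually_div_le (r : ℝ) {δ : ℝ} (hδ : 0 < δ) :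
    ∀ᶠ N : ℕ in atTop, r / (N + 1) ≤ δ := by
  have h : Tendsto (fun N : ℕ => r / ((N : ℝ) + 1)) atTop (𝓝 0) :=
    tendsto_const_nhds.div_atTop (tendsto_atTop_add_const_right _ _ tendsto_natCast_atTop_atTop)
  exact h.eventually (eventually_le_nhds hδ)

/-- The solution of the scheme at time `t`, with `N + 1` steps from time `s`. -/
noncomputable def approxValue (H : ℝ → Eucl d → Eucl d → ℝ) (C ℓ : ℝ) (u : Eucl d → ℝ) (s t : ℝ)
    (N : ℕ) : Eucl d → ℝ :=
  schemeChain H C (schemeLip C s (1 + ℓ)) (uniformGrid s t N) u (N + 1)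

theorem exists_eventually_approxSol (hH : HamiltonianBounds H C) {s t ℓ ε K ρ : ℝ} (hs : 0 ≤ s)
    (hst : s ≤ t) (hℓ : 0 ≤ ℓ) (hε : 0 < ε) (hK : 0 ≤ K) {u : Eucl d → ℝ}
    (hu : ∀ x y, |u x - u y| ≤ ℓ * ‖x - y‖) :
    ∀ᶠ N in atTop, ApproxSol H (schemeLip C 0 (1 + ℓ) t)
      (2 * C * (1 + schemeLip C 0 (1 + ℓ) t) ^ 2) ε K ρ (N + 1) (uniformGrid s t N)
        (schemeChain H C (schemeLip C s (1 + ℓ)) (uniformGrid s t N) u) := by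
  obtain ⟨δ, hδ, h⟩ := exists_approxSol_schemeChain hH (ρ := ρ) (hs.trans hst) hℓ hε hK
  filter_upwards [eventually_div_le (t - s) hδ] with N hN
  refine h s (N + 1) _ u hs (uniformGrid_zero s t N).ge (uniformGrid_last s t N).le
    (fun k _ => uniformGrid_le_succ hst N k) (fun k _ => (uniformGrid_succ_sub s t N k).trans_le hN)
    fun x y => ?_
  rw [uniformGrid_zero]
  simpa [schemeLip] using hu x y

/-- A Lipschitz constant of a Lipschitz function. -/
noncomputable def LipFun.lipBound (u : LipFun d) : ℝ := (Classical.choose u.2 : ℝ≥0)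

theorem LipFun.lipBound_nonneg (u : LipFun d) : 0 ≤ u.lipBound := NNReal.coe_nonneg _

theorem LipFun.abs_sub_le (u : LipFun d) (x y : Eucl d) :
    |u.1 x - u.1 y| ≤ u.lipBound * ‖x - y‖ := by
  have h := (Classical.choose_spec u.2).dist_le_mul x y
  rwa [Real.dist_eq, dist_eq_norm] at h

/-- The limit of the scheme. -/
noncomputable def value (H : ℝ → Eucl d → Eucl d → ℝ) (C : ℝ) (u : LipFun d) (s t : ℝ)
    (Q : Eucl d) : ℝ :=
  limUnder atTop fun N => approxValue H C u.lipBound u.1 s t N Q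

/-- Two fine grids give approximate solutions with the same initial value; comparison in both
directions yields the Cauchy property. -/
theorem tendsto_approxValue_lipBound (hH : HamiltonianBounds H C) (u : LipFun d) {s t : ℝ}
    (hs : 0 ≤ s) (hst : s ≤ t) (Q : Eucl d) :
    Tendsto (fun N => approxValue H C u.lipBound u.1 s t N Q) atTop (𝓝 (value H C u s t Q)) := by
  refine CauchySeq.tendsto_limUnder (Metric.cauchySeq_iff.2 fun η hη => ?_)
  have hC := hH.pos
  have hL := schemeLip_nonneg (s₀ := 0) hC.le (B := 1 + u.lipBound)
    (by linarith [u.lipBound_nonneg]) (hs.trans hst)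
  obtain ⟨ε, hε, K, hK, ρ, hρ, h⟩ := exists_comparison_approxSol hH hL
    (K₀ := 2 * C * (1 + schemeLip C 0 (1 + u.lipBound) t) ^ 2) (by positivity) (hs.trans hst)
    (norm_nonneg Q) le_rfl (half_pos hη)
  obtain ⟨N₀, hN₀⟩ := eventually_atTop.1
    (exists_eventually_approxSol hH (ρ := ρ) hs hst u.lipBound_nonneg hε hK.le u.abs_sub_le)
  have key : ∀ N ≥ N₀, ∀ N' ≥ N₀, approxValue H C u.lipBound u.1 s t N Q ≤
      approxValue H C u.lipBound u.1 s t N' Q + η / 2 := fun N hN N' hN' => by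
    have := h _ _ _ _ _ _ 0 (hN₀ N hN) (hN₀ N' hN') (by simp only [uniformGrid_zero])
      (by rwa [uniformGrid_zero]) (by simp only [uniformGrid_last])
      (by rw [uniformGrid_last]) (fun q => by simp [schemeChain])
      (fun q _ => by simp [schemeChain]) Q le_rfl
    rwa [add_zero] at this
  refine ⟨N₀, fun N hN N' hN' => ?_⟩
  rw [Real.dist_eq, abs_lt]
  constructor <;> linarith [key N hN N' hN', key N' hN' N hN]

/-- Approximate solutions are close to the value, if their initial values are. -/
theorem exists_forall_approxSol_value (hH : HamiltonianBounds H C) (u : LipFun d)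
    {L K₀ T ρ₀ m η : ℝ} (hL : 0 ≤ L) (hK₀ : 0 ≤ K₀) (hT : 0 ≤ T) (hρ₀ : 0 ≤ ρ₀) (hm : 0 ≤ m)
    (hη : 0 < η) :
    ∃ ε > 0, ∃ K > 0, ∃ ρ > 0, ∀ (s t : ℝ) (n : ℕ) (θ : ℕ → ℝ) (f : ℕ → Eucl d → ℝ) (m₀ : ℝ),
      0 ≤ s → t ≤ T → θ 0 = s → θ n = t → ApproxSol H L K₀ ε K ρ n θ f →
      ((∀ q, f 0 q ≤ u.1 q + m₀ + m) → (∀ q, ‖q‖ ≤ ρ → f 0 q ≤ u.1 q + m₀) →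
        ∀ Q, ‖Q‖ ≤ ρ₀ → f n Q ≤ value H C u s t Q + m₀ + η) ∧
      ((∀ q, u.1 q ≤ f 0 q + m₀ + m) → (∀ q, ‖q‖ ≤ ρ → u.1 q ≤ f 0 q + m₀) →
        ∀ Q, ‖Q‖ ≤ ρ₀ → value H C u s t Q ≤ f n Q + m₀ + η) := by
  have hC := hH.pos
  have hB : 1 ≤ 1 + u.lipBound := by linarith [u.lipBound_nonneg]
  set L' := schemeLip C 0 (1 + u.lipBound) T with hL'
  set K₀' := 2 * C * (1 + L') ^ 2 with hK₀'
  have hL'0 : 0 ≤ L' := schemeLip_nonneg (s₀ := 0) hC.le hB hT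
  obtain ⟨ε, hε, K, hK, ρ, hρ, h⟩ := exists_comparison_approxSol hH (L := max L L')
    (K₀ := max K₀ K₀') (le_max_of_le_left hL) (le_max_of_le_left hK₀) hT hρ₀ hm hη
  refine ⟨ε, hε, K, hK, ρ, hρ, fun s t n θ f m₀ hs htT h0 hn hf => ?_⟩
  have hst : s ≤ t := by
    rw [← h0, ← hn]
    exact hf.chain.le_of_le (Nat.zero_le n) le_rfl
  have hf' := hf.mono (le_max_left L L') (le_max_left K₀ K₀') le_rfl le_rfl le_rfl
  have hev := exists_eventually_approxSol hH (ρ := ρ) hs hst u.lipBound_nonneg hε hK.le u.abs_sub_le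
  have hLt : schemeLip C 0 (1 + u.lipBound) t ≤ L' := schemeLip_mono hC.le hB htT
  have hLt0 : 0 ≤ schemeLip C 0 (1 + u.lipBound) t :=
    schemeLip_nonneg (s₀ := 0) hC.le hB (hs.trans hst)
  have hev' : ∀ᶠ N in atTop, ApproxSol H (max L L') (max K₀ K₀') ε K ρ (N + 1)
      (uniformGrid s t N)
      (schemeChain H C (schemeLip C s (1 + u.lipBound)) (uniformGrid s t N) u.1) := by
    filter_upwards [hev] with N hN
    refine hN.mono (le_max_of_le_right hLt) (le_max_of_le_right ?_) le_rfl le_rfl le_rfl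
    rw [hK₀']
    gcongr
  have hlim := fun Q => tendsto_approxValue_lipBound hH u hs hst Q
  constructor
  · intro hg hl Q hQ
    refine ge_of_tendsto (((hlim Q).add_const m₀).add_const η) ?_
    filter_upwards [hev'] with N hN
    exact h _ _ _ _ _ _ m₀ hf' hN (by rw [h0, uniformGrid_zero]) (by rwa [h0])
      (by rw [hn, uniformGrid_last]) (by rwa [hn]) hg hl Q hQ
  · intro hg hl Q hQ
    refine le_of_tendsto (hlim Q) ?_
    filter_upwards [hev'] with N hN
    exact h _ _ _ _ _ _ m₀ hN hf' (by rw [h0, uniformGrid_zero]) (by rwa [uniformGrid_zero])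
      (by rw [hn, uniformGrid_last]) (by rwa [uniformGrid_last]) hg hl Q hQ

/-- Approximate solutions with the same initial value are close to the value. -/
theorem exists_forall_abs_sub_value_le (hH : HamiltonianBounds H C) (u : LipFun d)
    {L K₀ T ρ₀ η : ℝ} (hL : 0 ≤ L) (hK₀ : 0 ≤ K₀) (hT : 0 ≤ T) (hρ₀ : 0 ≤ ρ₀) (hη : 0 < η) :
    ∃ ε > 0, ∃ K > 0, ∃ ρ > 0, ∀ (s t : ℝ) (n : ℕ) (θ : ℕ → ℝ) (f : ℕ → Eucl d → ℝ),
      0 ≤ s → t ≤ T → θ 0 = s → θ n = t → ApproxSol H L K₀ ε K ρ n θ f → f 0 = u.1 →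
      ∀ Q, ‖Q‖ ≤ ρ₀ → |f n Q - value H C u s t Q| ≤ η := by
  obtain ⟨ε, hε, K, hK, ρ, hρ, h⟩ :=
    exists_forall_approxSol_value hH u hL hK₀ hT hρ₀ le_rfl hη
  refine ⟨ε, hε, K, hK, ρ, hρ, fun s t n θ f hs htT h0 hn hf hfu Q hQ => ?_⟩
  obtain ⟨h1, h2⟩ := h s t n θ f 0 hs htT h0 hn hf
  have h3 := h1 (fun q => by simp [hfu]) (fun q _ => by simp [hfu]) Q hQ
  have h4 := h2 (fun q => by simp [hfu]) (fun q _ => by simp [hfu]) Q hQ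
  rw [abs_le]
  constructor <;> linarith

/-- The limit of the scheme does not depend on the Lipschitz constant that is used. -/
theorem tendsto_approxValue (hH : HamiltonianBounds H C) (u : LipFun d) {ℓ : ℝ} (hℓ : 0 ≤ ℓ)
    (hu : ∀ x y, |u.1 x - u.1 y| ≤ ℓ * ‖x - y‖) {s t : ℝ} (hs : 0 ≤ s) (hst : s ≤ t)
    (Q : Eucl d) :
    Tendsto (fun N => approxValue H C ℓ u.1 s t N Q) atTop (𝓝 (value H C u s t Q)) := by
  have hC := hH.pos
  rw [Metric.tendsto_nhds]
  intro η hη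
  have hL := schemeLip_nonneg (s₀ := 0) hC.le (B := 1 + ℓ) (by linarith) (hs.trans hst)
  obtain ⟨ε, hε, K, hK, ρ, hρ, h⟩ := exists_forall_abs_sub_value_le hH u hL
    (K₀ := 2 * C * (1 + schemeLip C 0 (1 + ℓ) t) ^ 2) (by positivity) (hs.trans hst)
    (norm_nonneg Q) (half_pos hη)
  filter_upwards [exists_eventually_approxSol hH (ρ := ρ) hs hst hℓ hε hK.le hu] with N hN
  rw [Real.dist_eq]
  exact (h s t _ _ _ hs le_rfl (uniformGrid_zero s t N) (uniformGrid_last s t N) hN rfl Q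
    le_rfl).trans_lt (half_lt_self hη)

theorem abs_value_sub_le (hH : HamiltonianBounds H C) (u : LipFun d) {ℓ : ℝ} (hℓ : 0 ≤ ℓ)
    (hu : ∀ x y, |u.1 x - u.1 y| ≤ ℓ * ‖x - y‖) {s t : ℝ} (hs : 0 ≤ s) (hst : s ≤ t)
    (x y : Eucl d) :
    |value H C u s t x - value H C u s t y| ≤ schemeLip C 0 (1 + ℓ) t * ‖x - y‖ := by
  refine le_of_tendsto ((tendsto_approxValue hH u hℓ hu hs hst x).sub
    (tendsto_approxValue hH u hℓ hu hs hst y)).abs ?_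
  -- The parameters of the viscosity inequalities are arbitrary here: only the Lipschitz bounds of
  -- the chain pass to the limit.
  filter_upwards [exists_eventually_approxSol hH (ρ := 0) hs hst hℓ one_pos zero_le_one hu]
    with N hN
  exact hN.chain.space (N + 1) le_rfl x y

theorem abs_value_sub_self_le (hH : HamiltonianBounds H C) (u : LipFun d) {ℓ : ℝ} (hℓ : 0 ≤ ℓ)
    (hu : ∀ x y, |u.1 x - u.1 y| ≤ ℓ * ‖x - y‖) {s t : ℝ} (hs : 0 ≤ s) (hst : s ≤ t)
    (Q : Eucl d) : |value H C u s t Q - u.1 Q| ≤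
      2 * C * (1 + schemeLip C 0 (1 + ℓ) t) ^ 2 * (t - s) := by
  refine le_of_tendsto ((tendsto_approxValue hH u hℓ hu hs hst Q).sub_const _).abs ?_
  filter_upwards [exists_eventually_approxSol hH (ρ := 0) hs hst hℓ one_pos zero_le_one hu]
    with N hN
  have h := hN.chain.abs_sub_le_of_le (Nat.zero_le (N + 1)) le_rfl Q
  rwa [uniformGrid_zero, uniformGrid_last] at h

theorem value_le_value_add (hH : HamiltonianBounds H C) {u v : LipFun d} {c : ℝ}
    (h : ∀ q, u.1 q ≤ v.1 q + c) {s t : ℝ} (hs : 0 ≤ s) (hst : s ≤ t) (Q : Eucl d) :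
    value H C u s t Q ≤ value H C v s t Q + c := by
  have hC := hH.pos
  refine le_of_forall_pos_le_add fun η hη => ?_
  have hL := schemeLip_nonneg (s₀ := 0) hC.le (B := 1 + u.lipBound)
    (by linarith [u.lipBound_nonneg]) (hs.trans hst)
  obtain ⟨ε, hε, K, hK, ρ, hρ, hv⟩ := exists_forall_approxSol_value hH v hL
    (K₀ := 2 * C * (1 + schemeLip C 0 (1 + u.lipBound) t) ^ 2) (by positivity) (hs.trans hst)
    (norm_nonneg Q) le_rfl hη
  refine le_of_tendsto (tendsto_approxValue_lipBound hH u hs hst Q) ?_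
  filter_upwards [exists_eventually_approxSol hH (ρ := ρ) hs hst u.lipBound_nonneg hε hK.le
    u.abs_sub_le] with N hN
  exact (hv s t _ _ _ c hs le_rfl (uniformGrid_zero s t N) (uniformGrid_last s t N) hN).1
    (fun q => by rw [add_zero]; exact h q) (fun q _ => h q) Q le_rfl

end Value

/-! ### The viscosity operator -/

section ViscosityOperator

variable {d : ℕ} {H : ℝ → Eucl d → Eucl d → ℝ} {C : ℝ}

theorem exists_lipschitzWith_value (hH : HamiltonianBounds H C) (u : LipFun d) {s t : ℝ}
    (hs : 0 ≤ s) (hst : s ≤ t) : ∃ K : ℝ≥0, LipschitzWith K (value H C u s t) := by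
  refine ⟨(schemeLip C 0 (1 + u.lipBound) t).toNNReal, LipschitzWith.of_dist_le_mul fun x y => ?_⟩
  rw [Real.dist_eq, dist_eq_norm]
  refine (abs_value_sub_le hH u u.lipBound_nonneg u.abs_sub_le hs hst x y).trans ?_
  gcongr
  exact Real.le_coe_toNNReal _

open Classical in
/-- The viscosity operator of the Hamiltonian. -/
noncomputable def viscOp (hH : HamiltonianBounds H C) : OpFamily d := fun s t u =>
  if h : 0 ≤ s ∧ s ≤ t then ⟨value H C u s t, exists_lipschitzWith_value hH u h.1 h.2⟩ else u

theorem viscOp_val (hH : HamiltonianBounds H C) {s t : ℝ} (hs : 0 ≤ s) (hst : s ≤ t)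
    (u : LipFun d) : (viscOp hH s t u).1 = value H C u s t := by
  have h : viscOp hH s t u = (⟨value H C u s t, exists_lipschitzWith_value hH u hs hst⟩ : LipFun d) :=
    dif_pos ⟨hs, hst⟩
  rw [h]

theorem viscOp_monotone (hH : HamiltonianBounds H C) : OpMonotone (viscOp hH) := by
  intro s t hs hst u v huv q
  rw [viscOp_val hH hs hst, viscOp_val hH hs hst]
  simpa using value_le_value_add hH (c := 0) (fun q => by simpa using huv q) hs hst q

theorem viscOp_additive (hH : HamiltonianBounds H C) : OpAdditive (viscOp hH) := by
  intro s t hs hst u c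
  refine Subtype.ext (funext fun q => ?_)
  change (viscOp hH s t (u.addConst c)).1 q = c + (viscOp hH s t u).1 q
  rw [viscOp_val hH hs hst, viscOp_val hH hs hst]
  have h1 := value_le_value_add hH (u := u.addConst c) (v := u) (c := c)
    (fun q => (add_comm c (u.1 q)).le) hs hst q
  have h2 := value_le_value_add hH (u := u) (v := u.addConst c) (c := -c)
    (fun q => by change u.1 q ≤ c + u.1 q + -c; linarith) hs hst q
  linarith

/-- The slope bound `l` is a function of absolute time, so a restarted scheme uses the same steps as
the original one. -/
theorem schemeChain_add (l : ℝ → ℝ) (θ : ℕ → ℝ) (u : Eucl d → ℝ) (N k : ℕ) :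
    schemeChain H C l (fun j => θ (N + j)) (schemeChain H C l θ u N) k =
      schemeChain H C l θ u (N + k) := by
  induction k with
  | zero => rfl
  | succ k ih =>
    rw [← add_assoc, schemeChain, schemeChain, ih]
    rfl

/-- A fine grid from `s` to `t` that contains `r`. -/
theorem exists_grid_through {s r t : ℝ} (hsr : s ≤ r) (hrt : r ≤ t) {δ : ℝ} (hδ : 0 < δ) :
    ∃ (N n : ℕ) (θ : ℕ → ℝ), θ 0 = s ∧ θ N = r ∧ θ (N + n) = t ∧ (∀ k, θ k ≤ θ (k + 1)) ∧
      ∀ k, θ (k + 1) - θ k ≤ δ := by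
  obtain ⟨N, h1, h2⟩ := ((eventually_div_le (r - s) hδ).and (eventually_div_le (t - r) hδ)).exists
  set g : ℕ → ℝ := fun k => if k ≤ N + 1 then uniformGrid s r N k else
    uniformGrid r t N (k - (N + 1)) with hg
  have hstep : ∀ k, g (k + 1) - g k = (r - s) / (N + 1) ∨ g (k + 1) - g k = (t - r) / (N + 1) := by
    intro k
    simp only [hg]
    rcases lt_trichotomy k (N + 1) with hk | hk | hk
    · left
      rw [if_pos (by omega), if_pos (by omega), uniformGrid_succ_sub]
    · right
      subst hk
      rw [if_neg (by omega), if_pos le_rfl, uniformGrid_last, ← uniformGrid_succ_sub r t N 0,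
        uniformGrid_zero]
      congr 2
      omega
    · right
      rw [if_neg (by omega), if_neg (by omega), ← uniformGrid_succ_sub r t N (k - (N + 1))]
      congr 2
      omega
  have hN : (0 : ℝ) < N + 1 := by positivity
  refine ⟨N + 1, N + 1, g, ?_, ?_, ?_, fun k => ?_, fun k => ?_⟩
  · simp only [hg]
    rw [if_pos (Nat.zero_le _), uniformGrid_zero]
  · simp only [hg]
    rw [if_pos le_rfl, uniformGrid_last]
  · simp only [hg]
    rw [if_neg (by omega), Nat.add_sub_cancel, uniformGrid_last]
  · have e1 : 0 ≤ (r - s) / (N + 1) := div_nonneg (sub_nonneg.2 hsr) hN.le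
    have e2 : 0 ≤ (t - r) / (N + 1) := div_nonneg (sub_nonneg.2 hrt) hN.le
    rcases hstep k with h | h <;> linarith
  · rcases hstep k with h | h <;> linarith

/-- The scheme is run on a grid through `r`. At time `r` it is close to the value only on a ball,
but within `m` everywhere, so its tail is compared with the value issued from `viscOp hH s r u` by
means of the localized comparison. -/
theorem viscOp_markov (hH : HamiltonianBounds H C) : OpMarkov (viscOp hH) := by
  intro s r t hs hsr hrt u
  have hC := hH.pos
  have hr : 0 ≤ r := hs.trans hsr
  have ht : 0 ≤ t := hr.trans hrt
  refine Subtype.ext (funext fun Q => ?_)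
  rw [viscOp_val hH hs (hsr.trans hrt), viscOp_val hH hr hrt]
  set v := viscOp hH s r u with hv
  have hvval : v.1 = value H C u s r := viscOp_val hH hs hsr u
  set ℓ := u.lipBound with hℓdef
  have hℓ : 0 ≤ ℓ := u.lipBound_nonneg
  set L := schemeLip C 0 (1 + ℓ) t with hLdef
  have hL : 0 ≤ L := schemeLip_nonneg (s₀ := 0) hC.le (by linarith) ht
  set K₀ := 2 * C * (1 + L) ^ 2 with hK₀def
  have hK₀ : 0 ≤ K₀ := by positivity
  refine eq_of_forall_dist_le fun η' hη' => ?_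
  rw [Real.dist_eq]
  obtain ⟨η, hη, hηη⟩ : ∃ η > 0, 3 * η ≤ η' := ⟨η' / 3, by positivity, by linarith⟩
  set m := 2 * K₀ * (r - s) with hm
  have hm0 : 0 ≤ m := mul_nonneg (by positivity) (sub_nonneg.2 hsr)
  obtain ⟨ε₁, hε₁, K₁, hK₁, ρ₁, hρ₁, h₁⟩ :=
    exists_forall_abs_sub_value_le hH u hL hK₀ ht (norm_nonneg Q) hη
  obtain ⟨ε₂, hε₂, K₂, hK₂, ρ₂, hρ₂, h₂⟩ :=
    exists_forall_approxSol_value hH v hL hK₀ ht (norm_nonneg Q) hm0 hη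
  -- The head must be accurate on the ball of radius `ρ₂` which the comparison of the tails
  -- requires.
  obtain ⟨ε₃, hε₃, K₃, hK₃, ρ₃, hρ₃, h₃⟩ :=
    exists_forall_abs_sub_value_le hH u hL hK₀ ht hρ₂.le hη
  set ε := min ε₁ (min ε₂ ε₃) with hεdef
  set K := max K₁ (max K₂ K₃) with hKdef
  set ρ := max ρ₁ (max ρ₂ ρ₃) with hρdef
  obtain ⟨δ, hδ, hscheme⟩ := exists_approxSol_schemeChain hH (T := t) (ρ := ρ) ht hℓ
    (show 0 < ε by positivity) (show 0 ≤ K by positivity)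
  obtain ⟨N, n, θ, hθ0, hθN, hθn, hmono, hmesh⟩ := exists_grid_through hsr hrt
    (show 0 < min δ (1 / (2 * C)) by positivity)
  have hmesh1 : ∀ k, θ (k + 1) - θ k ≤ δ := fun k => (hmesh k).trans (min_le_left _ _)
  set f := schemeChain H C (schemeLip C s (1 + ℓ)) θ u.1 with hf
  have hfu : ∀ x y, |u.1 x - u.1 y| ≤ schemeLip C s (1 + ℓ) (θ 0) * ‖x - y‖ := fun x y => by
    rw [hθ0]
    simpa [schemeLip] using u.abs_sub_le x y
  have hfull := hscheme s (N + n) θ u.1 hs hθ0.ge hθn.le (fun k _ => hmono k)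
    (fun k _ => hmesh1 k) hfu
  have hhead := hscheme s N θ u.1 hs hθ0.ge (hθN.le.trans hrt) (fun k _ => hmono k)
    (fun k _ => hmesh1 k) hfu
  have hlipN : ∀ x y, |f N x - f N y| ≤ schemeLip C s (1 + ℓ) (θ N) * ‖x - y‖ := by
    refine (abs_schemeChain_sub_le hH (by linarith) hθ0.ge (fun k _ => hmono k) (fun k _ => ?_) hfu
      N le_rfl).2
    have := (hmesh k).trans (min_le_right _ _)
    rw [le_div_iff₀ (by positivity)] at this
    linarith
  have htail := hscheme s n (fun j => θ (N + j)) (f N) hs (by rw [add_zero, hθN]; exact hsr)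
    hθn.le (fun k _ => hmono _) (fun k _ => hmesh1 _) (by rw [add_zero]; exact hlipN)
  have e1 := h₁ s t (N + n) θ f hs le_rfl hθ0 hθn
    (hfull.mono le_rfl le_rfl (min_le_left _ _) (le_max_left _ _) (le_max_left _ _)) rfl Q le_rfl
  have e3 := h₃ s r N θ f hs hrt hθ0 hθN
    (hhead.mono le_rfl le_rfl ((min_le_right _ _).trans (min_le_right _ _))
      ((le_max_right _ _).trans (le_max_right _ _))
      ((le_max_right _ _).trans (le_max_right _ _))) rfl
  rw [← hvval] at e3
  have hglob : ∀ q, |f N q - v.1 q| ≤ m := fun q => by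
    have g1 := hhead.chain.abs_sub_le_of_le (Nat.zero_le N) le_rfl q
    rw [hθ0, hθN] at g1
    have g2 := abs_value_sub_self_le hH u hℓ u.abs_sub_le hs hsr q
    rw [← hvval] at g2
    have g3 : 2 * C * (1 + schemeLip C 0 (1 + ℓ) r) ^ 2 * (r - s) ≤ K₀ * (r - s) := by
      have := schemeLip_mono (s₀ := 0) hC.le (show 1 ≤ 1 + ℓ by linarith) hrt
      have := schemeLip_nonneg (s₀ := 0) hC.le (show 1 ≤ 1 + ℓ by linarith) hr
      have := sub_nonneg.2 hsr
      rw [hK₀def]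
      gcongr
    have g4 : |f N q - u.1 q| ≤ K₀ * (r - s) := g1
    rw [abs_le] at g2 g4 ⊢
    constructor <;> linarith
  obtain ⟨e4, e5⟩ := h₂ r t n (fun j => θ (N + j))
    (schemeChain H C (schemeLip C s (1 + ℓ)) (fun j => θ (N + j)) (f N)) η hr le_rfl
    (by rw [add_zero, hθN]) hθn
    (htail.mono le_rfl le_rfl ((min_le_right _ _).trans (min_le_left _ _))
      ((le_max_left _ _).trans (le_max_right _ _)) ((le_max_left _ _).trans (le_max_right _ _)))
  have e6 := e4 (fun q => by
    have := (abs_le.1 (hglob q)).2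
    change f N q ≤ _
    linarith) (fun q hq => by
    have := (abs_le.1 (e3 q hq)).2
    change f N q ≤ _
    linarith) Q le_rfl
  have e7 := e5 (fun q => by
    have := (abs_le.1 (hglob q)).1
    change _ ≤ f N q + _ + _
    linarith) (fun q hq => by
    have := (abs_le.1 (e3 q hq)).1
    change _ ≤ f N q + _
    linarith) Q le_rfl
  rw [hf, schemeChain_add, ← hf] at e6 e7
  rw [abs_le] at e1 ⊢
  constructor <;> linarith

/-- Samples of the classical solution are an approximate solution, hence close to the value with the
same initial function. -/
theorem viscOp_compatible (hH : HamiltonianBounds H C) : OpCompatible H (viscOp hH) := by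
  intro a b w hab hw ⟨L, hL⟩ s hs t ht hs0 hst v hv
  rw [viscOp_val hH hs0 hst]
  funext Q
  refine eq_of_forall_dist_le fun η hη => ?_
  obtain ⟨ε, hε, K, hK, ρ, hρ, h⟩ := exists_forall_abs_sub_value_le hH v (L := L) (K₀ := L)
    L.coe_nonneg L.coe_nonneg (hs0.trans hst) (norm_nonneg Q) hη
  obtain ⟨δ, hδ, hsol⟩ := hw.exists_approxSol hab hL (ρ := ρ) hε hK.le
  obtain ⟨N, hN⟩ := (eventually_div_le (t - s) hδ).exists
  have h1 := h s t (N + 1) (uniformGrid s t N) _ hs0 le_rfl (uniformGrid_zero s t N)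
    (uniformGrid_last s t N) (hsol (N + 1) _ (fun k hk =>
      Icc_subset_Icc hs.1 ht.2 (uniformGrid_mem_Icc hst hk))
      (fun k _ => uniformGrid_le_succ hst N k) fun k _ => (uniformGrid_succ_sub s t N k).trans_le hN)
    (by rw [uniformGrid_zero, hv]) Q le_rfl
  rw [uniformGrid_last] at h1
  rwa [dist_comm, Real.dist_eq]

theorem viscOp_regular (hH : HamiltonianBounds H C) : OpRegular (viscOp hH) := by
  intro u s hs
  have hC := hH.pos
  have hℓ := u.lipBound_nonneg
  have hlip : ∀ t T, s ≤ t → t ≤ T → ∀ x y, |(viscOp hH s t u).1 x - (viscOp hH s t u).1 y| ≤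
      schemeLip C 0 (1 + u.lipBound) T * ‖x - y‖ := fun t T hst htT x y => by
    rw [viscOp_val hH hs hst]
    refine (abs_value_sub_le hH u hℓ u.abs_sub_le hs hst x y).trans ?_
    gcongr
    exact schemeLip_mono hC.le (by linarith) htT
  refine ⟨fun T hT => ⟨(schemeLip C 0 (1 + u.lipBound) T).toNNReal, fun t ht =>
    LipschitzWith.of_dist_le_mul fun x y => ?_⟩, ?_⟩
  · rw [Real.dist_eq, dist_eq_norm]
    refine (hlip t T ht.1 ht.2 x y).trans ?_
    gcongr
    exact Real.le_coe_toNNReal _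
  · rintro ⟨t₀, Q₀⟩ ⟨ht₀, -⟩
    have hst₀ : s < t₀ := ht₀
    set T := t₀ + 1 with hT
    have hT0 : 0 ≤ T := by linarith
    set ℓ := schemeLip C 0 (1 + u.lipBound) T with hℓdef
    have hℓ0 : 0 ≤ ℓ := schemeLip_nonneg (s₀ := 0) hC.le (by linarith) hT0
    set K₀ := 2 * C * (1 + schemeLip C 0 (1 + ℓ) T) ^ 2 with hK₀def
    have hK₀ : 0 ≤ K₀ := by positivity
    have htime : ∀ t t', s ≤ t → t ≤ t' → t' ≤ T → ∀ Q,
        |(viscOp hH s t' u).1 Q - (viscOp hH s t u).1 Q| ≤ K₀ * (t' - t) := by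
      -- By the Markov property, the value at `t'` is the image of the value at `t` over a time `t'
      -- - t`, which moves a Lipschitz function by `O(t' - t)`.
      intro t t' hst htt' ht'T Q
      rw [viscOp_markov hH s t t' hs hst htt' u, viscOp_val hH (hs.trans hst) htt']
      refine (abs_value_sub_self_le hH (viscOp hH s t u) hℓ0
        (hlip t T hst (htt'.trans ht'T)) (hs.trans hst) htt' Q).trans ?_
      have := schemeLip_mono (s₀ := 0) hC.le (show 1 ≤ 1 + ℓ by linarith) ht'T
      have := schemeLip_nonneg (s₀ := 0) hC.le (show 1 ≤ 1 + ℓ by linarith)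
        (hs.trans (hst.trans htt'))
      have := sub_nonneg.2 htt'
      rw [hK₀def]
      gcongr
    have htime' : ∀ t t', s ≤ t → s ≤ t' → t ≤ T → t' ≤ T → ∀ Q,
        |(viscOp hH s t u).1 Q - (viscOp hH s t' u).1 Q| ≤ K₀ * |t - t'| := by
      intro t t' ht ht' htT ht'T Q
      rcases le_total t t' with h | h
      · rw [abs_sub_comm, abs_sub_comm t, abs_of_nonneg (sub_nonneg.2 h)]
        exact htime t t' ht h ht'T Q
      · rw [abs_of_nonneg (sub_nonneg.2 h)]
        exact htime t' t ht' h htT Q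
    refine ⟨(K₀ + ℓ).toNNReal, (Ioi s ×ˢ univ) ∩ (Iio T ×ˢ univ),
      inter_mem_nhdsWithin _ ((isOpen_Iio.prod isOpen_univ).mem_nhds ⟨by simp [hT], mem_univ _⟩),
      LipschitzOnWith.of_dist_le_mul ?_⟩
    rintro ⟨t, x⟩ ⟨⟨ht1, -⟩, ⟨ht2, -⟩⟩ ⟨t', y⟩ ⟨⟨ht1', -⟩, ⟨ht2', -⟩⟩
    simp only [mem_Ioi, mem_Iio] at ht1 ht2 ht1' ht2'
    rw [Real.coe_toNNReal _ (by positivity), Real.dist_eq, Prod.dist_eq, Real.dist_eq,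
      dist_eq_norm]
    dsimp only
    have h1 := htime' t t' ht1.le ht1'.le ht2.le ht2'.le x
    have h2 := hlip t' T ht1'.le ht2'.le x y
    have h3 := abs_sub_le ((viscOp hH s t u).1 x) ((viscOp hH s t' u).1 x)
      ((viscOp hH s t' u).1 y)
    have h4 : K₀ * |t - t'| ≤ K₀ * max |t - t'| ‖x - y‖ := by gcongr; exact le_max_left _ _
    have h5 : ℓ * ‖x - y‖ ≤ ℓ * max |t - t'| ‖x - y‖ := by gcongr; exact le_max_right _ _
    linarith

theorem isViscosityOperator_viscOp (hH : HamiltonianBounds H C) :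
    IsViscosityOperator H (viscOp hH) where
  monotone := viscOp_monotone hH
  additive := viscOp_additive hH
  regular := viscOp_regular hH
  compatible := viscOp_compatible hH
  markov := viscOp_markov hH

/-- Every viscosity operator is the limit of the scheme. -/
theorem IsViscosityOperator.eq_viscOp (hH : HamiltonianBounds H C) {W : OpFamily d}
    (hW : IsViscosityOperator H W) {s t : ℝ} (hs : 0 ≤ s) (hst : s ≤ t) :
    W s t = viscOp hH s t := by
  funext u
  refine Subtype.ext (funext fun Q => ?_)
  rw [viscOp_val hH hs hst]
  have hC := hH.pos
  have htest : TestVariational H C W := hW.compatible.testVariational hH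
  have hW0 : W s s u = u := by
    refine Subtype.ext (funext fun q => ?_)
    have h := htest.abs_sub_le_mul hH hW.monotone hW.additive hs le_rfl u.lipBound_nonneg
      (by simp) u.abs_sub_le q
    rw [sub_self, mul_zero] at h
    exact sub_eq_zero.1 (abs_nonpos_iff.1 h)
  -- Regularity provides one slope bound for the whole interval; with the Markov property, the
  -- values of `W` on any grid form an iteration of `W`.
  obtain ⟨L, hL⟩ := (hW.regular u s hs).1 t hst
  refine eq_of_forall_dist_le fun η hη => ?_
  obtain ⟨ε, hε, K, hK, ρ, hρ, h⟩ := exists_forall_abs_sub_value_le hH u (L := L)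
    (K₀ := (32 * (L : ℝ) ^ 2 + 11) * C) L.coe_nonneg (by positivity) (hs.trans hst)
    (norm_nonneg Q) hη
  obtain ⟨δ, hδ, hsol⟩ := exists_approxSol_of_testVariational hH (T := t) (ρ := ρ) L.coe_nonneg
    hε hK.le
  obtain ⟨N, hN⟩ := (eventually_div_le (t - s) hδ).exists
  have hmem : ∀ k ≤ N + 1, uniformGrid s t N k ∈ Icc s t := fun k hk =>
    uniformGrid_mem_Icc hst hk
  have h1 := h s t (N + 1) (uniformGrid s t N) _ hs le_rfl (uniformGrid_zero s t N)
    (uniformGrid_last s t N) (hsol W htest hW.monotone hW.additive (N + 1) (uniformGrid s t N)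
      (fun k => W s (uniformGrid s t N k) u) (by rwa [uniformGrid_zero])
      (uniformGrid_last s t N).le (fun k _ => uniformGrid_le_succ hst N k)
      (fun k _ => (uniformGrid_succ_sub s t N k).trans_le hN)
      (fun k hk x y => by
        have := (hL _ (hmem k hk)).dist_le_mul x y
        rwa [Real.dist_eq, dist_eq_norm] at this)
      (fun k hk => hW.markov s _ _ hs (hmem k hk.le).1 (uniformGrid_le_succ hst N k) u))
    (by rw [uniformGrid_zero, hW0]) Q le_rfl
  rw [uniformGrid_last] at h1
  rwa [Real.dist_eq]

end ViscosityOperator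

/-! ### Convergence of iterated variational operators -/

section Convergence

variable {d : ℕ} {H : ℝ → Eucl d → Eucl d → ℝ} {C : ℝ}

/-- The subdivision `τ` from the index `j` on, clamped to `[s, t]`. -/
noncomputable def clampedGrid (τ : ℕ → ℝ) (s t : ℝ) (j k : ℕ) : ℝ := max s (min t (τ (j + k)))

theorem clampedGrid_le_succ {τ : ℕ → ℝ} (hτ : Monotone τ) (s t : ℝ) (j k : ℕ) :
    clampedGrid τ s t j k ≤ clampedGrid τ s t j (k + 1) :=
  max_le_max le_rfl (min_le_min le_rfl (hτ (by omega)))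

theorem clampedGrid_succ_sub_le {τ : ℕ → ℝ} (hτ : Monotone τ) (s t : ℝ) (j k : ℕ) :
    clampedGrid τ s t j (k + 1) - clampedGrid τ s t j k ≤ τ (j + k + 1) - τ (j + k) := by
  have h : τ (j + k) ≤ τ (j + k + 1) := hτ (by omega)
  have e : j + (k + 1) = j + k + 1 := by omega
  rw [clampedGrid, clampedGrid, e, sub_le_iff_le_add]
  refine max_le ?_ ?_
  · linarith [le_max_left s (min t (τ (j + k)))]
  · have h1 := le_max_right s (min t (τ (j + k)))
    rcases min_choice t (τ (j + k)) with h2 | h2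
    · linarith [min_le_left t (τ (j + k + 1))]
    · linarith [min_le_right t (τ (j + k + 1))]

theorem clampedGrid_zero {τ : ℕ → ℝ} {s : ℝ} {j : ℕ} (hj : τ j ≤ s) (t : ℝ) :
    clampedGrid τ s t j 0 = s :=
  max_eq_left ((min_le_right _ _).trans hj)

theorem clampedGrid_of_mem_Icc {τ : ℕ → ℝ} {s t : ℝ} {j k : ℕ} (h : τ (j + k) ∈ Icc s t) :
    clampedGrid τ s t j k = τ (j + k) := by
  rw [clampedGrid, min_eq_right h.2, max_eq_right h.1]

theorem clampedGrid_of_le {τ : ℕ → ℝ} {s t : ℝ} {j k : ℕ} (hst : s ≤ t) (h : t ≤ τ (j + k)) :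
    clampedGrid τ s t j k = t := by
  rw [clampedGrid, min_eq_left h, max_eq_right hst]

theorem LipschitzEstimates.abs_sub_le {R : OpFamily d} (hR : LipschitzEstimates C R) {L : ℝ}
    (hL : 0 ≤ L) {u : LipFun d} (hu : ∀ x y, |u.1 x - u.1 y| ≤ L * ‖x - y‖) {s t : ℝ}
    (hs : 0 ≤ s) (hst : s ≤ t) (x y : Eucl d) :
    |(R s t u).1 x - (R s t u).1 y| ≤ (Real.exp (C * (t - s)) * (1 + L) - 1) * ‖x - y‖ := by
  have h : LipschitzWith ⟨L, hL⟩ u.1 := LipschitzWith.of_dist_le_mul fun x y => by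
    rw [Real.dist_eq, dist_eq_norm]
    exact hu x y
  exact hR.space ⟨L, hL⟩ u h s t hs hst x y

/-- Iterated variational operators on fine subdivisions are close to the value. -/
theorem exists_forall_abs_iteratedOp_sub_value_le (hH : HamiltonianBounds H C) {R : OpFamily d}
    (hR : IsVariationalOperator H R) (hRL : LipschitzEstimates C R) (u : LipFun d) {T ρ₀ η : ℝ}
    (hT : 0 ≤ T) (hρ₀ : 0 ≤ ρ₀) (hη : 0 < η) :
    ∃ δ > 0, ∀ τ : ℕ → ℝ, IsSubdivision τ → (∀ i, τ (i + 1) - τ i ≤ δ) →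
      ∀ (s t : ℝ) (Q : Eucl d), 0 ≤ s → s ≤ t → t ≤ T → ‖Q‖ ≤ ρ₀ →
        |(iteratedOp R τ s t u).1 Q - value H C u s t Q| ≤ η := by
  have hC := hH.pos
  have hℓ := u.lipBound_nonneg
  set ℓ := u.lipBound with hℓdef
  set L := Real.exp (C * T) * (1 + ℓ) - 1 with hLdef
  have hL : 0 ≤ L := by
    have : 1 ≤ Real.exp (C * T) := Real.one_le_exp (by positivity)
    nlinarith
  obtain ⟨ε, hε, K, hK, ρ, hρ, h⟩ := exists_forall_abs_sub_value_le hH u hL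
    (K₀ := (32 * L ^ 2 + 11) * C) (by positivity) hT hρ₀ hη
  obtain ⟨δ, hδ, hsol⟩ := exists_approxSol_of_testVariational hH (T := T) (ρ := ρ) hL hε hK.le
  refine ⟨δ, hδ, fun τ hτ hmesh s t Q hs hst htT hQ => ?_⟩
  set j := gridIndex τ s with hj
  set n := gridIndex τ t - j with hn
  obtain ⟨hj1, hj2⟩ := gridIndex_spec hτ hs
  obtain ⟨ht1, ht2⟩ := gridIndex_spec hτ (hs.trans hst)
  rw [← hj] at hj1 hj2
  have hjt : j ≤ gridIndex τ t := by
    by_contra hlt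
    have h1 : gridIndex τ t + 1 ≤ j := by omega
    have := hτ.monotone h1
    linarith
  have hjn : j + n = gridIndex τ t := by omega
  rw [← hjn] at ht1 ht2
  -- Clamping turns `s` and `t` into grid points, so the incomplete first and last steps are steps
  -- of the chain.
  set θ := clampedGrid τ s t j with hθ
  have hθ0 : θ 0 = s := clampedGrid_zero hj1 t
  have hθn : θ (n + 1) = t := clampedGrid_of_le hst ht2.le
  have hθk : ∀ k < n, θ (k + 1) = τ (j + k + 1) := fun k hk =>
    clampedGrid_of_mem_Icc (k := k + 1) ⟨hj2.le.trans (hτ.monotone (by omega)),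
      (hτ.monotone (by omega)).trans ht1⟩
  have hmono : ∀ k, θ k ≤ θ (k + 1) := clampedGrid_le_succ hτ.monotone s t j
  have hθs : ∀ k, s ≤ θ k := fun k => le_max_left _ _
  have hθT : ∀ k, θ k ≤ T := fun k => (max_le hst (min_le_left _ _)).trans htT
  -- Indices are shifted by one: `F (k + 1)` is the iteration with `k` intermediate times, and `F (n
  -- + 1)` is the iterated operator at `t`.
  set F : ℕ → LipFun d := fun k => match k with
    | 0 => u
    | k + 1 => iterSteps R τ s j u k (θ (k + 1)) with hF
  have hstep : ∀ k < n + 1, F (k + 1) = R (θ k) (θ (k + 1)) (F k) := by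
    intro k hk
    cases k with
    | zero =>
      simp only [hF]
      rw [hθ0]
      rfl
    | succ k =>
      simp only [hF]
      rw [hθk k (by omega)]
      rfl
  have hLk0 : ∀ k, 0 ≤ Real.exp (C * (θ k - s)) * (1 + ℓ) - 1 := fun k => by
    have : 1 ≤ Real.exp (C * (θ k - s)) :=
      Real.one_le_exp (mul_nonneg hC.le (sub_nonneg.2 (hθs k)))
    nlinarith
  have hlip : ∀ k ≤ n + 1, ∀ x y, |(F k).1 x - (F k).1 y| ≤
      (Real.exp (C * (θ k - s)) * (1 + ℓ) - 1) * ‖x - y‖ := by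
    intro k
    induction k with
    | zero =>
      intro _ x y
      rw [hθ0]
      simpa [hF] using u.abs_sub_le x y
    | succ k ih =>
      intro hk x y
      rw [hstep k (by omega)]
      refine (hRL.abs_sub_le (hLk0 k) (ih (by omega)) (hs.trans (hθs k)) (hmono k) x y).trans
        (le_of_eq ?_)
      -- Each step multiplies one plus the slope bound by an exponential, so the bound depends on
      -- the elapsed time and not on the number of steps.
      rw [add_sub_cancel, ← mul_assoc, ← Real.exp_add, ← mul_add, sub_add_sub_cancel]
  have hsolF := hsol R hR.variational.testVariational hR.monotone hR.additive (n + 1) θ F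
    (by rwa [hθ0]) (hθT _) (fun k _ => hmono k)
    (fun k _ => (clampedGrid_succ_sub_le hτ.monotone s t j k).trans (hmesh (j + k)))
    (fun k hk x y => (hlip k hk x y).trans (by
      rw [hLdef]
      gcongr
      have := hθT k
      linarith)) hstep
  have h1 := h s t (n + 1) θ _ hs htT hθ0 hθn hsolF rfl Q hQ
  simp only [hF] at h1
  rw [hθn] at h1
  exact h1

theorem tendstoUniformlyOn_iteratedOp (hH : HamiltonianBounds H C) {R : OpFamily d}
    (hR : IsVariationalOperator H R) (hRL : LipschitzEstimates C R) {τ : ℕ → ℕ → ℝ} {δ : ℕ → ℝ}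
    (hτ : ∀ N, IsSubdivision (τ N)) (hδ : ∀ N i, τ N (i + 1) - τ N i ≤ δ N)
    (hδ0 : Tendsto δ atTop (𝓝 0)) (u : LipFun d) {K : Set (ℝ × ℝ × Eucl d)} (hK : IsCompact K)
    (hK0 : K ⊆ {x | 0 ≤ x.1 ∧ x.1 ≤ x.2.1}) :
    TendstoUniformlyOn (fun N x => (iteratedOp R (τ N) x.1 x.2.1 u).1 x.2.2)
      (fun x => (viscOp hH x.1 x.2.1 u).1 x.2.2) atTop K := by
  rw [Metric.tendstoUniformlyOn_iff]
  intro η hη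
  obtain ⟨r, hr, hKr⟩ := hK.isBounded.exists_pos_norm_le
  obtain ⟨δ', hδ', h⟩ := exists_forall_abs_iteratedOp_sub_value_le hH hR hRL u hr.le hr.le
    (half_pos hη)
  filter_upwards [hδ0.eventually (eventually_le_nhds hδ')] with N hN
  rintro ⟨s, t, Q⟩ hx
  obtain ⟨hs, hst⟩ := hK0 hx
  have h1 := hKr _ hx
  have h2 : ‖(t, Q)‖ ≤ r := (norm_snd_le (s, t, Q)).trans h1
  dsimp only at hs hst ⊢
  rw [dist_comm, Real.dist_eq, viscOp_val hH hs hst]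
  exact (h (τ N) (hτ N) (fun i => (hδ N i).trans hN) s t Q hs hst
    (((le_abs_self t).trans (norm_fst_le (t, Q))).trans h2)
    ((norm_snd_le (t, Q)).trans h2)).trans_lt (half_lt_self hη)

end Convergence

theorem mainTheorem2 (d : ℕ) (H : ℝ → Eucl d → Eucl d → ℝ) (C : ℝ)
    (hH : HamiltonianBounds H C) :
    ∃ V : OpFamily d,
      IsViscosityOperator H V ∧
      (∀ W : OpFamily d, IsViscosityOperator H W → ∀ s t : ℝ, 0 ≤ s → s ≤ t → W s t = V s t) ∧
      ∀ R : OpFamily d, IsVariationalOperator H R → LipschitzEstimates C R →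
        ∀ (τ : ℕ → ℕ → ℝ) (δ : ℕ → ℝ), (∀ N, IsSubdivision (τ N)) →
          (∀ N i, τ N (i + 1) - τ N i ≤ δ N) → Tendsto δ atTop (𝓝 0) →
          (∀ s t : ℝ, 0 ≤ s → s ≤ t → ∀ (u : LipFun d) (Q : Eucl d),
            Tendsto (fun N => (iteratedOp R (τ N) s t u).1 Q) atTop (𝓝 ((V s t u).1 Q))) ∧
          (∀ u : LipFun d, ∀ K : Set (ℝ × ℝ × Eucl d), IsCompact K →
            K ⊆ {x | 0 ≤ x.1 ∧ x.1 ≤ x.2.1} →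
            TendstoUniformlyOn
              (fun N x => (iteratedOp R (τ N) x.1 x.2.1 u).1 x.2.2)
              (fun x => (V x.1 x.2.1 u).1 x.2.2) atTop K) := by
  refine ⟨viscOp hH, isViscosityOperator_viscOp hH,
    fun W hW s t hs hst => hW.eq_viscOp hH hs hst, ?_⟩
  intro R hR hRL τ δ hτ hδ hδ0
  have key := fun (u : LipFun d) (K : Set (ℝ × ℝ × Eucl d)) (hK : IsCompact K)
      (hK0 : K ⊆ {x | 0 ≤ x.1 ∧ x.1 ≤ x.2.1}) =>
    tendstoUniformlyOn_iteratedOp hH hR hRL hτ hδ hδ0 u hK hK0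
  refine ⟨fun s t hs hst u Q => ?_, key⟩
  -- Pointwise convergence is uniform convergence on a singleton.
  exact (key u {(s, t, Q)} isCompact_singleton (by
    rintro _ rfl
    exact ⟨hs, hst⟩)).tendsto_at (mem_singleton (s, t, Q))
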